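/- **Setting.** Let $(X,\mathrm{dist})$ be a metric space with $n\ge 1$ points, let $k\ge 1$ be an integer and $0<\varepsilon\le \tfrac12$. A *clustering* is a partition $\mathcal C$ of $X$ into nonempty clusters, and its cost is $\sum_{C\in\mathcal C}\operatorname{diam}(C)$. A constraint $F$ on clusterings is given; a *solution* is a clustering with at most $k$ clusters that satisfies $F$. The problem (mergeable min-sum diameters, MSD) is *mergeable* if merging any two clusters of a solution yields a solution. A *$(1+\varepsilon)$-approximation* is a solution whose cost is at most $(1+\varepsilon)$ times the cost of every solution. Let $d$ be the doubling dimension of $X$: the least $m\ge 0$ such that every closed ball of radius $r$ is covered by at most $2^m$ closed balls of radius $r/2$. Running times are those of a deterministic program, one for all inputs, on a real RAM (unit-cost arithmetic and comparisons of reals, without rounding; unit-cost addition, subtraction and comparison of natural numbers; indirect addressing; a distance is read in one step). The constraint $F$ is accessible through a validation procedure that, given a clustering as a list of $n$ labels, decides $F$ in time $f(n)$, where $f(n)\ge n$. **Theorem.** 1. There are a program and a constant $c$ such that, for every input whose problem is mergeable, the program outputs a $(1+\varepsilon)$-approximation if a solution exists, and otherwise reports that there is none, in time at most $$\left(\tfrac1\varepsilon\right)^{c\,kd}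 f(n) + 2^{c\,d}\, n\log n + c\,k\, f(n).$$ 2. In particular, this applies to fair (balanced) MSD: the input also contains a partition of $X$ into two colour classes $X_1,X_2$ and a number $b\in[0,1]$, and a clustering is feasible if each of its clusters $C$ satisfies $\min\left\{\frac{|C\cap X_2|}{|C\cap X_1|},\frac{|C\cap X_1|}{|C\cap X_2|}\right\}\ge b$ (the minimum being $0$ if $C$ has only one colour). There are a program, which uses no external validation procedure, and a constant $c$ such that, for every such input, the program outputs a $(1+\varepsilon)$-approximation if a solution exists, and otherwise reports that there is none, in time at most $$\left(\tfrac1\varepsilon\right)^{c\,kd} n + 2^{c\,d}\, n\log n + c\,k\,n.$$ -/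

import Mathlib

namespace MSD

/-! ### A real RAM

Two random access memories, one of natural numbers and one of real numbers.  Natural numbers
can be added, subtracted and compared (no multiplication), reals can be added, subtracted,
multiplied, divided and compared (no rounding).  The input metric is read one distance at a time.
Every elementary operation and every test takes one unit of time; one call of the validation
procedure takes the time that the input prescribes for it. -/

/-- Contents of the two memories. -/
structure State where
  nat : ℕ → ℕ
  real : ℕ → ℝ

/-- An operand: the cell with a fixed address, or the cell whose address is stored in
a fixed cell of the memory of natural numbers. -/
inductive Ref where
  | dir (a : ℕ)
  | ind (a : ℕ)

def Ref.addr (σ : State) : Ref → ℕ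
  | .dir a => a
  | .ind a => σ.nat a

def State.getN (σ : State) (r : Ref) : ℕ := σ.nat (r.addr σ)

noncomputable def State.getR (σ : State) (r : Ref) : ℝ := σ.real (r.addr σ)

def State.setN (σ : State) (r : Ref) (v : ℕ) : State :=
  { σ with nat := Function.update σ.nat (r.addr σ) v }

noncomputable def State.setR (σ : State) (r : Ref) (v : ℝ) : State :=
  { σ with real := Function.update σ.real (r.addr σ) v }

/-- The data outside the memories that a program can consult: the distance of the points with
numbers `i` and `j`, the colour of the point with number `i`, and a validation procedure, which
is handed a clustering as a list of labels (label `ℓ i` for the point with number `i`). -/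
structure Env where
  dist : ℕ → ℕ → ℝ
  color : ℕ → ℕ
  valid : (ℕ → ℕ) → Prop
  validTime : ℕ

/-- Elementary operations; the first argument is where the result is stored. -/
inductive Op where
  | constN (dst : Ref) (c : ℕ)
  | copyN (dst a : Ref)
  | addN (dst a b : Ref)
  | subN (dst a b : Ref)
  | copyR (dst a : Ref)
  | natCastR (dst a : Ref)
  | addR (dst a b : Ref)
  | subR (dst a b : Ref)
  | mulR (dst a b : Ref)
  | divR (dst a b : Ref)
  | dist (dst a b : Ref)
  | color (dst a : Ref)
  /-- Validate the labels stored in the consecutive cells that start at the address held in `a`. -/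
  | validate (dst a : Ref)

open Classical in
noncomputable def Op.apply (E : Env) (σ : State) : Op → State
  | .constN dst c => σ.setN dst c
  | .copyN dst a => σ.setN dst (σ.getN a)
  | .addN dst a b => σ.setN dst (σ.getN a + σ.getN b)
  | .subN dst a b => σ.setN dst (σ.getN a - σ.getN b)
  | .copyR dst a => σ.setR dst (σ.getR a)
  | .natCastR dst a => σ.setR dst (σ.getN a : ℝ)
  | .addR dst a b => σ.setR dst (σ.getR a + σ.getR b)
  | .subR dst a b => σ.setR dst (σ.getR a - σ.getR b)
  | .mulR dst a b => σ.setR dst (σ.getR a * σ.getR b)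
  | .divR dst a b => σ.setR dst (σ.getR a / σ.getR b)
  | .dist dst a b => σ.setR dst (E.dist (σ.getN a) (σ.getN b))
  | .color dst a => σ.setN dst (E.color (σ.getN a))
  | .validate dst a =>
      σ.setN dst (if E.valid (fun i => σ.nat (σ.getN a + i)) then 1 else 0)

def Op.time (E : Env) : Op → ℕ
  | .validate _ _ => E.validTime
  | _ => 1

inductive Test where
  | ltN (a b : Ref)
  | eqN (a b : Ref)
  | ltR (a b : Ref)
  | leR (a b : Ref)

def Test.holds (σ : State) : Test → Prop
  | .ltN a b => σ.getN a < σ.getN b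
  | .eqN a b => σ.getN a = σ.getN b
  | .ltR a b => σ.getR a < σ.getR b
  | .leR a b => σ.getR a ≤ σ.getR b

/-- Programs. -/
inductive Prog where
  | skip
  | op (o : Op)
  | seq (p q : Prog)
  | ite (c : Test) (p q : Prog)
  | loop (c : Test) (p : Prog)

/-- `Exec E p σ t σ'`: started in `σ`, the program `p` halts in `σ'` after time `t`. -/
inductive Exec (E : Env) : Prog → State → ℕ → State → Prop
  | skip (σ : State) : Exec E .skip σ 0 σ
  | op (o : Op) (σ : State) : Exec E (.op o) σ (o.time E) (o.apply E σ)
  | seq {p q : Prog} {σ σ' σ'' : State} {s t : ℕ} :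
      Exec E p σ s σ' → Exec E q σ' t σ'' → Exec E (.seq p q) σ (s + t) σ''
  | iteTrue {c : Test} {p q : Prog} {σ σ' : State} {t : ℕ} :
      c.holds σ → Exec E p σ t σ' → Exec E (.ite c p q) σ (1 + t) σ'
  | iteFalse {c : Test} {p q : Prog} {σ σ' : State} {t : ℕ} :
      ¬ c.holds σ → Exec E q σ t σ' → Exec E (.ite c p q) σ (1 + t) σ'
  | loopTrue {c : Test} {p : Prog} {σ σ' σ'' : State} {s t : ℕ} :
      c.holds σ → Exec E p σ s σ' → Exec E (.loop c p) σ' t σ'' →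
        Exec E (.loop c p) σ (1 + s + t) σ''
  | loopFalse {c : Test} {p : Prog} {σ : State} :
      ¬ c.holds σ → Exec E (.loop c p) σ 1 σ

/-- The program never calls the validation procedure of its environment. -/
def Prog.OracleFree : Prog → Prop
  | .skip => True
  | .op (.validate _ _) => False
  | .op _ => True
  | .seq p q => p.OracleFree ∧ q.OracleFree
  | .ite _ p q => p.OracleFree ∧ q.OracleFree
  | .loop _ p => p.OracleFree

/-- Initial memory: `n` and `k` in the first two cells for natural numbers, `ε` and `b` in
the first two cells for reals, and zeros elsewhere. -/
noncomputable def initState (n k : ℕ) (ε b : ℝ) : State where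
  nat := fun a => if a = 0 then n else if a = 1 then k else 0
  real := fun a => if a = 0 then ε else if a = 1 then b else 0

/-! ### Clusterings -/

section Clustering

variable {X : Type*} [Fintype X] [DecidableEq X]

/-- A clustering: a partition of the space into nonempty, pairwise disjoint clusters. -/
abbrev Clustering (X : Type*) [Fintype X] [DecidableEq X] : Type _ :=
  Finpartition (Finset.univ : Finset X)

/-- The sum of the diameters of the clusters. -/
noncomputable def cost [MetricSpace X] (𝒞 : Clustering X) : ℝ :=
  ∑ C ∈ 𝒞.parts, Metric.diam (C : Set X)

/-- `𝒞'` arises from `𝒞` by merging two of its clusters. -/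
def IsMerge (𝒞 𝒞' : Clustering X) : Prop :=
  ∃ A ∈ 𝒞.parts, ∃ B ∈ 𝒞.parts, A ≠ B ∧
    𝒞'.parts = insert (A ∪ B) ((𝒞.parts.erase A).erase B)

/-- A solution: a clustering with at most `k` clusters that satisfies the constraint `F`. -/
def IsSolution (F : Clustering X → Prop) (k : ℕ) (𝒞 : Clustering X) : Prop :=
  𝒞.parts.card ≤ k ∧ F 𝒞

/-- Merging two clusters of a solution yields a solution. -/
def Mergeable (F : Clustering X → Prop) (k : ℕ) : Prop :=
  ∀ 𝒞 𝒞' : Clustering X, IsSolution F k 𝒞 → IsMerge 𝒞 𝒞' → IsSolution F k 𝒞'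

/-- A solution whose cost is at most `1 + ε` times that of every solution. -/
def IsApproxSolution [MetricSpace X] (F : Clustering X → Prop) (k : ℕ) (ε : ℝ)
    (𝒞 : Clustering X) : Prop :=
  IsSolution F k 𝒞 ∧ ∀ 𝒞', IsSolution F k 𝒞' → cost 𝒞 ≤ (1 + ε) * cost 𝒞'

/-- Every cluster is `b`-balanced for the colours `X₁`, `X₂`.  In a cluster of one colour one
of the ratios is `0` and the other has denominator `0`; the minimum is then `0`, as it should. -/
def Balanced (X₁ X₂ : Finset X) (b : ℝ) (𝒞 : Clustering X) : Prop :=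
  ∀ C ∈ 𝒞.parts,
    b ≤ min (((C ∩ X₂).card : ℝ) / ((C ∩ X₁).card : ℝ))
      (((C ∩ X₁).card : ℝ) / ((C ∩ X₂).card : ℝ))

open Classical in
/-- The clustering in which two points share a cluster iff they have the same label. -/
noncomputable def ofLabels {n : ℕ} (pt : Fin n ≃ X) (ℓ : ℕ → ℕ) : Clustering X :=
  Finpartition.ofSetoid (Setoid.ker fun x => ℓ (pt.symm x : ℕ))

/-- The environment that presents the points of `X`, numbered by `pt`. -/
noncomputable def env [MetricSpace X] {n : ℕ} (pt : Fin n ≃ X) (color : X → ℕ)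
    (F : Clustering X → Prop) (time : ℕ) : Env where
  dist := fun i j => if h : i < n ∧ j < n then dist (pt ⟨i, h.1⟩) (pt ⟨j, h.2⟩) else 0
  color := fun i => if h : i < n then color (pt ⟨i, h⟩) else 0
  valid := fun ℓ => F (ofLabels pt ℓ)
  validTime := time

/-- The final memory holds a correct answer.  Cell `0` says whether there is a solution; if so,
cell `1` holds the address of the first of the `n` consecutive labels of a `(1 + ε)`-approximate
solution. -/
def Answers [MetricSpace X] {n : ℕ} (pt : Fin n ≃ X) (F : Clustering X → Prop) (k : ℕ) (ε : ℝ)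
    (σ : State) : Prop :=
  ((∃ 𝒞, IsSolution F k 𝒞) →
    σ.nat 0 = 1 ∧ IsApproxSolution F k ε (ofLabels pt fun i => σ.nat (σ.nat 1 + i))) ∧
  ((¬ ∃ 𝒞, IsSolution F k 𝒞) → σ.nat 0 = 0)

end Clustering

/-- The doubling dimension: the least `m` such that every ball of radius `r` is covered by at
most `2 ^ m` balls of radius `r / 2`. -/
noncomputable def doublingDim (X : Type*) [MetricSpace X] : ℝ :=
  sInf {m : ℝ | 0 ≤ m ∧ ∀ (x : X) (r : ℝ), 0 ≤ r → ∃ s : Finset X, (s.card : ℝ) ≤ 2 ^ m ∧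
    Metric.closedBall x r ⊆ ⋃ y ∈ s, Metric.closedBall y (r / 2)}

end MSD

namespace MSD

set_option linter.constructorNameAsVariable false
set_option linter.unusedSectionVars false
set_option linter.unusedSimpArgs false

/-! ### Structured programs with named registers and arrays -/

/-! Mergeability makes every clustering coarser than a solution a solution itself
(`IsSolution.of_le`). So it suffices to list a moderate number of clusterings among which, for every
solution `𝒞`, there is one that splits no cluster of `𝒞` and costs at most `(1 + ε) * cost 𝒞`. Each
listed clustering is validated, and the valid one with the best cost bound is kept.

Scale. Farthest-first traversal yields `k` centers that cover the space within some `R`, and one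
further point, all at mutual distance at least `R`; hence `R` is at most the cost of every
clustering with at most `k` clusters. Up to `2 * R`, the largest diameter in `𝒞` is a distance of
two centers, and the cost is at most `k` times that diameter. So one of `k * k * (k + 2)` numbers
`g` lies between `cost 𝒞` and `4 * cost 𝒞` (`exists_scale`). For this `g`, put `δ = ε * g / (k *
32)` and pass to a greedy `δ`-net, whose size is bounded by packing (`Centers.card_separated_le`).

Code. Clusterings of the net are grown from a single class by ball cuts. Let `p` be an end point of
a diameter `H` of a class. Seen from `p`, the clusters of `𝒞` in this class occupy intervals of
distances in `[0, H]`. If `H` is at most the total length of these intervals, up to a few `δ` per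
cluster, then leaving the class whole is cheap. Otherwise some multiple of `δ`, measured from `0` or
from `H`, lies in a gap (`exists_gap`), and the cut at this radius splits no cluster. The point `p`
is determined by the class, so a cut is encoded by the binary digits of one number `t`, which is at
most the weight of either side. By this small-to-large charging all cuts together need `O(k * e)`
digits, where `2 ^ e` is about `1 / ε` (`codeLen_add`, `exists_word`). Hence running through `5 ^
(64 * (k * e))` strings, without knowing `𝒞`, meets a good coarsening of every solution at this
scale (`IsNet.exists_digits`).

Machine. The program is written with named registers and arrays and compiled to the real RAM
(`Rep.instr`); correctness and time are proved with the total-correctness triples `Does`. With two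
or more points the doubling dimension is at least `1` (`one_le_doublingDim`), so `k`, `e`, the net
and the number of strings are all bounded by powers of `(1 / ε) ^ (k * d)`. With one point the
program replaces `k` and `ε` by constants. Balancedness is a pair of linear inequalities between
colour counts, hence mergeable (`mergeable_balanced`), and it is checked by counting. -/

/-- Registers for natural numbers. -/
inductive NReg
  | n | k | e | len | j | j1 | x | i | c | c2 | far | kp2 | i1 | i2 | l | m | u | w | fnd | av
  | cur | cnt | pu | pw | p | d | tc | it | carry | zero | one | four | ok | found | done
  | n1 | n2 | col
  deriving DecidableEq

/-- Registers for real numbers. -/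
inductive RReg
  | eps | b | rad | mn | y | del | g | rr | ub | hh | best | krr | z | q1 | q2 | q3
  deriving DecidableEq

/-- Arrays of natural numbers. -/
inductive Arr
  | cen | net | asg | part | lab | blab | dig
  deriving DecidableEq

/-- A memory made of named registers and arrays. -/
structure HState where
  v : NReg → ℕ
  r : RReg → ℝ
  a : Arr → ℕ → ℕ

inductive Instr
  | constN (x : NReg) (c : ℕ)
  | copyN (x y : NReg)
  | addN (x y z : NReg)
  | inc (x : NReg)
  | load (x : NReg) (A : Arr) (i : NReg)
  | store (A : Arr) (i x : NReg)
  | constR (x : RReg) (c : ℕ)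
  | castR (x : RReg) (y : NReg)
  | copyR (x y : RReg)
  | addR (x y z : RReg)
  | subR (x y z : RReg)
  | mulR (x y z : RReg)
  | divR (x y z : RReg)
  | dist (x : RReg) (y z : NReg)
  | color (x y : NReg)
  | validate (x : NReg)

open Classical in
noncomputable def Instr.run (E : Env) : Instr → HState → HState
  | constN x c, s => { s with v := Function.update s.v x c }
  | copyN x y, s => { s with v := Function.update s.v x (s.v y) }
  | addN x y z, s => { s with v := Function.update s.v x (s.v y + s.v z) }
  | inc x, s => { s with v := Function.update s.v x (s.v x + 1) }
  | load x A i, s => { s with v := Function.update s.v x (s.a A (s.v i)) }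
  | store A i x, s =>
      { s with a := Function.update s.a A (Function.update (s.a A) (s.v i) (s.v x)) }
  | constR x c, s => { s with r := Function.update s.r x (c : ℝ) }
  | castR x y, s => { s with r := Function.update s.r x (s.v y : ℝ) }
  | copyR x y, s => { s with r := Function.update s.r x (s.r y) }
  | addR x y z, s => { s with r := Function.update s.r x (s.r y + s.r z) }
  | subR x y z, s => { s with r := Function.update s.r x (s.r y - s.r z) }
  | mulR x y z, s => { s with r := Function.update s.r x (s.r y * s.r z) }
  | divR x y z, s => { s with r := Function.update s.r x (s.r y / s.r z) }
  | dist x y z, s => { s with r := Function.update s.r x (E.dist (s.v y) (s.v z)) }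
  | color x y, s => { s with v := Function.update s.v x (E.color (s.v y)) }
  | validate x, s => { s with v := Function.update s.v x (if E.valid (s.a .lab) then 1 else 0) }

/-- All arrays but `dig` have `S` cells. -/
def Instr.ok (S : ℕ) : Instr → HState → Prop
  | load _ A i, s => A = .dig ∨ s.v i < S
  | store A i _, s => A = .dig ∨ s.v i < S
  | _, _ => True

/-- Apart from validation, an instruction compiles to at most two elementary operations. -/
def Instr.time (E : Env) : Instr → ℕ
  | validate _ => E.validTime
  | _ => 2

/-- The write sets are computable, so that a frame condition for a concrete program is proved by
`rfl`. -/
def Instr.wN : Instr → NReg → Bool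
  | constN x _, r | copyN x _, r | addN x _ _, r | inc x, r | load x _ _, r | color x _, r
  | validate x, r => decide (x = r)
  | _, _ => false

def Instr.wR : Instr → RReg → Bool
  | constR x _, r | castR x _, r | copyR x _, r | addR x _ _, r | subR x _ _, r
  | mulR x _ _, r | divR x _ _, r | dist x _ _, r => decide (x = r)
  | _, _ => false

def Instr.wA : Instr → Arr → Bool
  | store A _ _, B => decide (A = B)
  | _, _ => false

noncomputable def runAll (E : Env) : List Instr → HState → HState
  | [], s => s
  | i :: l, s => runAll E l (i.run E s)

def okAll (E : Env) (S : ℕ) : List Instr → HState → Prop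
  | [], _ => True
  | i :: l, s => i.ok S s ∧ okAll E S l (i.run E s)

def timeAll (E : Env) : List Instr → ℕ
  | [] => 0
  | i :: l => i.time E + timeAll E l

inductive HTest
  | ltN (x y : NReg)
  | eqN (x y : NReg)
  | ltR (x y : RReg)
  | leR (x y : RReg)

def HTest.holds : HTest → HState → Prop
  | ltN x y, s => s.v x < s.v y
  | eqN x y, s => s.v x = s.v y
  | ltR x y, s => s.r x < s.r y
  | leR x y, s => s.r x ≤ s.r y

inductive Cmd
  | ops (l : List Instr)
  | seq (p q : Cmd)
  | ite (c : HTest) (p q : Cmd)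
  | loop (c : HTest) (p : Cmd)

infixr:60 " ;; " => Cmd.seq

def Cmd.skip : Cmd := .ops []

def Cmd.wN : Cmd → NReg → Bool
  | .ops l, r => l.any fun i => i.wN r
  | .seq p q, r => p.wN r || q.wN r
  | .ite _ p q, r => p.wN r || q.wN r
  | .loop _ p, r => p.wN r

def Cmd.wR : Cmd → RReg → Bool
  | .ops l, r => l.any fun i => i.wR r
  | .seq p q, r => p.wR r || q.wR r
  | .ite _ p q, r => p.wR r || q.wR r
  | .loop _ p, r => p.wR r

def Cmd.wA : Cmd → Arr → Bool
  | .ops l, r => l.any fun i => i.wA r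
  | .seq p q, r => p.wA r || q.wA r
  | .ite _ p q, r => p.wA r || q.wA r
  | .loop _ p, r => p.wA r

/-- `s'` agrees with `s` wherever `p` does not write. -/
structure Frame (p : Cmd) (s s' : HState) : Prop where
  v : ∀ r, p.wN r = false → s'.v r = s.v r
  r : ∀ r, p.wR r = false → s'.r r = s.r r
  a : ∀ r, p.wA r = false → s'.a r = s.a r

/-! #### Compilation -/

/-- Registers occupy the cells below 48 in the order of their constructors, so `n`, `k` and `eps`,
`b` are where the input is given. Base addresses of the arrays start at cell 48, cell 60 is scratch,
and the arrays start at cell 64 with stride `S`. The array `dig` comes last and is therefore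
unbounded. -/
def NReg.ref (x : NReg) : Ref := .dir x.ctorIdx
def RReg.ref (x : RReg) : Ref := .dir x.ctorIdx
def Arr.baseRef (A : Arr) : Ref := .dir (48 + A.ctorIdx)
def tmpRef : Ref := .dir 60
def Arr.addr (S : ℕ) (A : Arr) (i : ℕ) : ℕ := 64 + A.ctorIdx * S + i

def Instr.code : Instr → List Op
  | constN x c => [.constN x.ref c]
  | copyN x y => [.copyN x.ref y.ref]
  | addN x y z => [.addN x.ref y.ref z.ref]
  | inc x => [.constN tmpRef 1, .addN x.ref x.ref tmpRef]
  | load x A i => [.addN tmpRef A.baseRef i.ref, .copyN x.ref (.ind 60)]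
  | store A i x => [.addN tmpRef A.baseRef i.ref, .copyN (.ind 60) x.ref]
  | constR x c => [.constN tmpRef c, .natCastR x.ref tmpRef]
  | castR x y => [.natCastR x.ref y.ref]
  | copyR x y => [.copyR x.ref y.ref]
  | addR x y z => [.addR x.ref y.ref z.ref]
  | subR x y z => [.subR x.ref y.ref z.ref]
  | mulR x y z => [.mulR x.ref y.ref z.ref]
  | divR x y z => [.divR x.ref y.ref z.ref]
  | dist x y z => [.dist x.ref y.ref z.ref]
  | color x y => [.color x.ref y.ref]
  | validate x => [.validate x.ref Arr.lab.baseRef]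

def opsProg : List Op → Prog
  | [] => .skip
  | o :: l => .seq (.op o) (opsProg l)

def instrsProg : List Instr → Prog
  | [] => .skip
  | i :: l => .seq (opsProg i.code) (instrsProg l)

def HTest.code : HTest → Test
  | ltN x y => .ltN x.ref y.ref
  | eqN x y => .eqN x.ref y.ref
  | ltR x y => .ltR x.ref y.ref
  | leR x y => .leR x.ref y.ref

def Cmd.code : Cmd → Prog
  | .ops l => instrsProg l
  | .seq p q => .seq p.code q.code
  | .ite c p q => .ite c.code p.code q.code
  | .loop c p => .loop c.code p.code

/-- The memory `σ` represents `s`. -/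
structure Rep (S : ℕ) (σ : State) (s : HState) : Prop where
  v : ∀ x : NReg, σ.nat x.ctorIdx = s.v x
  r : ∀ x : RReg, σ.real x.ctorIdx = s.r x
  a : ∀ A i, (A = .dig ∨ i < S) → σ.nat (A.addr S i) = s.a A i
  base : ∀ A : Arr, σ.nat (48 + A.ctorIdx) = A.addr S 0

theorem NReg.ctorIdx_inj {x y : NReg} (h : x.ctorIdx = y.ctorIdx) : x = y := by
  rw [← NReg.ofNat_ctorIdx x, h, NReg.ofNat_ctorIdx]

theorem RReg.ctorIdx_inj {x y : RReg} (h : x.ctorIdx = y.ctorIdx) : x = y := by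
  rw [← RReg.ofNat_ctorIdx x, h, RReg.ofNat_ctorIdx]

theorem NReg.ctorIdx_lt (x : NReg) : x.ctorIdx < 48 := by cases x <;> decide

theorem Arr.ctorIdx_lt (x : Arr) : x.ctorIdx < 7 := by cases x <;> decide

theorem Arr.addr_inj {S : ℕ} {A B : Arr} {i j : ℕ} (hA : A = .dig ∨ i < S)
    (hB : B = .dig ∨ j < S) (h : A.addr S i = B.addr S j) : A = B ∧ i = j := by
  cases A <;> cases B <;> simp [Arr.addr, Arr.ctorIdx] at * <;> omega

/-! ### Simulation of registers and arrays by the two memories -/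

section Rep

variable {S : ℕ} {σ : State} {s : HState}

theorem Rep.setTmp (h : Rep S σ s) (c : ℕ) :
    Rep S { σ with nat := Function.update σ.nat 60 c } s := by
  refine ⟨fun x => ?_, h.r, fun A i hi => ?_, fun A => ?_⟩
  · rw [← h.v x]; exact Function.update_of_ne (by have := x.ctorIdx_lt; omega) _ _
  · rw [← h.a A i hi]; exact Function.update_of_ne (by unfold Arr.addr; omega) _ _
  · rw [← h.base A]; exact Function.update_of_ne (by have := A.ctorIdx_lt; omega) _ _

theorem Rep.setV (h : Rep S σ s) (x : NReg) (c : ℕ) :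
    Rep S { σ with nat := Function.update σ.nat x.ctorIdx c }
      { s with v := Function.update s.v x c } := by
  have hx := x.ctorIdx_lt
  refine ⟨fun y => ?_, h.r, fun A i hi => ?_, fun A => ?_⟩
  · by_cases hy : y = x
    · subst hy; simp
    · simp [Function.update_of_ne hy, h.v y,
        Function.update_of_ne (fun h => hy (NReg.ctorIdx_inj h))]
  · rw [← h.a A i hi]; exact Function.update_of_ne (by unfold Arr.addr; omega) _ _
  · rw [← h.base A]; exact Function.update_of_ne (by omega) _ _

theorem Rep.setR (h : Rep S σ s) (x : RReg) (c : ℝ) :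
    Rep S { σ with real := Function.update σ.real x.ctorIdx c }
      { s with r := Function.update s.r x c } := by
  refine ⟨h.v, fun y => ?_, h.a, h.base⟩
  by_cases hy : y = x
  · subst hy; simp
  · simp [Function.update_of_ne hy, h.r y,
      Function.update_of_ne (fun h => hy (RReg.ctorIdx_inj h))]

theorem Rep.setA (h : Rep S σ s) (A : Arr) (i c : ℕ) (hA : A = .dig ∨ i < S) :
    Rep S { σ with nat := Function.update σ.nat (A.addr S i) c }
      { s with a := Function.update s.a A (Function.update (s.a A) i c) } := by
  refine ⟨fun y => ?_, h.r, fun B j hB => ?_, fun B => ?_⟩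
  · rw [← h.v y]
    exact Function.update_of_ne (by have := y.ctorIdx_lt; unfold Arr.addr; omega) _ _
  · by_cases hAB : B = A ∧ j = i
    · obtain ⟨rfl, rfl⟩ := hAB; simp
    · have hne : B.addr S j ≠ A.addr S i := fun h => hAB (Arr.addr_inj hB hA h)
      simp only [Function.update_of_ne hne, h.a B j hB]
      by_cases hBA : B = A
      · subst hBA
        simp [Function.update_of_ne (fun h => hAB ⟨rfl, h⟩)]
      · simp [Function.update_of_ne hBA]
  · rw [← h.base B]
    exact Function.update_of_ne (by have := B.ctorIdx_lt; unfold Arr.addr; omega) _ _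

end Rep

/-- Validity depends on the first `S` labels only. -/
def Env.Local (E : Env) (S : ℕ) : Prop :=
  ∀ ℓ ℓ' : ℕ → ℕ, (∀ i < S, ℓ i = ℓ' i) → (E.valid ℓ ↔ E.valid ℓ')

-- Distinct registers and array cells have distinct addresses, so a write changes one entry.
-- Two-step instructions also change the scratch cell, which represents nothing.
open Classical in
theorem Rep.instr {E : Env} {S : ℕ} {σ : State} {s : HState} (hE : E.Local S) (h : Rep S σ s)
    (i : Instr) (hi : i.ok S s) :
    Rep S (i.code.foldl (fun σ o => o.apply E σ) σ) (i.run E s) := by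
  have hT := fun c => h.setTmp c
  have hind : ∀ (A : Arr) (y : NReg), σ.nat (48 + A.ctorIdx) + σ.nat y.ctorIdx =
      A.addr S (s.v y) := by
    intro A y; rw [h.base, h.v]; simp [Arr.addr]
  have hind' : ∀ (A : Arr) (y : NReg), σ.nat (48 + A.ctorIdx) + s.v y = A.addr S (s.v y) := by
    intro A y; rw [← h.v, hind, h.v]
  have hne : ∀ x : NReg, x.ctorIdx ≠ 60 := fun x => by have := x.ctorIdx_lt; omega
  have hne' : ∀ (A : Arr) i, A.addr S i ≠ 60 := fun A i => by unfold Arr.addr; omega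
  cases i with
  | inc x =>
    have := (hT 1).setV x (s.v x + 1)
    simpa [Instr.code, Instr.run, Op.apply, State.setN, State.getN, NReg.ref, tmpRef, Ref.addr,
      h.v, hne] using this
  | load x A y =>
    have := (hT (A.addr S (s.v y))).setV x (s.a A (s.v y))
    simpa [Instr.code, Instr.run, Op.apply, State.setN, State.getN, NReg.ref, tmpRef, Ref.addr,
      Arr.baseRef, hind, hne', h.a A _ hi] using this
  | store A y x =>
    have := (hT (A.addr S (s.v y))).setA A (s.v y) (s.v x) hi
    simpa [Instr.code, Instr.run, Op.apply, State.setN, State.getN, NReg.ref, tmpRef, Ref.addr,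
      Arr.baseRef, hind', hne, hne', h.v] using this
  | constR x c =>
    have := (hT c).setR x c
    simpa [Instr.code, Instr.run, Op.apply, State.setN, State.setR, State.getN, RReg.ref, tmpRef,
      Ref.addr] using this
  | validate x =>
    -- Past the first `S` labels the validation procedure sees the next array; locality makes this
    -- irrelevant.
    have hv : E.valid (fun i => σ.nat (σ.nat (48 + Arr.lab.ctorIdx) + i)) ↔
        E.valid (s.a .lab) := by
      apply hE
      intro i hi
      rw [← h.a .lab i (Or.inr hi), h.base]; simp [Arr.addr]
    have := h.setV x (if E.valid (s.a .lab) then 1 else 0)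
    simpa [Instr.code, Instr.run, Op.apply, State.setN, State.getN, NReg.ref, Ref.addr,
      Arr.baseRef, hv] using this
  | constN x c => exact h.setV x c
  | copyN x y => rw [Instr.run, ← h.v]; exact h.setV x _
  | addN x y z => rw [Instr.run, ← h.v, ← h.v]; exact h.setV x _
  | castR x y => rw [Instr.run, ← h.v]; exact h.setR x _
  | copyR x y => rw [Instr.run, ← h.r]; exact h.setR x _
  | addR x y z => rw [Instr.run, ← h.r, ← h.r]; exact h.setR x _
  | subR x y z => rw [Instr.run, ← h.r, ← h.r]; exact h.setR x _
  | mulR x y z => rw [Instr.run, ← h.r, ← h.r]; exact h.setR x _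
  | divR x y z => rw [Instr.run, ← h.r, ← h.r]; exact h.setR x _
  | dist x y z => rw [Instr.run, ← h.v, ← h.v]; exact h.setR x _
  | color x y => rw [Instr.run, ← h.v]; exact h.setV x _

theorem exec_opsProg (E : Env) (l : List Op) (σ : State) :
    Exec E (opsProg l) σ ((l.map (Op.time E)).sum) (l.foldl (fun σ o => o.apply E σ) σ) := by
  induction l generalizing σ with
  | nil => exact .skip σ
  | cons o l ih => exact .seq (.op o σ) (ih _)

theorem Instr.code_time (E : Env) (i : Instr) : (i.code.map (Op.time E)).sum ≤ i.time E := by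
  cases i <;> simp [Instr.code, Op.time, Instr.time]

theorem exec_instrsProg {E : Env} {S : ℕ} (hE : E.Local S) (l : List Instr) :
    ∀ {σ : State} {s : HState}, Rep S σ s → okAll E S l s →
      ∃ t σ', Exec E (instrsProg l) σ t σ' ∧ Rep S σ' (runAll E l s) ∧ t ≤ timeAll E l := by
  induction l with
  | nil => exact fun h _ => ⟨0, _, .skip _, h, le_rfl⟩
  | cons i l ih =>
    intro σ s h hok
    obtain ⟨t, σ', h1, h2, h3⟩ := ih (h.instr hE i hok.1) hok.2
    exact ⟨_, σ', .seq (exec_opsProg E i.code σ) h1, h2, Nat.add_le_add (i.code_time E) h3⟩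

theorem HTest.code_holds {S : ℕ} {σ : State} {s : HState} (h : Rep S σ s) (c : HTest) :
    c.code.holds σ ↔ c.holds s := by
  cases c <;> simp [HTest.code, HTest.holds, Test.holds, State.getN, State.getR, NReg.ref,
    RReg.ref, Ref.addr, h.v, h.r]

theorem Instr.run_frame (E : Env) (i : Instr) (s : HState) : Frame (.ops [i]) s (i.run E s) := by
  constructor <;> intro r hr <;> cases i <;>
    simp_all [Instr.run, Cmd.wN, Cmd.wR, Cmd.wA, Instr.wN, Instr.wR, Instr.wA,
      Function.update_of_ne, eq_comm]

section Frame

variable {p q : Cmd} {s s' s'' : HState}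

theorem Frame.refl (p : Cmd) (s : HState) : Frame p s s :=
  ⟨fun _ _ => rfl, fun _ _ => rfl, fun _ _ => rfl⟩

theorem Frame.trans (h : Frame p s s') (h' : Frame p s' s'') : Frame p s s'' :=
  ⟨fun r hr => (h'.v r hr).trans (h.v r hr), fun r hr => (h'.r r hr).trans (h.r r hr),
    fun r hr => (h'.a r hr).trans (h.a r hr)⟩

theorem Frame.mono (h : Frame p s s') (hN : ∀ r, q.wN r = false → p.wN r = false)
    (hR : ∀ r, q.wR r = false → p.wR r = false) (hA : ∀ r, q.wA r = false → p.wA r = false) :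
    Frame q s s' :=
  ⟨fun r hr => h.v r (hN r hr), fun r hr => h.r r (hR r hr), fun r hr => h.a r (hA r hr)⟩

theorem Frame.seqLeft (h : Frame p s s') : Frame (p ;; q) s s' :=
  h.mono (by simp +contextual [Cmd.wN]) (by simp +contextual [Cmd.wR])
    (by simp +contextual [Cmd.wA])

theorem Frame.seqRight (h : Frame q s s') : Frame (p ;; q) s s' :=
  h.mono (by simp +contextual [Cmd.wN]) (by simp +contextual [Cmd.wR])
    (by simp +contextual [Cmd.wA])

theorem Frame.ops (E : Env) (l : List Instr) (s : HState) : Frame (.ops l) s (runAll E l s) := by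
  induction l generalizing s with
  | nil => exact .refl _ _
  | cons i l ih =>
    refine Frame.trans ((i.run_frame E s).mono ?_ ?_ ?_) ((ih (i.run E s)).mono ?_ ?_ ?_) <;>
      simp +contextual [Cmd.wN, Cmd.wR, Cmd.wA]

end Frame

/-- Started in `s`, the program `p` halts within time `T` in a state that satisfies `Q`. -/
def Does (E : Env) (S : ℕ) (p : Cmd) (s : HState) (T : ℕ) (Q : HState → Prop) : Prop :=
  E.Local S → ∀ σ, Rep S σ s → ∃ t σ' s', Exec E p.code σ t σ' ∧ Rep S σ' s' ∧ Frame p s s' ∧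
    t ≤ T ∧ Q s'

/-! ### Program logic for results and running time -/

section Does

variable {E : Env} {S : ℕ} {p q : Cmd} {s : HState} {T T' : ℕ} {Q R : HState → Prop}

theorem Does.mono (h : Does E S p s T R) (hT : T ≤ T')
    (hQ : ∀ s', Frame p s s' → R s' → Q s') : Does E S p s T' Q := by
  intro hE σ hσ
  obtain ⟨t, σ', s', h1, h2, h3, h4, h5⟩ := h hE σ hσ
  exact ⟨t, σ', s', h1, h2, h3, h4.trans hT, hQ s' h3 h5⟩

theorem Does.ops {l : List Instr} (hok : okAll E S l s) (ht : timeAll E l ≤ T)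
    (hQ : Q (runAll E l s)) : Does E S (.ops l) s T Q := by
  intro hE σ hσ
  obtain ⟨t, σ', h1, h2, h3⟩ := exec_instrsProg hE l hσ hok
  exact ⟨t, σ', _, h1, h2, .ops E l s, h3.trans ht, hQ⟩

theorem Does.skip (hQ : Q s) : Does E S .skip s T Q :=
  Does.ops trivial (Nat.zero_le _) hQ

theorem Does.seq (T₁ T₂ : ℕ) (hp : Does E S p s T₁ R)
    (hq : ∀ s', Frame p s s' → R s' → Does E S q s' T₂ Q) (hT : T₁ + T₂ ≤ T := by omega) :
    Does E S (p ;; q) s T Q := by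
  intro hE σ hσ
  obtain ⟨t, σ', s', h1, h2, h3, h4, h5⟩ := hp hE σ hσ
  obtain ⟨t', σ'', s'', h1', h2', h3', h4', h5'⟩ := hq s' h3 h5 hE σ' h2
  exact ⟨t + t', σ'', s'', .seq h1 h1', h2', h3.seqLeft.trans h3'.seqRight,
    (Nat.add_le_add h4 h4').trans hT, h5'⟩

theorem Does.opsSeq {l : List Instr} (T₁ T₂ : ℕ) (hok : okAll E S l s) (ht : timeAll E l ≤ T₁)
    (hq : Does E S q (runAll E l s) T₂ Q) (hT : T₁ + T₂ ≤ T := by omega) :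
    Does E S (.ops l ;; q) s T Q :=
  Does.seq (R := fun s' => s' = runAll E l s) T₁ T₂ (Does.ops hok ht rfl)
    (fun _ _ h => h ▸ hq) hT

theorem Does.ite {c : HTest} (T₁ : ℕ) (hp : c.holds s → Does E S p s T₁ Q)
    (hq : ¬ c.holds s → Does E S q s T₁ Q) (hT : T₁ + 1 ≤ T := by omega) :
    Does E S (.ite c p q) s T Q := by
  intro hE σ hσ
  by_cases hc : c.holds s
  · obtain ⟨t, σ', s', h1, h2, h3, h4, h5⟩ := hp hc hE σ hσ
    refine ⟨1 + t, σ', s', .iteTrue ((c.code_holds hσ).2 hc) h1, h2, h3.mono ?_ ?_ ?_,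
      by omega, h5⟩ <;> simp +contextual [Cmd.wN, Cmd.wR, Cmd.wA]
  · obtain ⟨t, σ', s', h1, h2, h3, h4, h5⟩ := hq hc hE σ hσ
    refine ⟨1 + t, σ', s', .iteFalse (fun h => hc ((c.code_holds hσ).1 h)) h1, h2,
      h3.mono ?_ ?_ ?_, by omega, h5⟩ <;> simp +contextual [Cmd.wN, Cmd.wR, Cmd.wA]

/-- A loop that makes exactly `N` rounds. -/
theorem Does.loop {c : HTest} (N T₁ : ℕ) (I : ℕ → HState → Prop) (h0 : I 0 s)
    (hs : ∀ i s', i < N → Frame p s s' → I i s' → c.holds s' ∧ Does E S p s' T₁ (I (i + 1)))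
    (hN : ∀ s', Frame p s s' → I N s' → ¬ c.holds s' ∧ Q s') (hT : N * (T₁ + 1) + 1 ≤ T) :
    Does E S (.loop c p) s T Q := by
  have key : ∀ m i s', i + m = N → Frame p s s' → I i s' →
      Does E S (.loop c p) s' (m * (T₁ + 1) + 1) Q := by
    intro m
    induction m with
    | zero =>
      intro i s' hi hf hI hE σ hσ
      obtain rfl : i = N := by omega
      have := hN s' hf hI
      exact ⟨1, σ, s', .loopFalse (fun h => this.1 ((c.code_holds hσ).1 h)), hσ, .refl _ _,
        by omega, this.2⟩
    | succ m ih =>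
      intro i s' hi hf hI hE σ hσ
      obtain ⟨hc, hp⟩ := hs i s' (by omega) hf hI
      obtain ⟨t, σ', s'', h1, h2, h3, h4, h5⟩ := hp hE σ hσ
      obtain ⟨t', σ₂, s₂, h1', h2', h3', h4', h5'⟩ :=
        ih (i + 1) s'' (by omega) (hf.trans h3) h5 hE σ' h2
      exact ⟨1 + t + t', σ₂, s₂, .loopTrue ((c.code_holds hσ).2 hc) h1 h1', h2',
        ⟨fun r hr => (h3'.v r hr).trans (h3.v r hr), fun r hr => (h3'.r r hr).trans (h3.r r hr),
          fun r hr => (h3'.a r hr).trans (h3.a r hr)⟩, by rw [Nat.succ_mul]; omega, h5'⟩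
  exact (key N 0 s (by omega) (.refl _ _) h0).mono hT fun _ _ h => h

/-- `for i := 0 to b - 1 do p`. -/
def forUp (i b : NReg) (p : Cmd) : Cmd :=
  .ops [.constN i 0] ;; .loop (.ltN i b) (p ;; .ops [.inc i])

def HState.setN (s : HState) (x : NReg) (c : ℕ) : HState :=
  { s with v := Function.update s.v x c }

/-- The invariant refers to the state in which the counter has already been set, hence `setN`. The 3
units per round pay for the increment and the test. -/
theorem Does.forUp {i b : NReg} (T₁ : ℕ) (I : ℕ → HState → Prop)
    (hw : (p ;; Cmd.ops [.inc i]).wN b = false ∧ p.wN i = false) (h0 : I 0 (s.setN i 0))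
    (hs : ∀ j s', j < s.v b → s'.v i = j → Frame (MSD.forUp i b p) s s' → I j s' →
      Does E S p s' T₁ fun s'' => I (j + 1) (s''.setN i (j + 1)))
    (hQ : ∀ s', Frame (MSD.forUp i b p) s s' → I (s.v b) s' → Q s')
    (hT : s.v b * (T₁ + 3) + 3 ≤ T) :
    Does E S (MSD.forUp i b p) s T Q := by
  have hib : b ≠ i := by
    rintro rfl
    simp [Cmd.wN, Instr.wN] at hw
  have hfr : ∀ s', Frame (p ;; Cmd.ops [.inc i]) (runAll E [.constN i 0] s) s' →
      Frame (MSD.forUp i b p) s s' := fun s' h =>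
    (Frame.ops E [.constN i 0] s).seqLeft.trans
      (h.mono (fun r hr => by simp_all [Cmd.wN, MSD.forUp])
        (fun r hr => by simp_all [Cmd.wR, MSD.forUp])
        (fun r hr => by simp_all [Cmd.wA, MSD.forUp]))
  refine Does.opsSeq 2 (s.v b * (T₁ + 2 + 1) + 1) ⟨trivial, trivial⟩ le_rfl ?_ (by rw [show T₁ + 2 + 1 = T₁ + 3 from rfl]; omega)
  refine Does.loop (s.v b) (T₁ + 2) (fun j s' => s'.v i = j ∧ I j s') ⟨?_, h0⟩ ?_ ?_ le_rfl
  · simp [runAll, Instr.run]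
  · rintro j s' hj hf ⟨hi, hI⟩
    have hb : s'.v b = s.v b := (hfr s' hf).v b (by
      simpa [MSD.forUp, Cmd.wN, Instr.wN, hib.symm] using hw.1)
    refine ⟨by simp only [HTest.holds]; omega, ?_⟩
    refine Does.seq T₁ 2 (hs j s' hj hi (hfr s' hf) hI) fun s'' hf'' hI'' => ?_
    refine Does.ops ⟨trivial, trivial⟩ le_rfl ?_
    have : s''.v i = j := by rw [hf''.v i hw.2, hi]
    simp [runAll, Instr.run, this]
    exact hI''
  · rintro s' hf ⟨hi, hI⟩
    have hb : s'.v b = s.v b := (hfr s' hf).v b (by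
      simpa [MSD.forUp, Cmd.wN, Instr.wN, hib.symm] using hw.1)
    exact ⟨by simp only [HTest.holds]; omega, hQ s' (hfr s' hf) hI⟩

end Does

/-! #### Programs without validation -/

def Instr.free : Instr → Bool
  | validate _ => false
  | _ => true

def Cmd.free : Cmd → Bool
  | .ops l => l.all Instr.free
  | .seq p q => p.free && q.free
  | .ite _ p q => p.free && q.free
  | .loop _ p => p.free

theorem Cmd.oracleFree : ∀ p : Cmd, p.free = true → p.code.OracleFree
  | .ops l, h => by
    induction l with
    | nil => trivial
    | cons i l ih =>
      simp only [Cmd.free, List.all_cons, Bool.and_eq_true] at h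
      refine ⟨?_, ih h.2⟩
      cases i <;> simp_all [Instr.code, opsProg, Prog.OracleFree, Instr.free]
  | .seq p q, h => by
    simp only [Cmd.free, Bool.and_eq_true] at h
    exact ⟨p.oracleFree h.1, q.oracleFree h.2⟩
  | .ite _ p q, h => by
    simp only [Cmd.free, Bool.and_eq_true] at h
    exact ⟨p.oracleFree h.1, q.oracleFree h.2⟩
  | .loop _ p, h => p.oracleFree h

/-! ### Decoding a clustering of the net from a string of digits -/

section Decode

variable (D : ℕ → ℕ → ℝ) (net : ℕ → ℕ) (M : ℕ) (δ : ℝ)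

noncomputable def scanRow (part : ℕ → ℕ) (cur u : ℕ) : ℕ → ℕ × ℝ → ℕ × ℝ
  | 0, a => a
  | w + 1, a =>
    if part w = cur ∧ (scanRow part cur u w a).2 < D (net u) (net w) then
      (net u, D (net u) (net w))
    else scanRow part cur u w a

/-- An end point of a diameter, and the diameter, of the class with label `cur`. -/
noncomputable def scan (part : ℕ → ℕ) (cur : ℕ) : ℕ → ℕ × ℝ
  | 0 => (0, 0)
  | u + 1 => if part u = cur then scanRow D net part cur u M (scan part cur u)
      else scan part cur u

/-- The classes with labels below `cur` are finished. -/
structure Dec where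
  part : ℕ → ℕ
  cnt : ℕ
  cur : ℕ
  rr : ℝ
  ub : ℝ

noncomputable def Dec.cut (st : Dec) (p : ℕ) (r : ℝ) : Dec where
  part := fun u => if st.part u = st.cur ∧ r < D p (net u) then st.cnt else st.part u
  cnt := st.cnt + 1
  cur := st.cur
  rr := 0
  ub := st.ub

/-- Digit 0 closes the current class, digits 1 and 2 append a binary digit to the multiple `rr` of
`δ`, digits 3 and 4 cut at radius `rr` or at the diameter minus `rr`. The center is recomputed from
the class and need not be encoded. The two `δ` added to `ub` pay for passing from net points to the
points assigned to them. -/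
noncomputable def Dec.step (st : Dec) (d : ℕ) : Dec :=
  if st.cur < st.cnt then
    if d = 0 then
      { st with
        cur := st.cur + 1
        rr := 0
        ub := st.ub + (scan D net M st.part st.cur M).2 + δ + δ }
    else if d = 1 then { st with rr := st.rr + st.rr }
    else if d = 2 then { st with rr := st.rr + st.rr + δ }
    else if d = 3 then st.cut D net (scan D net M st.part st.cur M).1 st.rr
    else st.cut D net (scan D net M st.part st.cur M).1
      ((scan D net M st.part st.cur M).2 - st.rr)
  else st

def Dec.init : Dec := ⟨fun _ => 0, 1, 0, 0, 0⟩

noncomputable def decode (dig : ℕ → ℕ) : ℕ → Dec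
  | 0 => Dec.init
  | i + 1 => (decode dig i).step D net M δ (dig i)

variable {D net M δ}

theorem scanRow_mono (part : ℕ → ℕ) (cur u : ℕ) (a : ℕ × ℝ) (w : ℕ) :
    a.2 ≤ (scanRow D net part cur u w a).2 ∧
      ∀ w' < w, part w' = cur → D (net u) (net w') ≤ (scanRow D net part cur u w a).2 := by
  induction w with
  | zero => exact ⟨le_rfl, fun w' h => by omega⟩
  | succ w ih =>
    rw [scanRow]
    split_ifs with h
    · refine ⟨(ih.1.trans h.2.le), fun w' hw' hp => ?_⟩
      rcases Nat.lt_succ_iff_lt_or_eq.1 hw' with h' | rfl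
      · exact (ih.2 w' h' hp).trans h.2.le
      · exact le_rfl
    · refine ⟨ih.1, fun w' hw' hp => ?_⟩
      rcases Nat.lt_succ_iff_lt_or_eq.1 hw' with h' | rfl
      · exact ih.2 w' h' hp
      · by_contra h'
        exact h ⟨hp, not_le.1 h'⟩

theorem scanRow_spec (part : ℕ → ℕ) (cur u : ℕ) (a : ℕ × ℝ) (w : ℕ) :
    scanRow D net part cur u w a = a ∨ ∃ w' < w, part w' = cur ∧
      scanRow D net part cur u w a = (net u, D (net u) (net w')) := by
  induction w with
  | zero => exact .inl rfl
  | succ w ih =>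
    rw [scanRow]
    split_ifs with h
    · exact .inr ⟨w, by omega, h.1, rfl⟩
    · exact ih.imp id fun ⟨w', h1, h2⟩ => ⟨w', by omega, h2⟩

theorem scan_nonneg (part : ℕ → ℕ) (cur u : ℕ) : 0 ≤ (scan D net M part cur u).2 := by
  induction u with
  | zero => exact le_rfl
  | succ u ih =>
    rw [scan]
    split_ifs
    · exact ih.trans (scanRow_mono part cur u _ M).1
    · exact ih

theorem le_scan (part : ℕ → ℕ) (cur u : ℕ) : ∀ u' < u, ∀ w < M, part u' = cur → part w = cur →
    D (net u') (net w) ≤ (scan D net M part cur u).2 := by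
  induction u with
  | zero => intro u' h; omega
  | succ u ih =>
    intro u' hu' w hw hpu hpw
    rw [scan]
    rcases Nat.lt_succ_iff_lt_or_eq.1 hu' with h' | rfl
    · have := ih u' h' w hw hpu hpw
      split_ifs
      · exact this.trans (scanRow_mono part cur u _ M).1
      · exact this
    · rw [if_pos hpu]
      exact (scanRow_mono part cur u' _ M).2 w hw hpw

/-- The scan starts at value `0` and replaces it only by something larger, so a value `0` may come
with a dummy end point. -/
theorem scan_spec (part : ℕ → ℕ) (cur u : ℕ) : (scan D net M part cur u).2 = 0 ∨
    ∃ u' < u, ∃ w < M, part u' = cur ∧ part w = cur ∧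
      scan D net M part cur u = (net u', D (net u') (net w)) := by
  induction u with
  | zero => exact .inl rfl
  | succ u ih =>
    have ih' : (scan D net M part cur u).2 = 0 ∨
        ∃ u' < u + 1, ∃ w < M, part u' = cur ∧ part w = cur ∧
          scan D net M part cur u = (net u', D (net u') (net w)) :=
      ih.imp id fun ⟨u', h1, h2⟩ => ⟨u', by omega, h2⟩
    rw [scan]
    split_ifs with hp
    · rcases scanRow_spec (D := D) (net := net) part cur u (scan D net M part cur u) M with
        h | ⟨w, h1, h2, h3⟩
      · rw [h]; exact ih'
      · exact .inr ⟨u, by omega, w, h1, hp, h2, h3⟩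
    · exact ih'

/-- The finished classes have the diameters that `ub` accounts for. -/
structure Dec.Sound (D : ℕ → ℕ → ℝ) (net : ℕ → ℕ) (M : ℕ) (δ : ℝ) (st : Dec) : Prop where
  cur_le : st.cur ≤ st.cnt
  part_lt : ∀ u < M, st.part u < st.cnt
  ub : ∃ h : ℕ → ℝ, st.ub = ∑ c ∈ Finset.range st.cur, (h c + 2 * δ) ∧
    ∀ c < st.cur, 0 ≤ h c ∧ ∀ u < M, ∀ w < M, st.part u = c → st.part w = c →
      D (net u) (net w) ≤ h c

/-- Only members of the class `cur` are relabelled, with a fresh label; closed classes have smaller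
labels and stay the same. -/
theorem Dec.Sound.cut {st : Dec} (h : st.Sound D net M δ) (hc : st.cur < st.cnt) (p : ℕ) (r : ℝ) :
    (st.cut D net p r).Sound D net M δ := by
  obtain ⟨h1, h2, f, h3, h4⟩ := h
  refine ⟨by simp only [Dec.cut]; omega, fun u hu => ?_, f, h3, fun c hcc => ⟨(h4 c hcc).1, ?_⟩⟩
  · have := h2 u hu
    simp only [Dec.cut]
    split_ifs <;> omega
  · have key : ∀ u < M, (st.cut D net p r).part u = c → st.part u = c := by
      intro u hu
      simp only [Dec.cut] at hcc ⊢
      split_ifs with h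
      · intro h; omega
      · exact id
    exact fun u hu w hw hpu hpw => (h4 c hcc).2 u hu w hw (key u hu hpu) (key w hw hpw)

theorem Dec.Sound.step {st : Dec} (h : st.Sound D net M δ) (d : ℕ) :
    (st.step D net M δ d).Sound D net M δ := by
  unfold Dec.step
  split_ifs with hc h0 h1 h2 h3
  · obtain ⟨h1, h2, f, h3, h4⟩ := h
    refine ⟨hc, h2, Function.update f st.cur (scan D net M st.part st.cur M).2, ?_, ?_⟩
    · simp only [Finset.sum_range_succ, Function.update_self]
      rw [h3, Finset.sum_congr rfl (g := fun c => Function.update f st.cur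
        (scan D net M st.part st.cur M).2 c + 2 * δ)]
      · ring
      · intro c hcc
        rw [Function.update_of_ne (Finset.mem_range.1 hcc).ne]
    · intro c hcc
      rcases Nat.lt_succ_iff_lt_or_eq.1 hcc with h' | rfl
      · rw [Function.update_of_ne h'.ne]; exact h4 c h'
      · rw [Function.update_self]
        exact ⟨scan_nonneg _ _ _, fun u hu w hw => le_scan _ _ _ u hu w hw⟩
  · exact ⟨h.1, h.2, h.3⟩
  · exact ⟨h.1, h.2, h.3⟩
  · exact h.cut hc _ _
  · exact h.cut hc _ _
  · exact h

theorem Dec.sound_init : Dec.init.Sound D net M δ :=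
  ⟨by simp [Dec.init], fun _ _ => Nat.one_pos, fun _ => 0, by simp [Dec.init],
    fun c hc => by simp [Dec.init] at hc⟩

theorem decode_sound (dig : ℕ → ℕ) (i : ℕ) : (decode D net M δ dig i).Sound D net M δ := by
  induction i with
  | zero => exact Dec.sound_init
  | succ i ih => exact ih.step _

/-! ### Ball cuts -/

section Cut

variable {ι : Type*} [DecidableEq ι]

/-- Intervals that overlap after an extension by `δ`, collected from the left end on. -/
theorem exists_overlap_chain {J : Finset ι} {lo hi : ι → ℝ} {a : ι → ℕ} {δ : ℝ}
    (hδ : 0 ≤ δ) (hab : ∀ i ∈ J, hi i - lo i ≤ ((a i : ℝ) - 1) * δ) {i₀ : ι} (hi₀ : i₀ ∈ J) (h0 : lo i₀ ≤ 0) :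
    ∃ K ⊆ J, ∃ e ∈ K, (∀ i ∈ K, hi i ≤ hi e) ∧ (∀ j ∈ J \ K, hi e + δ ≤ lo j) ∧
      hi e + δ ≤ (∑ i ∈ K, a i : ℕ) * δ := by
  classical
  -- A largest family with this property works: an interval that starts before `hi e + δ` could be
  -- added, since its weight pays for its length and one more `δ`.
  let P : Finset ι → Prop := fun K => ∃ e ∈ K, (∀ i ∈ K, hi i ≤ hi e) ∧
    hi e + δ ≤ (∑ i ∈ K, a i : ℕ) * δ
  have hne : (J.powerset.filter P).Nonempty := by
    refine ⟨{i₀}, Finset.mem_filter.2 ⟨by simpa using hi₀, i₀, by simp, by simp, ?_⟩⟩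
    have := hab i₀ hi₀
    simp only [Finset.sum_singleton]
    linarith
  obtain ⟨K, hK, hmax⟩ := Finset.exists_max_image _ Finset.card hne
  obtain ⟨hKJ, e, he, h1, h2⟩ := Finset.mem_filter.1 hK
  rw [Finset.mem_powerset] at hKJ
  refine ⟨K, hKJ, e, he, h1, fun j hj => ?_, h2⟩
  obtain ⟨hjJ, hjK⟩ := Finset.mem_sdiff.1 hj
  by_contra hlt
  push Not at hlt
  have hj' := hab j hjJ
  have hsum : ((∑ i ∈ insert j K, a i : ℕ) : ℝ) * δ = a j * δ + (∑ i ∈ K, a i : ℕ) * δ := by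
    rw [Finset.sum_insert hjK]; push_cast; ring
  have haj : 0 ≤ a j * δ := by positivity
  have : insert j K ∈ J.powerset.filter P := by
    refine Finset.mem_filter.2 ⟨Finset.mem_powerset.2 (Finset.insert_subset hjJ hKJ), ?_⟩
    rcases le_total (hi j) (hi e) with hle | hle
    · refine ⟨e, Finset.mem_insert_of_mem he, ?_, by rw [hsum]; linarith⟩
      simpa [hle] using h1
    · refine ⟨j, Finset.mem_insert_self _ _, ?_, by rw [hsum]; linarith⟩
      simpa using fun i hi => (h1 i hi).trans hle
  have := hmax _ this
  rw [Finset.card_insert_of_notMem hjK] at this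
  omega

/-- If the intervals `[lo i, hi i]` are too short to connect `0` and `H`, then a multiple of `δ`,
measured from one of the two ends, lies in a gap. -/
theorem exists_gap {J : Finset ι} {lo hi : ι → ℝ} {a : ι → ℕ} {δ H : ℝ} (hδ : 0 ≤ δ)
    (hlo : ∀ i ∈ J, 0 ≤ lo i) (hlh : ∀ i ∈ J, lo i ≤ hi i)
    (hab : ∀ i ∈ J, hi i - lo i ≤ ((a i : ℝ) - 1) * δ)
    (hH : ∀ i ∈ J, hi i ≤ H) {i₀ i₁ : ι} (hi₀ : i₀ ∈ J) (hi₁ : i₁ ∈ J) (h0 : lo i₀ ≤ 0)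
    (h1 : hi i₁ = H) (hpos : 0 < H) (hgap : (((∑ i ∈ J, a i : ℕ) : ℝ) - 1) * δ < H) :
    ∃ K ⊆ J, K.Nonempty ∧ (J \ K).Nonempty ∧ ∃ (t : ℕ) (r : ℝ), (r = t * δ ∨ r = H - t * δ) ∧
      (∀ i ∈ K, hi i ≤ r) ∧ (∀ j ∈ J \ K, r < lo j) ∧ t ≤ ∑ i ∈ K, a i ∧ t ≤ ∑ i ∈ J \ K, a i := by
  -- For `δ = 0` the intervals are points, and radius `0` separates those at `0` from the rest.
  rcases hδ.eq_or_lt with rfl | hδ'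
  · simp only [mul_zero, sub_nonpos] at hab
    refine ⟨J.filter fun i => hi i ≤ 0, Finset.filter_subset _ _, ⟨i₀, ?_⟩, ⟨i₁, ?_⟩, 0, 0,
      by simp, ?_, ?_, Nat.zero_le _, Nat.zero_le _⟩
    · exact Finset.mem_filter.2 ⟨hi₀, (hab i₀ hi₀).trans h0⟩
    · simp [hi₁, h1, hpos]
    · exact fun i hi => (Finset.mem_filter.1 hi).2
    · intro j hj
      simp only [Finset.mem_sdiff, Finset.mem_filter, not_and, not_le] at hj
      exact (hj.2 hj.1).trans_le (hab j hj.1)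
  obtain ⟨K, hKJ, e, he, he1, he2, he3⟩ := exists_overlap_chain hδ hab hi₀ h0
  have hne : (J \ K).Nonempty := by
    by_contra hemp
    rw [Finset.not_nonempty_iff_eq_empty, Finset.sdiff_eq_empty_iff_subset] at hemp
    obtain rfl := Finset.Subset.antisymm hKJ hemp
    have := he1 i₁ hi₁
    rw [h1] at this
    linarith
  -- If `K` is the lighter side, the first multiple of `δ` from `hi e` on is below `hi e + δ`, hence
  -- in the gap. Otherwise a chain `K'` is built from the end `H` inside the complement of `K`, so
  -- that `K'` is the lighter side. Either way `t` is at most the lighter weight.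
  by_cases hle : ∑ i ∈ K, a i ≤ ∑ i ∈ J \ K, a i
  · have hneg : 0 ≤ hi e := (hlo e (hKJ he)).trans (hlh e (hKJ he))
    have hc : (⌈hi e / δ⌉₊ : ℝ) * δ < hi e + δ := by
      have := Nat.ceil_lt_add_one (div_nonneg hneg hδ)
      calc (⌈hi e / δ⌉₊ : ℝ) * δ < (hi e / δ + 1) * δ := by gcongr
        _ = hi e + δ := by field_simp
    have ht : ⌈hi e / δ⌉₊ ≤ ∑ i ∈ K, a i := by
      have := hc.trans_le he3
      exact_mod_cast (lt_of_mul_lt_mul_right this hδ).le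
    refine ⟨K, hKJ, ⟨e, he⟩, hne, ⌈hi e / δ⌉₊, _, .inl rfl, fun i hi => ?_,
      fun j hj => hc.trans_le (he2 j hj), ht, ht.trans hle⟩
    refine (he1 i hi).trans ?_
    rw [← div_le_iff₀ hδ']
    exact Nat.le_ceil _
  · have hi₁' : i₁ ∈ J \ K := by
      refine Finset.mem_sdiff.2 ⟨hi₁, fun hK => ?_⟩
      obtain ⟨j, hj⟩ := hne
      have h2 := he2 j hj
      have hj := (Finset.mem_sdiff.1 hj).1
      have := he1 i₁ hK
      linarith [hlh j hj, hH j hj]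
    obtain ⟨K', hK', e', he', he1', he2', he3'⟩ := exists_overlap_chain (J := J \ K)
      (lo := fun i => H - hi i) (hi := fun i => H - lo i) (a := a) hδ
      (fun i hi => by have := hab i (Finset.mem_sdiff.1 hi).1; linarith) hi₁' (by simp [h1])
    simp only [Finset.mem_sdiff] at he2'
    have hK'J : K' ⊆ J := hK'.trans Finset.sdiff_subset
    -- Floor plus one instead of the ceiling: points at distance exactly `r` stay inside the ball,
    -- so the radius must be strictly below `lo e'`.
    have hc : (⌊(H - lo e') / δ⌋₊ + 1 : ℕ) * δ ≤ H - lo e' + δ := by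
      have h0 : 0 ≤ H - lo e' := by linarith [hlh e' (hK'J he'), hH e' (hK'J he')]
      have := Nat.floor_le (div_nonneg h0 hδ)
      push_cast
      calc ((⌊(H - lo e') / δ⌋₊ : ℝ) + 1) * δ ≤ ((H - lo e') / δ + 1) * δ := by gcongr
        _ = H - lo e' + δ := by field_simp
    have hc' : H - lo e' < (⌊(H - lo e') / δ⌋₊ + 1 : ℕ) * δ := by
      rw [← div_lt_iff₀ hδ']
      push_cast
      exact Nat.lt_floor_add_one _
    have ht : ⌊(H - lo e') / δ⌋₊ + 1 ≤ ∑ i ∈ K', a i := by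
      have := hc.trans he3'
      exact_mod_cast le_of_mul_le_mul_right this hδ'
    have hKK : K ⊆ J \ K' := fun i hi => Finset.mem_sdiff.2 ⟨hKJ hi, fun h =>
      (Finset.mem_sdiff.1 (hK' h)).2 hi⟩
    have hsd : J \ (J \ K') = K' := by
      rw [Finset.sdiff_sdiff_eq_self hK'J]
    refine ⟨J \ K', Finset.sdiff_subset, ⟨e, hKK he⟩, by rw [hsd]; exact ⟨e', he'⟩,
      ⌊(H - lo e') / δ⌋₊ + 1, _, .inr rfl, fun i hi => ?_, ?_, ?_, by rwa [hsd]⟩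
    · by_cases hiK : i ∈ K
      · have := he1 i hiK
        have := he2 e' (hK' he')
        linarith
      · have := he2' i ⟨⟨(Finset.mem_sdiff.1 hi).1, hiK⟩, (Finset.mem_sdiff.1 hi).2⟩
        linarith
    · rw [hsd]
      intro j hj
      have := he1' j hj
      linarith
    · refine ht.trans ((Finset.sum_le_sum_of_subset hK').trans ?_)
      exact (not_le.1 hle).le.trans (Finset.sum_le_sum_of_subset hKK)

end Cut
end Decode

/-! ### Short codes for coarsenings of a given clustering -/

section Code

variable {D : ℕ → ℕ → ℝ} {net : ℕ → ℕ} {M : ℕ} {δ : ℝ} {ι : Type*} [DecidableEq ι]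
  {I : Finset ι} {C : ι → Finset ℕ} {a : ι → ℕ}

/-- The net is covered by clusters `C i` with diameter at most `(a i - 1) * δ`. -/
structure Cover (D : ℕ → ℕ → ℝ) (net : ℕ → ℕ) (M : ℕ) (δ : ℝ) (I : Finset ι)
    (C : ι → Finset ℕ) (a : ι → ℕ) : Prop where
  lt : ∀ i ∈ I, ∀ u ∈ C i, u < M
  nonempty : ∀ i ∈ I, (C i).Nonempty
  cover : ∀ u < M, ∃ i ∈ I, u ∈ C i
  diam : ∀ i ∈ I, ∀ u ∈ C i, ∀ w ∈ C i, D (net u) (net w) ≤ ((a i : ℝ) - 1) * δ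
  pos : ∀ i ∈ I, 1 ≤ a i
  delta : 0 ≤ δ
  nonneg : ∀ x y, 0 ≤ D x y
  self : ∀ x, D x x = 0
  triangle : ∀ u < M, ∀ v < M, ∀ w < M,
    D (net u) (net w) ≤ D (net u) (net v) + D (net v) (net w)

/-- A decoder state in which no cluster is split; `lbl i` is the class that contains `C i`. -/
structure Dec.Good (M : ℕ) (I : Finset ι) (C : ι → Finset ℕ) (st : Dec) (lbl : ι → ℕ) : Prop where
  part : ∀ i ∈ I, ∀ u ∈ C i, st.part u = lbl i
  lt : ∀ i ∈ I, lbl i < st.cnt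
  surj : ∀ c < st.cnt, ∃ i ∈ I, lbl i = c
  cur_le : st.cur ≤ st.cnt

def fam (I : Finset ι) (lbl : ι → ℕ) (c : ℕ) : Finset ι := I.filter fun i => lbl i = c

theorem mem_fam {lbl : ι → ℕ} {c : ℕ} {i : ι} : i ∈ fam I lbl c ↔ i ∈ I ∧ lbl i = c :=
  Finset.mem_filter

/-- The number of digits that describe a class made of `m` clusters of total weight `A`. -/
def codeLen (e A m : ℕ) : ℕ := A / 2 ^ e + (e + 4) * m - 3 - Nat.log 2 A

/-- Division by `2 ^ e` lowers the logarithm by `e`, and a logarithm is at most its argument. This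
keeps the subtractions in `codeLen` from being truncated when `1 ≤ m`. -/
theorem log_le_add_div (e A : ℕ) : Nat.log 2 A ≤ e + A / 2 ^ e := by
  have h1 : Nat.log 2 (A / 2 ^ e) = Nat.log 2 A - e := by
    induction e with
    | zero => simp
    | succ e ih => rw [pow_succ, ← Nat.div_div_eq_div_mul, Nat.log_div_base, ih]; omega
  have h2 := Nat.log_le_self 2 (A / 2 ^ e)
  omega

theorem one_le_codeLen (e A : ℕ) {m : ℕ} (hm : 1 ≤ m) : 1 ≤ codeLen e A m := by
  have h1 := log_le_add_div e A
  have h2 : (e + 4) * 1 ≤ (e + 4) * m := Nat.mul_le_mul_left _ hm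
  unfold codeLen
  omega

/-- The term `Nat.log 2 t + 2` is the price of a cut: `Nat.log 2 t + 1` binary digits of the radius
and one digit for the cut itself. The negative logarithm pays: `t` is at most the smaller of `A`,
`B`, and `A + B` is at most twice the larger, so `log (A + B) + log t ≤ log A + log B + 1`. The
constant 3 in `codeLen` is what balances `6 - 2 - 1`. -/
theorem codeLen_add {e A B m n t : ℕ} (hm : 1 ≤ m) (hn : 1 ≤ n) (htA : t ≤ A) (htB : t ≤ B) :
    codeLen e A m + codeLen e B n + (Nat.log 2 t + 2) ≤ codeLen e (A + B) (m + n) := by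
  have h1 := log_le_add_div e A
  have h2 := log_le_add_div e B
  have h3 : (e + 4) * 1 ≤ (e + 4) * m := Nat.mul_le_mul_left _ hm
  have h4 : (e + 4) * 1 ≤ (e + 4) * n := Nat.mul_le_mul_left _ hn
  have h5 : A / 2 ^ e + B / 2 ^ e ≤ (A + B) / 2 ^ e := Nat.div_add_div_le_add_div
  have h6 : (e + 4) * (m + n) = (e + 4) * m + (e + 4) * n := Nat.mul_add _ _ _
  have h7 : ∀ A B t : ℕ, t ≤ A → A ≤ B →
      Nat.log 2 (A + B) + Nat.log 2 t ≤ Nat.log 2 A + Nat.log 2 B + 1 := by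
    intro A B t htA hAB
    rcases Nat.eq_zero_or_pos B with rfl | hB
    · obtain rfl : A = 0 := by omega
      obtain rfl : t = 0 := by omega
      simp
    have h1 : Nat.log 2 t ≤ Nat.log 2 A := Nat.log_mono_right htA
    have h2 : Nat.log 2 (A + B) ≤ Nat.log 2 (B * 2) := Nat.log_mono_right (by omega)
    rw [Nat.log_mul_base (by norm_num) hB.ne'] at h2
    omega
  have h8 : Nat.log 2 (A + B) + Nat.log 2 t ≤ Nat.log 2 A + Nat.log 2 B + 1 := by
    rcases le_total A B with h | h
    · exact h7 A B t htA h
    · have := h7 B A t htB h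
      rw [add_comm B A] at this
      omega
  unfold codeLen
  omega

/-- The binary digits of `t` are entered with the most significant one first. -/
theorem exists_radius_word {st : Dec} (hc : st.cur < st.cnt) (hr : st.rr = 0) (b : ℕ) :
    ∀ t : ℕ, t < 2 ^ b → ∃ w : List ℕ, (∀ d ∈ w, d < 5) ∧ w.length ≤ b ∧
      w.foldl (Dec.step D net M δ) st = { st with rr := t * δ } := by
  induction b with
  | zero =>
    intro t ht
    obtain rfl : t = 0 := by rw [pow_zero] at ht; omega
    refine ⟨[], by simp, by simp, ?_⟩
    cases st
    simp_all
  | succ b ih =>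
    intro t ht
    obtain ⟨w, hw, hlen, heq⟩ := ih (t / 2) (by rw [pow_succ] at ht; omega)
    refine ⟨w ++ [1 + t % 2], ?_, by simpa using hlen, ?_⟩
    · intro d hd
      rcases List.mem_append.1 hd with h | h
      · exact hw d h
      · simp at h; omega
    · rw [List.foldl_append, heq]
      have h2 : (t : ℝ) = (t / 2 : ℕ) * 2 + (t % 2 : ℕ) := by
        exact_mod_cast (Nat.div_add_mod' t 2).symm
      rcases Nat.mod_two_eq_zero_or_one t with h | h
      · simp only [List.foldl_cons, List.foldl_nil, Dec.step, h, if_pos hc]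
        rw [h2, h]
        simp
        ring
      · simp only [List.foldl_cons, List.foldl_nil, Dec.step, h, if_pos hc]
        rw [h2, h]
        simp
        ring

/-- A class whose clusters are too short to connect its diameter can be cut. -/
theorem Cover.exists_cut (h : Cover D net M δ I C a) {st : Dec} {lbl : ι → ℕ}
    (hg : st.Good M I C lbl) (hc : st.cur < st.cnt)
    (hlt : (((∑ i ∈ fam I lbl st.cur, a i : ℕ) : ℝ) - 1) * δ <
      (scan D net M st.part st.cur M).2) :
    ∃ K ⊆ fam I lbl st.cur, K.Nonempty ∧ (fam I lbl st.cur \ K).Nonempty ∧ ∃ (t : ℕ) (r : ℝ),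
      (r = t * δ ∨ r = (scan D net M st.part st.cur M).2 - t * δ) ∧
      (∀ i ∈ K, ∀ u ∈ C i, D (scan D net M st.part st.cur M).1 (net u) ≤ r) ∧
      (∀ i ∈ fam I lbl st.cur \ K, ∀ u ∈ C i, r < D (scan D net M st.part st.cur M).1 (net u)) ∧
      t ≤ ∑ i ∈ K, a i ∧ t ≤ ∑ i ∈ fam I lbl st.cur \ K, a i := by
  have hA : 1 ≤ ∑ i ∈ fam I lbl st.cur, a i := by
    obtain ⟨i, hi, hic⟩ := hg.surj _ hc
    exact (h.pos i hi).trans (Finset.single_le_sum (f := a) (fun _ _ => Nat.zero_le _)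
      (mem_fam.2 ⟨hi, hic⟩))
  have hH : 0 < (scan D net M st.part st.cur M).2 := by
    refine lt_of_le_of_lt (mul_nonneg ?_ h.delta) hlt
    have : (1 : ℝ) ≤ (∑ i ∈ fam I lbl st.cur, a i : ℕ) := by exact_mod_cast hA
    linarith
  obtain ⟨u₀, hu₀, w₀, hw₀, hpu, hpw, heq⟩ :=
    (scan_spec (D := D) (net := net) (M := M) st.part st.cur M).resolve_left hH.ne'
  have hle := le_scan (D := D) (net := net) (M := M) st.part st.cur M
  set sc := scan D net M st.part st.cur M
  have e1 : sc.1 = net u₀ := by rw [heq]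
  have e2 : sc.2 = D (net u₀) (net w₀) := by rw [heq]
  have hpt : ∀ i ∈ fam I lbl st.cur, ∀ u ∈ C i, u < M ∧ st.part u = st.cur := fun i hi u hu =>
    ⟨h.lt i (mem_fam.1 hi).1 u hu, (hg.part i (mem_fam.1 hi).1 u hu).trans (mem_fam.1 hi).2⟩
  -- The interval of a cluster is the range of its distances from the end point of the diameter. By
  -- the triangle inequality it is no longer than the diameter of the cluster.
  let lo : ι → ℝ := fun i => if hi : (C i).Nonempty then (C i).inf' hi fun u => D sc.1 (net u) else 0
  let hi' : ι → ℝ := fun i =>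
    if hi : (C i).Nonempty then (C i).sup' hi fun u => D sc.1 (net u) else 0
  have hlo : ∀ i, ∀ u ∈ C i, lo i ≤ D sc.1 (net u) := by
    intro i u hu
    have hn : (C i).Nonempty := ⟨u, hu⟩
    simp only [lo]
    rw [dif_pos hn]
    exact Finset.inf'_le (fun u => D sc.1 (net u)) hu
  have hhi : ∀ i, ∀ u ∈ C i, D sc.1 (net u) ≤ hi' i := by
    intro i u hu
    have hn : (C i).Nonempty := ⟨u, hu⟩
    simp only [hi']
    rw [dif_pos hn]
    exact Finset.le_sup' (fun u => D sc.1 (net u)) hu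
  have hlo' : ∀ i ∈ fam I lbl st.cur, ∃ u ∈ C i, lo i = D sc.1 (net u) := by
    intro i hi
    have hn := h.nonempty i (mem_fam.1 hi).1
    simp only [lo]
    rw [dif_pos hn]
    exact Finset.exists_mem_eq_inf' hn _
  have hhi' : ∀ i ∈ fam I lbl st.cur, ∃ u ∈ C i, hi' i = D sc.1 (net u) := by
    intro i hi
    have hn := h.nonempty i (mem_fam.1 hi).1
    simp only [hi']
    rw [dif_pos hn]
    exact Finset.exists_mem_eq_sup' hn _
  obtain ⟨i₀, hi₀, hui₀⟩ := h.cover u₀ hu₀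
  obtain ⟨i₁, hi₁, hwi₁⟩ := h.cover w₀ hw₀
  have hi₀f : i₀ ∈ fam I lbl st.cur := mem_fam.2 ⟨hi₀, (hg.part i₀ hi₀ u₀ hui₀).symm.trans hpu⟩
  have hi₁f : i₁ ∈ fam I lbl st.cur := mem_fam.2 ⟨hi₁, (hg.part i₁ hi₁ w₀ hwi₁).symm.trans hpw⟩
  have hhH : ∀ i ∈ fam I lbl st.cur, hi' i ≤ sc.2 := by
    intro i hi
    obtain ⟨u, hu, he⟩ := hhi' i hi
    rw [he, e1]
    exact hle u₀ hu₀ u (hpt i hi u hu).1 hpu (hpt i hi u hu).2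
  obtain ⟨K, hK, hKn, hKn', t, r, hr, h1, h2, h3, h4⟩ := exists_gap (J := fam I lbl st.cur)
    (lo := lo) (hi := hi') (a := a) (δ := δ) (H := sc.2) h.delta
    (fun i hi => by obtain ⟨u, hu, he⟩ := hlo' i hi; rw [he]; exact h.nonneg _ _)
    (fun i hi => by obtain ⟨u, hu, he⟩ := hlo' i hi; rw [he]; exact hhi i u hu)
    (fun i hi => by
      obtain ⟨u, hu, he⟩ := hlo' i hi
      obtain ⟨w, hw, he'⟩ := hhi' i hi
      have := h.triangle u₀ hu₀ u (hpt i hi u hu).1 w (hpt i hi w hw).1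
      have := h.diam i (mem_fam.1 hi).1 u hu w hw
      rw [he, he', e1]
      linarith)
    hhH hi₀f hi₁f (by have := hlo i₀ u₀ hui₀; rwa [e1, h.self] at this)
    (le_antisymm (hhH i₁ hi₁f) (by have := hhi i₁ w₀ hwi₁; rwa [e1, ← e2] at this)) hH hlt
  refine ⟨K, hK, hKn, hKn', t, r, hr, fun i hi u hu => (hhi i u hu).trans (h1 i hi),
    fun i hi u hu => (h2 i hi).trans_le (hlo i u hu), h3, h4⟩

/-- The current class is closed if the total weight of its clusters accounts for its diameter, and
otherwise cut in a gap. The quantity bounded by `N` drops by one in both cases: closing raises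
`cur`, and a cut raises `cnt`, which counts twice. -/
theorem exists_word (h : Cover D net M δ I C a) (e : ℕ) (N : ℕ) : ∀ (st : Dec) (lbl : ι → ℕ),
    st.Good M I C lbl → st.rr = 0 → st.cnt ≤ I.card →
    2 * (I.card - st.cnt) + (st.cnt - st.cur) ≤ N →
    ∃ w : List ℕ, (∀ d ∈ w, d < 5) ∧
      w.length ≤ ∑ c ∈ Finset.Ico st.cur st.cnt,
        codeLen e (∑ i ∈ fam I lbl c, a i) (fam I lbl c).card ∧
      ∃ lbl', (w.foldl (Dec.step D net M δ) st).Good M I C lbl' ∧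
        (w.foldl (Dec.step D net M δ) st).cur = (w.foldl (Dec.step D net M δ) st).cnt ∧
        (w.foldl (Dec.step D net M δ) st).ub ≤ st.ub + ∑ c ∈ Finset.Ico st.cur st.cnt,
          ((∑ i ∈ fam I lbl c, a i + (fam I lbl c).card : ℕ) : ℝ) * δ := by
  induction N with
  | zero =>
    intro st lbl hg hr hcard hN
    have := hg.cur_le
    exact ⟨[], by simp, Nat.zero_le _, lbl, hg, by simp; omega, by
      simp [show st.cur = st.cnt by omega]⟩
  | succ N ih =>
    intro st lbl hg hr hcard hN
    rcases hg.cur_le.eq_or_lt with hc | hc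
    · exact ⟨[], by simp, Nat.zero_le _, lbl, hg, hc, by simp [hc]⟩
    have hfam : 1 ≤ (fam I lbl st.cur).card := by
      obtain ⟨i, hi, hic⟩ := hg.surj _ hc
      exact Finset.card_pos.2 ⟨i, mem_fam.2 ⟨hi, hic⟩⟩
    have hIco : Finset.Ico st.cur st.cnt = insert st.cur (Finset.Ico (st.cur + 1) st.cnt) := by
      ext; simp; omega
    have hnot : st.cur ∉ Finset.Ico (st.cur + 1) st.cnt := by simp
    by_cases hle : (scan D net M st.part st.cur M).2 ≤
        (((∑ i ∈ fam I lbl st.cur, a i : ℕ) : ℝ) - 1) * δ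
    · set st' := st.step D net M δ 0 with hst'
      simp only [Dec.step, if_pos hc, if_true] at hst'
      obtain ⟨w, h1, h2, lbl', h3, h4, h5⟩ := ih st' lbl
        ⟨by rw [hst']; exact hg.part, by rw [hst']; exact hg.lt, by rw [hst']; exact hg.surj,
          by rw [hst']; exact hc⟩ (by rw [hst']) (by rw [hst']; exact hcard)
        (by rw [hst']; simp only; omega)
      have e1 : st'.cur = st.cur + 1 := by rw [hst']
      have e2 : st'.cnt = st.cnt := by rw [hst']
      have e3 : st'.ub = st.ub + (scan D net M st.part st.cur M).2 + δ + δ := by rw [hst']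
      rw [e1, e2] at h2 h5
      refine ⟨0 :: w, by simpa using h1, ?_, lbl', h3, h4, ?_⟩
      · rw [hIco, Finset.sum_insert hnot, List.length_cons]
        have := one_le_codeLen e (∑ i ∈ fam I lbl st.cur, a i) hfam
        omega
      · rw [hIco, Finset.sum_insert hnot]
        refine h5.trans ?_
        rw [e3]
        -- Of the `2 * δ` charged for closing, one `δ` is covered by the `- 1` in the diameter bound
        -- and the other by the number of clusters in the class.
        have : (1 : ℝ) ≤ (fam I lbl st.cur).card := by exact_mod_cast hfam
        have := mul_le_mul_of_nonneg_right this h.delta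
        push_cast at hle ⊢
        linarith
    · obtain ⟨K, hK, hKn, hKn', t, r, hr', hin, hout, ht1, ht2⟩ :=
        h.exists_cut hg hc (not_le.1 hle)
      obtain ⟨w₀, hw1, hw2, hw3⟩ := exists_radius_word (D := D) (net := net) (M := M) (δ := δ)
        hc hr (Nat.log 2 t + 1) t (Nat.lt_pow_succ_log_self (by norm_num) t)
      obtain ⟨d, hd, hst'⟩ : ∃ d < 5, Dec.step D net M δ { st with rr := t * δ } d =
          st.cut D net (scan D net M st.part st.cur M).1 r := by
        rcases hr' with rfl | rfl
        · exact ⟨3, by norm_num, by simp [Dec.step, if_pos hc, Dec.cut]⟩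
        · exact ⟨4, by norm_num, by simp [Dec.step, if_pos hc, Dec.cut]⟩
      set st' := st.cut D net (scan D net M st.part st.cur M).1 r with hst''
      let lbl' : ι → ℕ := fun i => if i ∈ fam I lbl st.cur \ K then st.cnt else lbl i
      have hf1 : fam I lbl' st.cur = K := by
        ext i
        simp only [mem_fam, lbl', Finset.mem_sdiff]
        by_cases hiK : i ∈ K
        · simp [hiK, mem_fam.1 (hK hiK)]
        · simp only [hiK, not_false_eq_true, and_true, iff_false, not_and]
          intro hi
          split_ifs with h'
          · omega
          · exact fun h'' => h' ⟨hi, h''⟩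
      have hf2 : fam I lbl' st.cnt = fam I lbl st.cur \ K := by
        ext i
        simp only [mem_fam, lbl']
        by_cases hiK : i ∈ fam I lbl st.cur \ K
        · simp [hiK, (mem_fam.1 (Finset.mem_sdiff.1 hiK).1).1]
        · simp only [hiK, if_false, iff_false, not_and]
          exact fun hi => (hg.lt i hi).ne
      have hf3 : ∀ c, c ≠ st.cur → c < st.cnt → fam I lbl' c = fam I lbl c := by
        intro c hc1 hc2
        ext i
        simp only [mem_fam, lbl']
        by_cases hiK : i ∈ fam I lbl st.cur \ K
        · have := (mem_fam.1 (Finset.mem_sdiff.1 hiK).1).2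
          simp only [hiK, if_true]
          constructor <;> rintro ⟨_, h⟩ <;> omega
        · simp [hiK]
      -- Both sides of the cut contain a cluster, so there are never more classes than clusters.
      have hcard' : st.cnt + 1 ≤ I.card := by
        have hsub : (Finset.range (st.cnt + 1)) ⊆ I.image lbl' := by
          intro c hc'
          rw [Finset.mem_range] at hc'
          have : (fam I lbl' c).Nonempty := by
            rcases Nat.lt_succ_iff_lt_or_eq.1 hc' with h' | rfl
            · by_cases hcc : c = st.cur
              · rw [hcc, hf1]; exact hKn
              · rw [hf3 c hcc h']
                obtain ⟨i, hi, hic⟩ := hg.surj c h'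
                exact ⟨i, mem_fam.2 ⟨hi, hic⟩⟩
            · rw [hf2]; exact hKn'
          obtain ⟨i, hi⟩ := this
          exact Finset.mem_image.2 ⟨i, mem_fam.1 hi⟩
        simpa using (Finset.card_le_card hsub).trans Finset.card_image_le
      have hg' : st'.Good M I C lbl' := by
        refine ⟨fun i hi u hu => ?_, fun i hi => ?_, fun c hc' => ?_, ?_⟩
        · have hp := hg.part i hi u hu
          simp only [hst'', Dec.cut, lbl', hp]
          by_cases hif : i ∈ fam I lbl st.cur
          · by_cases hiK : i ∈ K
            · simp [hiK, (hin i hiK u hu).not_gt]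
            · have := hout i (Finset.mem_sdiff.2 ⟨hif, hiK⟩) u hu
              simp [hif, hiK, this, (mem_fam.1 hif).2]
          · have : lbl i ≠ st.cur := fun h => hif (mem_fam.2 ⟨hi, h⟩)
            simp [hif, this]
        · have := hg.lt i hi
          simp only [hst'', Dec.cut, lbl']
          split_ifs <;> omega
        · simp only [hst'', Dec.cut] at hc'
          have : (fam I lbl' c).Nonempty := by
            rcases Nat.lt_succ_iff_lt_or_eq.1 hc' with h' | rfl
            · by_cases hcc : c = st.cur
              · rw [hcc, hf1]; exact hKn
              · rw [hf3 c hcc h']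
                obtain ⟨i, hi, hic⟩ := hg.surj c h'
                exact ⟨i, mem_fam.2 ⟨hi, hic⟩⟩
            · rw [hf2]; exact hKn'
          obtain ⟨i, hi⟩ := this
          exact ⟨i, mem_fam.1 hi⟩
        · simp only [hst'', Dec.cut]; omega
      have e1 : st'.cur = st.cur := rfl
      have e2 : st'.cnt = st.cnt + 1 := rfl
      obtain ⟨w, h1, h2, lbl'', h3, h4, h5⟩ := ih st' lbl' hg' rfl hcard' (by
        rw [e1, e2]; omega)
      have hsum : ∀ {β : Type} [AddCommMonoid β] (f : Finset ι → β),
          ∑ c ∈ Finset.Ico st'.cur st'.cnt, f (fam I lbl' c) =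
            f K + f (fam I lbl st.cur \ K) +
              ∑ c ∈ Finset.Ico (st.cur + 1) st.cnt, f (fam I lbl c) := by
        intro β _ f
        have : Finset.Ico st'.cur st'.cnt =
            insert st.cur (insert st.cnt (Finset.Ico (st.cur + 1) st.cnt)) := by
          rw [e1, e2]; ext; simp; omega
        rw [this, Finset.sum_insert (by simp; omega), Finset.sum_insert (by simp), hf1, hf2,
          add_assoc]
        congr 2
        refine Finset.sum_congr rfl fun c hc' => ?_
        rw [Finset.mem_Ico] at hc'
        rw [hf3 c (by omega) hc'.2]
      rw [hsum fun F => codeLen e (∑ i ∈ F, a i) F.card] at h2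
      rw [hsum fun F => ((∑ i ∈ F, a i + F.card : ℕ) : ℝ) * δ] at h5
      have hA : ∑ i ∈ fam I lbl st.cur, a i = ∑ i ∈ K, a i + ∑ i ∈ fam I lbl st.cur \ K, a i := by
        rw [add_comm, Finset.sum_sdiff hK]
      have hm : (fam I lbl st.cur).card = K.card + (fam I lbl st.cur \ K).card := by
        rw [add_comm, Finset.card_sdiff_add_card_eq_card hK]
      have hfold : (w₀ ++ d :: w).foldl (Dec.step D net M δ) st =
          w.foldl (Dec.step D net M δ) st' := by
        rw [List.foldl_append, List.foldl_cons, hw3, hst']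
      refine ⟨w₀ ++ d :: w, ?_, ?_, lbl'', ?_⟩
      · intro d' hd'
        simp only [List.mem_append, List.mem_cons] at hd'
        rcases hd' with h' | rfl | h'
        exacts [hw1 _ h', hd, h1 _ h']
      · rw [hIco, Finset.sum_insert hnot, hA, hm]
        have := codeLen_add (e := e) (Finset.card_pos.2 hKn) (Finset.card_pos.2 hKn') ht1 ht2
        simp only [List.length_append, List.length_cons]
        omega
      · rw [hfold]
        refine ⟨h3, h4, h5.trans ?_⟩
        rw [hIco, Finset.sum_insert hnot, hA, hm]
        have e3 : st'.ub = st.ub := rfl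
        rw [e3]
        push_cast
        linarith

theorem Dec.step_of_finished {st : Dec} (h : st.cur = st.cnt) (d : ℕ) :
    st.step D net M δ d = st := by
  simp [Dec.step, h]

theorem decode_eq_foldl (dig : ℕ → ℕ) (i : ℕ) :
    decode D net M δ dig i = ((List.range i).map dig).foldl (Dec.step D net M δ) Dec.init := by
  induction i with
  | zero => rfl
  | succ i ih => rw [decode, ih, List.range_succ, List.map_append, List.foldl_append]; rfl

/-- Some string of digits leads to a clustering that splits no cluster and whose cost is
controlled by the total weight. -/
theorem exists_digits (h : Cover D net M δ I C a) (e L : ℕ) (hI : I.Nonempty)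
    (hL : codeLen e (∑ i ∈ I, a i) I.card ≤ L) :
    ∃ dig : ℕ → ℕ, (∀ i, dig i < 5) ∧ (∀ i, L ≤ i → dig i = 0) ∧ ∃ lbl : ι → ℕ,
      (decode D net M δ dig L).Good M I C lbl ∧
      (decode D net M δ dig L).cur = (decode D net M δ dig L).cnt ∧
      (decode D net M δ dig L).cnt ≤ I.card ∧
      (decode D net M δ dig L).ub ≤ ((∑ i ∈ I, a i + I.card : ℕ) : ℝ) * δ := by
  have hcard : 1 ≤ I.card := Finset.card_pos.2 hI
  obtain ⟨w, h1, h2, lbl, h3, h4, h5⟩ := exists_word h e (2 * (I.card - 1) + 1) Dec.init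
    (fun _ => 0) ⟨fun _ _ _ _ => rfl, fun _ _ => Nat.one_pos, fun c hc => by
      obtain ⟨i, hi⟩ := hI
      exact ⟨i, hi, by simp [Dec.init] at hc; omega⟩, Nat.zero_le _⟩ rfl hcard
    (by simp [Dec.init])
  have hfam : fam I (fun _ => 0) 0 = I := by simp [fam]
  simp only [Dec.init, Nat.Ico_zero_eq_range, Finset.sum_range_one, hfam, zero_add] at h2 h5
  have hwL : w.length ≤ L := h2.trans hL
  -- Padding with zeros is harmless, since a decoder without open classes ignores every digit.
  have key : decode D net M δ (fun i => w.getD i 0) L =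
      w.foldl (Dec.step D net M δ) Dec.init := by
    have : (List.range L).map (fun i => w.getD i 0) = w ++ List.replicate (L - w.length) 0 := by
      apply List.ext_getElem
      · simp; omega
      · intro i hi1 hi2
        simp only [List.getElem_map, List.getElem_range, List.getElem_append,
          List.getElem_replicate]
        split_ifs with h'
        · simp [h']
        · simp [Nat.not_lt.1 h']
    rw [decode_eq_foldl, this, List.foldl_append]
    generalize L - w.length = m
    induction m with
    | zero => rfl
    | succ m ih => rw [List.replicate_succ, List.foldl_cons, Dec.step_of_finished h4, ih]
  refine ⟨fun i => w.getD i 0, fun i => ?_, fun i hi => ?_, lbl, ?_⟩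
  · by_cases hi : i < w.length
    · simpa [hi] using h1 _ (List.getElem_mem hi)
    · simp [Nat.not_lt.1 hi]
  · simp [hwL.trans hi]
  · rw [key]
    refine ⟨h3, h4, ?_, h5⟩
    have hsub : Finset.range (w.foldl (Dec.step D net M δ) Dec.init).cnt ⊆ I.image lbl := by
      intro c hc
      obtain ⟨i, hi, hic⟩ := h3.surj c (Finset.mem_range.1 hc)
      exact Finset.mem_image.2 ⟨i, hi, hic⟩
    simpa using (Finset.card_le_card hsub).trans Finset.card_image_le

end Code

/-! ### Doubling dimension -/

section Doubling

variable {X : Type*} [Fintype X] [MetricSpace X]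

theorem doublingDim_set_nonempty : {m : ℝ | 0 ≤ m ∧ ∀ (x : X) (r : ℝ), 0 ≤ r → ∃ s : Finset X,
    (s.card : ℝ) ≤ 2 ^ m ∧ Metric.closedBall x r ⊆ ⋃ y ∈ s, Metric.closedBall y (r / 2)}.Nonempty := by
  refine ⟨Fintype.card X, Nat.cast_nonneg _, fun x r hr => ⟨Finset.univ, ?_, fun y _ => ?_⟩⟩
  · rw [Real.rpow_natCast]
    exact_mod_cast (Nat.lt_two_pow_self).le
  · simp only [Set.mem_iUnion]
    exact ⟨y, Finset.mem_univ _, Metric.mem_closedBall_self (by linarith)⟩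

theorem doublingDim_nonneg : 0 ≤ doublingDim X :=
  le_csInf doublingDim_set_nonempty fun _ h => h.1

/-- The infimum is attained: the binary logarithm of the least size of a cover of this ball is at
most every admissible exponent. -/
theorem exists_cover_half (x : X) {r : ℝ} (hr : 0 ≤ r) : ∃ s : Finset X,
    (s.card : ℝ) ≤ 2 ^ doublingDim X ∧
      Metric.closedBall x r ⊆ ⋃ y ∈ s, Metric.closedBall y (r / 2) := by
  classical
  have hex : ∃ m, ∃ s : Finset X, s.card = m ∧
      Metric.closedBall x r ⊆ ⋃ y ∈ s, Metric.closedBall y (r / 2) := by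
    obtain ⟨m, hm⟩ := doublingDim_set_nonempty (X := X)
    obtain ⟨s, hs⟩ := hm.2 x r hr
    exact ⟨_, s, rfl, hs.2⟩
  obtain ⟨s, hs1, hs2⟩ := Nat.find_spec hex
  refine ⟨s, ?_, hs2⟩
  rcases Nat.eq_zero_or_pos s.card with h0 | hpos
  · rw [h0]; simp; positivity
  have hpos' : (0 : ℝ) < s.card := by exact_mod_cast hpos
  have : Real.logb 2 s.card ≤ doublingDim X := by
    refine le_csInf doublingDim_set_nonempty fun m hm => ?_
    obtain ⟨s', h1, h2⟩ := hm.2 x r hr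
    have : s.card ≤ s'.card := hs1 ▸ Nat.find_min' hex ⟨s', rfl, h2⟩
    rw [Real.logb_le_iff_le_rpow (by norm_num) hpos']
    exact (by exact_mod_cast this : (s.card : ℝ) ≤ s'.card).trans h1
  rwa [Real.logb_le_iff_le_rpow (by norm_num) hpos'] at this

/-- Around a closest pair, balls of half the distance are single points, so a ball that contains the
pair needs two of them. This is what allows factors polynomial in `k` and `1 / ε` to be absorbed
into the exponential term. -/
theorem one_le_doublingDim [Nontrivial X] : 1 ≤ doublingDim X := by
  classical
  refine le_csInf doublingDim_set_nonempty fun m hm => ?_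
  have hne : (Finset.univ : Finset X).offDiag.Nonempty := by
    obtain ⟨x, y, h⟩ := exists_pair_ne X
    exact ⟨(x, y), by simp [h]⟩
  obtain ⟨⟨x, y⟩, hxy, hmin⟩ := Finset.exists_min_image _ (fun p : X × X => dist p.1 p.2) hne
  have hxy : x ≠ y := by simpa using hxy
  have hd : 0 < dist x y := dist_pos.2 hxy
  obtain ⟨s, h1, h2⟩ := hm.2 x (dist x y) dist_nonneg
  have key : ∀ z ∈ Metric.closedBall x (dist x y), z ∈ s := by
    intro z hz
    have := h2 hz
    simp only [Set.mem_iUnion, Metric.mem_closedBall] at this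
    obtain ⟨w, hw, hzw⟩ := this
    by_contra hzs
    have hne : z ≠ w := fun h => hzs (h ▸ hw)
    have := hmin (z, w) (by simp [hne])
    simp only at this
    linarith
  have hx := key x (Metric.mem_closedBall_self dist_nonneg)
  have hy := key y (by simp [dist_comm])
  have hc : 2 ≤ s.card := by
    rw [← Finset.card_pair hxy]
    exact Finset.card_le_card (by simp [Finset.insert_subset_iff, hx, hy])
  have : (2 : ℝ) ^ (1 : ℝ) ≤ 2 ^ m := by
    rw [Real.rpow_one]
    exact (by exact_mod_cast hc : (2 : ℝ) ≤ s.card).trans h1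
  exact (Real.rpow_le_rpow_left_iff (by norm_num)).1 this

theorem exists_cover_pow (x : X) {r : ℝ} (hr : 0 ≤ r) (j : ℕ) : ∃ s : Finset X,
    (s.card : ℝ) ≤ ((2 : ℝ) ^ doublingDim X) ^ j ∧
      Metric.closedBall x r ⊆ ⋃ y ∈ s, Metric.closedBall y (r / 2 ^ j) := by
  classical
  induction j with
  | zero => exact ⟨{x}, by simp, by simp⟩
  | succ j ih =>
    obtain ⟨s, h1, h2⟩ := ih
    choose f hf1 hf2 using fun y : X => exists_cover_half y (r := r / 2 ^ j) (by positivity)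
    refine ⟨s.biUnion f, ?_, fun z hz => ?_⟩
    · calc ((s.biUnion f).card : ℝ) ≤ ∑ y ∈ s, ((f y).card : ℝ) := by
            exact_mod_cast Finset.card_biUnion_le
        _ ≤ ∑ _y ∈ s, (2 : ℝ) ^ doublingDim X := Finset.sum_le_sum fun y _ => hf1 y
        _ = s.card * (2 : ℝ) ^ doublingDim X := by simp
        _ ≤ _ := by rw [pow_succ]; gcongr
    · have := h2 hz
      simp only [Set.mem_iUnion] at this
      obtain ⟨y, hy, hzy⟩ := this
      have := hf2 y hzy
      simp only [Set.mem_iUnion] at this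
      obtain ⟨w, hw, hzw⟩ := this
      simp only [Set.mem_iUnion]
      refine ⟨w, Finset.mem_biUnion.2 ⟨y, hy, hw⟩, ?_⟩
      rwa [div_div, ← pow_succ] at hzw

/-- Each of the small balls left after `j` halvings contains at most one of the separated points. -/
theorem card_separated_le (x : X) {r δ : ℝ} (hr : 0 ≤ r) (j : ℕ) (hj : 2 * (r / 2 ^ j) ≤ δ)
    {s : Finset X} (hs : ∀ y ∈ s, dist y x ≤ r) (hsep : ∀ y ∈ s, ∀ z ∈ s, y ≠ z → δ < dist y z) :
    (s.card : ℝ) ≤ ((2 : ℝ) ^ doublingDim X) ^ j := by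
  classical
  obtain ⟨t, h1, h2⟩ := exists_cover_pow x hr j
  have : ∀ y ∈ s, ∃ w ∈ t, dist y w ≤ r / 2 ^ j := by
    intro y hy
    have := h2 (Metric.mem_closedBall.2 (hs y hy))
    simpa [Set.mem_iUnion] using this
  choose! f hf1 hf2 using this
  refine le_trans ?_ h1
  exact_mod_cast Finset.card_le_card_of_injOn f hf1 fun y hy z hz hyz => by
    by_contra hne
    have h3 := hsep y hy z hz hne
    have h4 := dist_triangle_right y z (f y)
    have h5 := hf2 y hy
    have h6 := hf2 z hz
    rw [← hyz] at h6
    linarith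

end Doubling

/-! ### Clusterings -/

section Clusterings

variable {X : Type*} [Fintype X] [DecidableEq X]

theorem exists_isMerge (𝒞 : Clustering X) {A B : Finset X} (hA : A ∈ 𝒞.parts) (hB : B ∈ 𝒞.parts)
    (hAB : A ≠ B) : ∃ 𝒞' : Clustering X,
      𝒞'.parts = insert (A ∪ B) ((𝒞.parts.erase A).erase B) := by
  have hsub : (𝒞.parts.erase A).erase B ⊆ 𝒞.parts :=
    (Finset.erase_subset _ _).trans (Finset.erase_subset _ _)
  have hdisj : Disjoint (((𝒞.parts.erase A).erase B).sup id) (A ∪ B) := by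
    rw [Finset.disjoint_sup_left]
    intro D hD
    simp only [Finset.mem_erase] at hD
    rw [id, Finset.disjoint_union_right]
    exact ⟨𝒞.disjoint hD.2.2 hA hD.2.1, 𝒞.disjoint hD.2.2 hB hD.1⟩
  have hsup : ((𝒞.parts.erase A).erase B).sup id ⊔ (A ∪ B) = Finset.univ := by
    refine Eq.trans ?_ 𝒞.sup_parts
    apply le_antisymm
    · refine sup_le (Finset.sup_mono hsub) (Finset.union_subset ?_ ?_)
      · exact Finset.le_sup (f := id) hA
      · exact Finset.le_sup (f := id) hB
    · refine Finset.sup_le fun D hD => ?_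
      by_cases h1 : D = A
      · subst h1
        exact le_sup_of_le_right Finset.subset_union_left
      by_cases h2 : D = B
      · subst h2
        exact le_sup_of_le_right Finset.subset_union_right
      · exact le_sup_of_le_left (Finset.le_sup (f := id) (by simp [h1, h2, hD]))
  have hne : A ∪ B ≠ ⊥ := by
    obtain ⟨x, hx⟩ := 𝒞.nonempty_of_mem_parts hA
    exact Finset.ne_empty_of_mem (Finset.mem_union_left B hx)
  exact ⟨(𝒞.ofSubset hsub rfl).extend hne hdisj hsup, rfl⟩

/-- If `𝒞` differs from `𝒬`, some cluster lies properly inside a cluster of `𝒬`. Merging it with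
another cluster in there gives a solution with fewer clusters that still refines `𝒬`. -/
theorem IsSolution.of_le {F : Clustering X → Prop} {k : ℕ} (hm : Mergeable F k)
    {𝒬 : Clustering X} : ∀ {𝒞 : Clustering X}, 𝒞 ≤ 𝒬 → IsSolution F k 𝒞 → IsSolution F k 𝒬 := by
  suffices ∀ (N : ℕ) (𝒞 : Clustering X), 𝒞.parts.card ≤ N → 𝒞 ≤ 𝒬 → IsSolution F k 𝒞 →
      IsSolution F k 𝒬 from fun _ h1 h2 => this _ _ le_rfl h1 h2
  intro N
  induction N with
  | zero =>
    intro 𝒞 hN hle hs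
    have h0 : 𝒞.parts = ∅ := by simpa using hN
    have : 𝒞 = 𝒬 := by
      have hemp : (Finset.univ : Finset X) = ∅ := by rw [← 𝒞.sup_parts, h0]; rfl
      ext1
      rw [h0]
      symm
      rw [Finset.eq_empty_iff_forall_notMem]
      intro A hA
      obtain ⟨x, -⟩ := 𝒬.nonempty_of_mem_parts hA
      have := Finset.mem_univ x
      rw [hemp] at this
      simp at this
    exact this ▸ hs
  | succ N ih =>
    intro 𝒞 hN hle hs
    by_cases hsub : ∀ A ∈ 𝒞.parts, A ∈ 𝒬.parts
    · have : 𝒞 = 𝒬 := by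
        ext1
        refine Finset.Subset.antisymm hsub fun Q hQ => ?_
        obtain ⟨x, hx⟩ := 𝒬.nonempty_of_mem_parts hQ
        have h1 := hsub _ (𝒞.part_mem.2 (Finset.mem_univ x))
        rw [𝒬.eq_of_mem_parts hQ h1 hx (𝒞.mem_part (Finset.mem_univ x))]
        exact 𝒞.part_mem.2 (Finset.mem_univ x)
      exact this ▸ hs
    · push Not at hsub
      obtain ⟨A, hA, hAQ⟩ := hsub
      obtain ⟨Q, hQ, hAleQ⟩ := hle hA
      have hssub : A ⊂ Q := hAleQ.lt_of_ne fun h => hAQ (h ▸ hQ)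
      obtain ⟨x, hxQ, hxA⟩ := Finset.exists_of_ssubset hssub
      have hB := 𝒞.part_mem.2 (Finset.mem_univ x)
      have hxB := 𝒞.mem_part (Finset.mem_univ x)
      have hAB : A ≠ 𝒞.part x := fun h => hxA (h ▸ hxB)
      obtain ⟨𝒞', h𝒞'⟩ := exists_isMerge 𝒞 hA hB hAB
      refine ih 𝒞' ?_ ?_ (hm 𝒞 𝒞' hs ⟨A, hA, _, hB, hAB, h𝒞'⟩)
      · rw [h𝒞']
        have h1 := Finset.card_insert_le (A ∪ 𝒞.part x) ((𝒞.parts.erase A).erase (𝒞.part x))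
        rw [Finset.card_erase_of_mem (Finset.mem_erase.2 ⟨hAB.symm, hB⟩),
          Finset.card_erase_of_mem hA] at h1
        have h2 : 2 ≤ 𝒞.parts.card := by
          rw [← Finset.card_pair hAB]
          exact Finset.card_le_card (by simp [Finset.insert_subset_iff, hA, hB])
        omega
      · intro D hD
        rw [h𝒞', Finset.mem_insert] at hD
        rcases hD with rfl | hD
        · refine ⟨Q, hQ, Finset.union_subset hAleQ ?_⟩
          obtain ⟨Q', hQ', hle'⟩ := hle hB
          rwa [𝒬.eq_of_mem_parts hQ hQ' hxQ (hle' hxB)]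
        · simp only [Finset.mem_erase] at hD
          exact hle hD.2.2

/-- For `b > 0` both colour counts must be positive, because a quotient by zero is zero; the
condition then reads `b * x ≤ y` and `b * y ≤ x`, which is additive over disjoint clusters. -/
theorem mergeable_balanced {X₁ X₂ : Finset X} {b : ℝ} (hb : 0 ≤ b) (k : ℕ) :
    Mergeable (Balanced X₁ X₂ b) k := by
  rintro 𝒞 𝒞' ⟨hk, hF⟩ ⟨A, hA, B, hB, hAB, hp⟩
  refine ⟨?_, fun C hC => ?_⟩
  · rw [hp]
    have h1 := Finset.card_insert_le (A ∪ B) ((𝒞.parts.erase A).erase B)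
    rw [Finset.card_erase_of_mem (Finset.mem_erase.2 ⟨hAB.symm, hB⟩),
      Finset.card_erase_of_mem hA] at h1
    have h2 : 2 ≤ 𝒞.parts.card := by
      rw [← Finset.card_pair hAB]
      exact Finset.card_le_card (by simp [Finset.insert_subset_iff, hA, hB])
    omega
  · rw [hp, Finset.mem_insert] at hC
    rcases hC with rfl | hC
    swap
    · simp only [Finset.mem_erase] at hC
      exact hF C hC.2.2
    have hdis : Disjoint A B := 𝒞.disjoint hA hB hAB
    have hcard : ∀ Y : Finset X, (((A ∪ B) ∩ Y).card : ℝ) = (A ∩ Y).card + (B ∩ Y).card := by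
      intro Y
      rw [Finset.union_inter_distrib_right, Finset.card_union_of_disjoint
        (hdis.mono Finset.inter_subset_left Finset.inter_subset_left)]
      push_cast; rfl
    rcases hb.eq_or_lt with rfl | hb
    · positivity
    have hA' := le_min_iff.1 (hF A hA)
    have hB' := le_min_iff.1 (hF B hB)
    have pos : ∀ {x y : ℝ}, 0 ≤ y → b ≤ x / y → 0 < y ∧ b * y ≤ x := by
      intro x y hy h
      rcases hy.eq_or_lt with rfl | hy
      · simp at h; linarith
      · exact ⟨hy, (le_div_iff₀ hy).1 h⟩
    obtain ⟨a1, a2⟩ := pos (Nat.cast_nonneg _) hA'.1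
    obtain ⟨a3, a4⟩ := pos (Nat.cast_nonneg _) hA'.2
    obtain ⟨b1, b2⟩ := pos (Nat.cast_nonneg _) hB'.1
    obtain ⟨b3, b4⟩ := pos (Nat.cast_nonneg _) hB'.2
    rw [hcard, hcard, le_min_iff, le_div_iff₀ (by linarith), le_div_iff₀ (by linarith)]
    constructor <;> linarith

/-! ### Clusterings given by labels -/

section Labels

variable {n : ℕ} (pt : Fin n ≃ X) (ℓ : ℕ → ℕ)

theorem mem_part_ofLabels {x y : X} :
    y ∈ (ofLabels pt ℓ).part x ↔ ℓ (pt.symm x) = ℓ (pt.symm y) := by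
  classical
  exact Finpartition.mem_part_ofSetoid_iff_rel

theorem ofLabels_same {C : Finset X} (hC : C ∈ (ofLabels pt ℓ).parts) {x y : X} (hx : x ∈ C) :
    y ∈ C ↔ ℓ (pt.symm x) = ℓ (pt.symm y) := by
  rw [← mem_part_ofLabels, (ofLabels pt ℓ).part_eq_of_mem hC hx]

theorem ofLabels_congr {ℓ' : ℕ → ℕ} (h : ∀ i < n, ℓ i = ℓ' i) :
    ofLabels pt ℓ = ofLabels pt ℓ' := by
  have : (fun x => ℓ (pt.symm x : ℕ)) = fun x => ℓ' (pt.symm x : ℕ) :=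
    funext fun x => h _ (pt.symm x).2
  classical
  exact congrArg (fun g : X → ℕ => (Finpartition.ofSetoid (Setoid.ker g) : Clustering X)) this

theorem le_ofLabels {𝒞 : Clustering X}
    (h : ∀ C ∈ 𝒞.parts, ∀ x ∈ C, ∀ y ∈ C, ℓ (pt.symm x) = ℓ (pt.symm y)) :
    𝒞 ≤ ofLabels pt ℓ := by
  intro C hC
  obtain ⟨x, hx⟩ := 𝒞.nonempty_of_mem_parts hC
  exact ⟨_, (ofLabels pt ℓ).part_mem.2 (Finset.mem_univ x), fun y hy =>
    (mem_part_ofLabels pt ℓ).2 (h C hC x hx y hy)⟩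

/-- This turns counts and sums over clusters into counts and sums over labels. -/
theorem exists_label : ∃ f : Finset X → ℕ, (∀ C ∈ (ofLabels pt ℓ).parts, ∃ x ∈ C,
    f C = ℓ (pt.symm x)) ∧ Set.InjOn f (ofLabels pt ℓ).parts := by
  have : ∀ C ∈ (ofLabels pt ℓ).parts, ∃ x, x ∈ C := fun C hC =>
    (ofLabels pt ℓ).nonempty_of_mem_parts hC
  choose! g hg using (fun C : Finset X => (⟨if h : ∃ x, x ∈ C then ℓ (pt.symm h.choose) else 0, by
    intro hC
    have h := this C hC
    exact ⟨h.choose, h.choose_spec, by rw [dif_pos h]⟩⟩ : ∃ m : ℕ, C ∈ (ofLabels pt ℓ).parts →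
      ∃ x ∈ C, m = ℓ (pt.symm x)))
  refine ⟨g, hg, fun C hC C' hC' h => ?_⟩
  obtain ⟨x, hx, h1⟩ := hg C hC
  obtain ⟨y, hy, h2⟩ := hg C' hC'
  exact (ofLabels pt ℓ).eq_of_mem_parts hC hC' ((ofLabels_same pt ℓ hC hx).2 (by omega)) hy

theorem card_ofLabels_le {m : ℕ} (h : ∀ i < n, ℓ i < m) : (ofLabels pt ℓ).parts.card ≤ m := by
  obtain ⟨f, hf, hinj⟩ := exists_label pt ℓ
  rw [← Finset.card_range m]
  refine Finset.card_le_card_of_injOn f (fun C hC => ?_) hinj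
  obtain ⟨x, -, h1⟩ := hf C hC
  rw [h1]
  simpa using h _ (pt.symm x).2

variable [MetricSpace X]

theorem cost_ofLabels_le {m : ℕ} (h : ∀ i < n, ℓ i < m) (H : ℕ → ℝ) (h0 : ∀ c < m, 0 ≤ H c)
    (hH : ∀ x y : X, ℓ (pt.symm x) = ℓ (pt.symm y) → dist x y ≤ H (ℓ (pt.symm x))) :
    cost (ofLabels pt ℓ) ≤ ∑ c ∈ Finset.range m, H c := by
  obtain ⟨f, hf, hinj⟩ := exists_label pt ℓ
  calc cost (ofLabels pt ℓ) ≤ ∑ C ∈ (ofLabels pt ℓ).parts, H (f C) := by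
        refine Finset.sum_le_sum fun C hC => ?_
        obtain ⟨x, hx, h1⟩ := hf C hC
        rw [h1]
        refine Metric.diam_le_of_forall_dist_le (h0 _ (h _ (pt.symm x).2)) fun y hy z hz => ?_
        have hxy := (ofLabels_same pt ℓ hC hx).1 hy
        have hyz := (ofLabels_same pt ℓ hC hy).1 hz
        rw [hxy]
        exact hH y z hyz
    _ = ∑ c ∈ (ofLabels pt ℓ).parts.image f, H c := (Finset.sum_image hinj).symm
    _ ≤ ∑ c ∈ Finset.range m, H c := by
        refine Finset.sum_le_sum_of_subset_of_nonneg (fun c hc => ?_) fun c hc _ =>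
          h0 c (Finset.mem_range.1 hc)
        obtain ⟨C, hC, rfl⟩ := Finset.mem_image.1 hc
        obtain ⟨x, -, h1⟩ := hf C hC
        rw [h1]
        simpa using h _ (pt.symm x).2

end Labels

variable [MetricSpace X]

theorem cost_nonneg (𝒞 : Clustering X) : 0 ≤ cost 𝒞 :=
  Finset.sum_nonneg fun _ _ => Metric.diam_nonneg

theorem dist_le_diam {C : Finset X} {x y : X} (hx : x ∈ C) (hy : y ∈ C) :
    dist x y ≤ Metric.diam (C : Set X) :=
  Metric.dist_le_diam_of_mem C.finite_toSet.isBounded hx hy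

theorem diam_le_cost {𝒞 : Clustering X} {C : Finset X} (hC : C ∈ 𝒞.parts) :
    Metric.diam (C : Set X) ≤ cost 𝒞 :=
  Finset.single_le_sum (f := fun C : Finset X => Metric.diam (C : Set X))
    (fun _ _ => Metric.diam_nonneg) hC

/-- By pigeonhole, two of the `k + 1` points share a cluster. -/
theorem le_cost_of_separated {𝒞 : Clustering X} {k : ℕ} (hk : 𝒞.parts.card ≤ k) {R : ℝ}
    {c : ℕ → X} (hc : ∀ j ≤ k, ∀ i < j, R ≤ dist (c j) (c i)) : R ≤ cost 𝒞 := by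
  obtain ⟨i, hi, j, hj, hij, heq⟩ := Finset.exists_ne_map_eq_of_card_lt_of_maps_to
    (s := Finset.range (k + 1)) (t := 𝒞.parts) (f := fun i => 𝒞.part (c i)) (by simp; omega)
    (fun i _ => 𝒞.part_mem.2 (Finset.mem_univ _))
  have key : ∀ i j, i < j → j ≤ k → 𝒞.part (c i) = 𝒞.part (c j) → R ≤ cost 𝒞 := by
    intro i j hij hj heq
    refine (hc j hj i hij).trans ((dist_le_diam (C := 𝒞.part (c j)) ?_ ?_).trans
      (diam_le_cost (𝒞.part_mem.2 (Finset.mem_univ _))))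
    · exact 𝒞.mem_part (Finset.mem_univ _)
    · rw [← heq]; exact 𝒞.mem_part (Finset.mem_univ _)
  simp only [Finset.mem_range] at hi hj
  rcases lt_or_gt_of_ne hij with h | h
  · exact key i j h (by omega) heq
  · exact key j i h (by omega) heq.symm

/-- One of the scales that are tried is a good estimate of the cost of a given clustering. -/
theorem exists_scale {𝒞 : Clustering X} {k : ℕ} (hcard : 𝒞.parts.card ≤ k) {R : ℝ}
    (hR0 : 0 ≤ R) {c : ℕ → X} (hR : ∀ x, ∃ i < k, dist x (c i) ≤ R)
    (hc : ∀ j ≤ k, ∀ i < j, R ≤ dist (c j) (c i)) :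
    ∃ i < k, ∃ j < k, ∃ l < k + 2, cost 𝒞 ≤ (R + dist (c i) (c j)) * 2 ^ l ∧
      (R + dist (c i) (c j)) * 2 ^ l ≤ 4 * cost 𝒞 := by
  have hRc := le_cost_of_separated hcard hc
  -- `D` is the largest diameter of a cluster, attained by `x` and `y`.
  obtain ⟨D, hD, x, y, hxy, hDc⟩ : ∃ D : ℝ, cost 𝒞 ≤ k * D ∧ ∃ x y : X, dist x y = D ∧
      D ≤ cost 𝒞 := by
    by_cases hne : 𝒞.parts.Nonempty
    · obtain ⟨C, hC, hmax⟩ := Finset.exists_max_image 𝒞.parts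
        (fun C => Metric.diam (C : Set X)) hne
      have hCn := 𝒞.nonempty_of_mem_parts hC
      obtain ⟨⟨x, y⟩, hxy, hm⟩ := Finset.exists_max_image (C ×ˢ C)
        (fun p => dist p.1 p.2) (hCn.product hCn)
      rw [Finset.mem_product] at hxy
      have hd : Metric.diam (C : Set X) = dist x y := by
        refine le_antisymm (Metric.diam_le_of_forall_dist_le dist_nonneg fun a ha b hb => ?_)
          (dist_le_diam hxy.1 hxy.2)
        exact hm (a, b) (Finset.mem_product.2 ⟨ha, hb⟩)
      refine ⟨dist x y, ?_, x, y, rfl, hd ▸ diam_le_cost hC⟩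
      calc cost 𝒞 ≤ ∑ _C ∈ 𝒞.parts, dist x y :=
            Finset.sum_le_sum fun C' hC' => (hmax C' hC').trans hd.le
        _ = 𝒞.parts.card * dist x y := by simp
        _ ≤ k * dist x y := by gcongr
    · rw [Finset.not_nonempty_iff_eq_empty] at hne
      have h0 : cost 𝒞 = 0 := by simp [cost, hne]
      exact ⟨0, by simp [h0], c 0, c 0, by simp, by simp [h0]⟩
  obtain ⟨i, hi, hxi⟩ := hR x
  obtain ⟨j, hj, hyj⟩ := hR y
  have h1 : dist (c i) (c j) ≤ D + 2 * R := by
    have := dist_triangle4 (c i) x y (c j)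
    rw [dist_comm (c i) x] at this
    linarith
  have h2 : D ≤ dist (c i) (c j) + 2 * R := by
    have := dist_triangle4 x (c i) (c j) y
    rw [dist_comm (c j) y] at this
    linarith
  have hb0 : 0 ≤ R + dist (c i) (c j) := by positivity
  -- The exponent `k + 1` is large enough because `D ≤ 2 * (R + dist (c i) (c j))` and `k ≤ 2 ^ k`;
  -- the least admissible exponent is used.
  have hex : ∃ l, cost 𝒞 ≤ (R + dist (c i) (c j)) * 2 ^ l := by
    refine ⟨k + 1, hD.trans ?_⟩
    have hk2 : (k : ℝ) ≤ 2 ^ k := by exact_mod_cast (Nat.lt_two_pow_self).le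
    calc (k : ℝ) * D ≤ 2 ^ k * (2 * (R + dist (c i) (c j))) := by
          apply mul_le_mul hk2 _ (hxy ▸ dist_nonneg) (by positivity)
          linarith [dist_nonneg (x := c i) (y := c j)]
      _ = (R + dist (c i) (c j)) * 2 ^ (k + 1) := by ring
  have hlt : Nat.find hex < k + 2 := by
    refine Nat.lt_succ_of_le (Nat.find_min' hex ?_)
    have hk2 : (k : ℝ) ≤ 2 ^ k := by exact_mod_cast (Nat.lt_two_pow_self).le
    calc cost 𝒞 ≤ (k : ℝ) * D := hD
      _ ≤ 2 ^ k * (2 * (R + dist (c i) (c j))) := by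
          apply mul_le_mul hk2 _ (hxy ▸ dist_nonneg) (by positivity)
          linarith [dist_nonneg (x := c i) (y := c j)]
      _ = (R + dist (c i) (c j)) * 2 ^ (k + 1) := by ring
  refine ⟨i, hi, j, hj, Nat.find hex, hlt, Nat.find_spec hex, ?_⟩
  -- For exponent `0` the value is at most `R + (D + 2 * R)`, with `R` and `D` at most the cost.
  -- Otherwise half the value is below the cost by minimality.
  rcases Nat.eq_zero_or_pos (Nat.find hex) with h0 | hpos
  · rw [h0]; linarith
  · obtain ⟨l, hl⟩ := Nat.exists_eq_succ_of_ne_zero hpos.ne'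
    have := Nat.find_min hex (m := l) (by omega)
    rw [hl, Nat.succ_eq_add_one, pow_succ]
    push Not at this
    linarith [cost_nonneg 𝒞]

end Clusterings

/-! ### Nets: cost, codes and size -/

/-- Every point with number below `n` is assigned to a point of the net within distance `δ`. -/
structure IsNet (D : ℕ → ℕ → ℝ) (n : ℕ) (δ : ℝ) (net asg : ℕ → ℕ) (M : ℕ) : Prop where
  net_lt : ∀ u < M, net u < n
  asg_lt : ∀ x < n, asg x < M
  close : ∀ x < n, D x (net (asg x)) ≤ δ
  asg_net : ∀ u < M, asg (net u) = u
  sep : ∀ u < M, ∀ w < u, δ < D (net u) (net w)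

section Net

variable {X : Type*} [Fintype X] [DecidableEq X] [MetricSpace X] {n : ℕ}

noncomputable def ptDist (pt : Fin n ≃ X) (i j : ℕ) : ℝ :=
  if h : i < n ∧ j < n then dist (pt ⟨i, h.1⟩) (pt ⟨j, h.2⟩) else 0

variable (pt : Fin n ≃ X)

theorem ptDist_symm (x y : X) : ptDist pt (pt.symm x) (pt.symm y) = dist x y := by
  simp [ptDist]

theorem ptDist_of_lt {i j : ℕ} (hi : i < n) (hj : j < n) :
    ptDist pt i j = dist (pt ⟨i, hi⟩) (pt ⟨j, hj⟩) := by
  simp [ptDist, hi, hj]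

theorem ptDist_nonneg (i j : ℕ) : 0 ≤ ptDist pt i j := by
  unfold ptDist
  split_ifs
  · exact dist_nonneg
  · exact le_rfl

theorem ptDist_self (i : ℕ) : ptDist pt i i = 0 := by
  unfold ptDist
  split_ifs <;> simp

theorem ptDist_comm (i j : ℕ) : ptDist pt i j = ptDist pt j i := by
  unfold ptDist
  split_ifs with h1 h2 h2
  · exact dist_comm _ _
  · exact absurd h1.symm h2
  · exact absurd h2.symm h1
  · rfl

theorem ptDist_triangle {i j l : ℕ} (hi : i < n) (hj : j < n) (hl : l < n) :
    ptDist pt i l ≤ ptDist pt i j + ptDist pt j l := by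
  rw [ptDist_of_lt pt hi hj, ptDist_of_lt pt hi hl, ptDist_of_lt pt hj hl]
  exact dist_triangle _ _ _

variable {pt} {net asg : ℕ → ℕ} {M : ℕ} {δ : ℝ}

/-- The quantity `ub` that a decoder maintains bounds the cost of the clustering. -/
theorem IsNet.cost_le (h : IsNet (ptDist pt) n δ net asg M) (hδ : 0 ≤ δ) {st : Dec}
    (hs : st.Sound (ptDist pt) net M δ) (hc : st.cur = st.cnt) {ℓ : ℕ → ℕ}
    (hℓ : ∀ i < n, ℓ i = st.part (asg i)) :
    cost (ofLabels pt ℓ) ≤ st.ub ∧ (ofLabels pt ℓ).parts.card ≤ st.cnt := by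
  have hlt : ∀ i < n, ℓ i < st.cnt := fun i hi => by
    rw [hℓ i hi]; exact hs.part_lt _ (h.asg_lt i hi)
  refine ⟨?_, card_ofLabels_le pt ℓ hlt⟩
  obtain ⟨H, h1, h2⟩ := hs.ub
  rw [h1, hc]
  rw [hc] at h2
  refine cost_ofLabels_le pt ℓ hlt _ (fun c hcc => by linarith [(h2 c hcc).1]) fun x y hxy => ?_
  have hx := (pt.symm x).2
  have hy := (pt.symm y).2
  have hnx := h.net_lt _ (h.asg_lt _ hx)
  have hny := h.net_lt _ (h.asg_lt _ hy)
  rw [← ptDist_symm pt]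
  have t1 := ptDist_triangle pt hx hnx hy
  have t2 := ptDist_triangle pt hnx hny hy
  rw [ptDist_comm pt (net (asg (pt.symm y))) (pt.symm y)] at t2
  have t3 := h.close _ hx
  have t4 := h.close _ hy
  have t5 := (h2 _ (hlt _ hx)).2 _ (h.asg_lt _ hx) _ (h.asg_lt _ hy) (hℓ _ hx).symm
    ((hℓ _ hy).symm.trans hxy.symm)
  linarith

/-- The net points that represent `C` have mutual distance at most `diam C + 2 * δ`, and the weight
minus one, times `δ`, has to dominate this. The 4 per cluster is 2 from this margin, 1 from rounding
and 1 from the extra unit. -/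
theorem sum_weights_le {𝒞 : Clustering X} {δ : ℝ} (hδ : 0 ≤ δ) :
    (∑ C ∈ 𝒞.parts, (⌈(Metric.diam (C : Set X) + 2 * δ) / δ⌉₊ + 1) : ℕ) ≤
      cost 𝒞 / δ + 4 * 𝒞.parts.card := by
  have key : ∀ C ∈ 𝒞.parts, ((⌈(Metric.diam (C : Set X) + 2 * δ) / δ⌉₊ + 1 : ℕ) : ℝ) ≤
      Metric.diam (C : Set X) / δ + 4 := by
    intro C _
    have h0 : 0 ≤ (Metric.diam (C : Set X) + 2 * δ) / δ :=
      div_nonneg (add_nonneg Metric.diam_nonneg (by linarith)) hδ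
    have h1 := Nat.ceil_lt_add_one h0
    have h2 : (Metric.diam (C : Set X) + 2 * δ) / δ ≤ Metric.diam (C : Set X) / δ + 2 := by
      rcases hδ.eq_or_lt with rfl | hδ
      · simp
      · rw [add_div, mul_div_assoc, div_self hδ.ne', mul_one]
    push_cast
    linarith
  push_cast at key ⊢
  refine (Finset.sum_le_sum key).trans ?_
  rw [Finset.sum_add_distrib, ← Finset.sum_div]
  simp [cost, mul_comm]

/-- Every clustering of cost at most `g` is refined by some string of digits, at little cost. -/
theorem IsNet.exists_digits (h : IsNet (ptDist pt) n δ net asg M) {k e : ℕ} {ε g : ℝ}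
    (hn : 1 ≤ n) (hε : 0 < ε) (he : 1 ≤ e) (hee : 1 ≤ 2 ^ e * ε) (hk : 1 ≤ k)
    (hδ : δ = ε * g / (k * 32)) {𝒞 : Clustering X} (hcard : 𝒞.parts.card ≤ k) (hg : cost 𝒞 ≤ g) :
    ∃ dig : ℕ → ℕ, (∀ i, dig i < 5) ∧ (∀ i, 64 * (k * e) ≤ i → dig i = 0) ∧
      (decode (ptDist pt) net M δ dig (64 * (k * e))).cur =
        (decode (ptDist pt) net M δ dig (64 * (k * e))).cnt ∧
      (decode (ptDist pt) net M δ dig (64 * (k * e))).cnt ≤ k ∧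
      (decode (ptDist pt) net M δ dig (64 * (k * e))).ub ≤ cost 𝒞 + 5 * k * δ ∧
      ∀ ℓ : ℕ → ℕ, (∀ i < n, ℓ i = (decode (ptDist pt) net M δ dig (64 * (k * e))).part (asg i)) →
        𝒞 ≤ ofLabels pt ℓ := by
  have hg0 : 0 ≤ g := (cost_nonneg 𝒞).trans hg
  have hk' : (1 : ℝ) ≤ k := by exact_mod_cast hk
  have hδ0 : 0 ≤ δ := by rw [hδ]; positivity
  let a : Finset X → ℕ := fun C => ⌈(Metric.diam (C : Set X) + 2 * δ) / δ⌉₊ + 1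
  let Cs : Finset X → Finset ℕ := fun C => C.image fun x => asg (pt.symm x)
  have hcov : Cover (ptDist pt) net M δ 𝒞.parts Cs a := by
    refine ⟨fun C hC u hu => ?_, fun C hC => (𝒞.nonempty_of_mem_parts hC).image _, fun u hu => ?_,
      fun C hC u hu w hw => ?_, fun _ _ => Nat.le_add_left _ _, hδ0, ptDist_nonneg pt,
      ptDist_self pt, fun u hu v hv w hw => ptDist_triangle pt (h.net_lt u hu) (h.net_lt v hv)
        (h.net_lt w hw)⟩
    · obtain ⟨x, -, rfl⟩ := Finset.mem_image.1 hu
      exact h.asg_lt _ (pt.symm x).2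
    · refine ⟨𝒞.part (pt ⟨net u, h.net_lt u hu⟩), 𝒞.part_mem.2 (Finset.mem_univ _),
        Finset.mem_image.2 ⟨_, 𝒞.mem_part (Finset.mem_univ _), ?_⟩⟩
      simp [h.asg_net u hu]
    · obtain ⟨x, hxC, rfl⟩ := Finset.mem_image.1 hu
      obtain ⟨y, hyC, rfl⟩ := Finset.mem_image.1 hw
      have hx := (pt.symm x).2
      have hy := (pt.symm y).2
      have hnx := h.net_lt _ (h.asg_lt _ hx)
      have hny := h.net_lt _ (h.asg_lt _ hy)
      have t1 := ptDist_triangle pt hnx hx hny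
      have t2 := ptDist_triangle pt hx hy hny
      rw [ptDist_comm pt (net (asg (pt.symm x))) (pt.symm x)] at t1
      have t3 := h.close _ hx
      have t4 := h.close _ hy
      have t5 := dist_le_diam hxC hyC
      rw [ptDist_symm] at t2
      have t6 : Metric.diam (C : Set X) + 2 * δ ≤
          ⌈(Metric.diam (C : Set X) + 2 * δ) / δ⌉₊ * δ := by
        -- If `δ = 0`, then `g = 0`, so all clusters have diameter `0` and the dummy value of the
        -- quotient does no harm.
        rcases hδ0.eq_or_lt with h0 | hpos
        · have hc0 : Metric.diam (C : Set X) ≤ 0 := by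
            have : g = 0 := by
              by_contra hgne
              have : 0 < δ := by
                rw [hδ]
                have := lt_of_le_of_ne hg0 (Ne.symm hgne)
                positivity
              linarith
            linarith [diam_le_cost hC]
          rw [← h0]; simpa using hc0
        · rw [← div_le_iff₀ hpos]; exact Nat.le_ceil _
      simp only [a]
      push_cast
      linarith
  have hne : 𝒞.parts.Nonempty := ⟨_, 𝒞.part_mem.2 (Finset.mem_univ (pt ⟨0, hn⟩))⟩
  have hm : (𝒞.parts.card : ℝ) ≤ k := by exact_mod_cast hcard
  have hsum := sum_weights_le (𝒞 := 𝒞) hδ0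
  have hcδ : cost 𝒞 / δ ≤ 32 * k * 2 ^ e := by
    rcases hδ0.eq_or_lt with h0 | hpos
    · rw [← h0]; simp
    · rw [div_le_iff₀ hpos, hδ]
      have : 32 * (k : ℝ) * 2 ^ e * (ε * g / (k * 32)) = (2 ^ e * ε) * g := by field_simp
      rw [this]
      nlinarith
  -- The 32 is the one in `δ`, through `cost 𝒞 ≤ g` and `1 ≤ 2 ^ e * ε`; the other 4 come from
  -- `sum_weights_le`.
  have hA : ∑ C ∈ 𝒞.parts, a C ≤ 36 * k * 2 ^ e := by
    have h2 : (1 : ℝ) ≤ 2 ^ e := one_le_pow₀ (by norm_num)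
    have : ((∑ C ∈ 𝒞.parts, a C : ℕ) : ℝ) ≤ (36 * k * 2 ^ e : ℕ) := by
      refine hsum.trans ?_
      push_cast
      nlinarith
    exact_mod_cast this
  -- Already `36 * k + (e + 4) * k ≤ 41 * (k * e)`; the factor 64 is obtained by six doublings.
  have hL : codeLen e (∑ C ∈ 𝒞.parts, a C) 𝒞.parts.card ≤ 64 * (k * e) := by
    have h1 : (∑ C ∈ 𝒞.parts, a C) / 2 ^ e ≤ 36 * k :=
      (Nat.div_le_div_right hA).trans (by rw [Nat.mul_div_cancel _ (by positivity)])
    have h2 : (e + 4) * 𝒞.parts.card ≤ (e + 4) * k := Nat.mul_le_mul_left _ hcard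
    have h3 : k * 1 ≤ k * e := Nat.mul_le_mul_left _ he
    have h4 : (e + 4) * k = k * e + 4 * k := by ring
    unfold codeLen
    omega
  obtain ⟨dig, h1, h2, lbl, h3, h4, h5, h6⟩ := MSD.exists_digits hcov e (64 * (k * e)) hne hL
  refine ⟨dig, h1, h2, h4, h5.trans hcard, h6.trans ?_, fun ℓ hℓ => le_ofLabels pt ℓ ?_⟩
  · push_cast at hsum ⊢
    have hcδ' : cost 𝒞 / δ * δ ≤ cost 𝒞 := by
      rcases hδ0.eq_or_lt with h0 | hpos
      · rw [← h0]; simpa using cost_nonneg 𝒞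
      · rw [div_mul_cancel₀ _ hpos.ne']
    have := mul_le_mul_of_nonneg_right hsum hδ0
    have := mul_le_mul_of_nonneg_right hm hδ0
    simp only [a]
    push_cast
    linarith
  · intro C hC x hx y hy
    rw [hℓ _ (pt.symm x).2, hℓ _ (pt.symm y).2,
      h3.part C hC _ (Finset.mem_image_of_mem _ hx), h3.part C hC _ (Finset.mem_image_of_mem _ hy)]

theorem IsNet.le_card (h : IsNet (ptDist pt) n δ net asg M) : M ≤ n := by
  rw [← Finset.card_range M, ← Finset.card_range n]
  refine Finset.card_le_card_of_injOn net (fun u hu => by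
    simpa using h.net_lt u (by simpa using hu)) fun u hu w hw huw => ?_
  rw [← h.asg_net u (by simpa using hu), huw, h.asg_net w (by simpa using hw)]

/-- The net points are distributed over the balls of radius `R` around the `k` centers, and packing
bounds each share. -/
theorem separated_card_le (hlt : ∀ u < M, net u < n)
    (hsep : ∀ u < M, ∀ w < u, δ < ptDist pt (net u) (net w)) {k j : ℕ} {R : ℝ} (hR : 0 ≤ R)
    {c : ℕ → X} (hc : ∀ x, ∃ i < k, dist x (c i) ≤ R) (hj : 2 * (R / 2 ^ j) ≤ δ) :
    (M : ℝ) ≤ k * ((2 : ℝ) ^ doublingDim X) ^ j := by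
  classical
  choose f hf1 hf2 using hc
  let p : ℕ → X := fun u => if hu : net u < n then pt ⟨net u, hu⟩ else c 0
  have hp : ∀ u < M, ∀ w < M, u ≠ w → δ < dist (p u) (p w) := by
    intro u hu w hw huw
    simp only [p, dif_pos (hlt u hu), dif_pos (hlt w hw)]
    rw [← ptDist_of_lt pt]
    rcases lt_or_gt_of_ne huw with h' | h'
    · rw [ptDist_comm]; exact hsep w hw u h'
    · exact hsep u hu w h'
  have hδ : 0 ≤ δ := le_trans (by positivity) hj
  have hcard : M = ∑ i ∈ Finset.range k, ((Finset.range M).filter fun u => f (p u) = i).card := by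
    rw [← Finset.card_eq_sum_card_fiberwise (fun u _ => by simpa using hf1 (p u)),
      Finset.card_range]
  have hinj : ∀ u < M, ∀ w < M, p u = p w → u = w := fun u hu w hw he => by
    by_contra hne
    have := hp u hu w hw hne
    rw [he, dist_self] at this
    linarith
  have key : ∀ i ∈ Finset.range k, ((((Finset.range M).filter fun u => f (p u) = i).card : ℕ) : ℝ) ≤
      ((2 : ℝ) ^ doublingDim X) ^ j := by
    intro i _
    rw [← Finset.card_image_of_injOn (f := p) (fun u hu w hw he => hinj u
      (by simp at hu; exact hu.1) w (by simp at hw; exact hw.1) he)]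
    refine card_separated_le (c i) hR j hj (δ := δ) ?_ ?_
    · intro y hy
      obtain ⟨u, hu, rfl⟩ := Finset.mem_image.1 hy
      rw [← (Finset.mem_filter.1 hu).2]
      exact hf2 _
    · intro y hy z hz hyz
      obtain ⟨u, hu, rfl⟩ := Finset.mem_image.1 hy
      obtain ⟨w, hw, rfl⟩ := Finset.mem_image.1 hz
      simp only [Finset.mem_filter, Finset.mem_range] at hu hw
      exact hp u hu.1 w hw.1 fun h => hyz (by rw [h])
  calc (M : ℝ) = ∑ i ∈ Finset.range k,
        ((((Finset.range M).filter fun u => f (p u) = i).card : ℕ) : ℝ) := by exact_mod_cast hcard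
    _ ≤ ∑ _i ∈ Finset.range k, ((2 : ℝ) ^ doublingDim X) ^ j := Finset.sum_le_sum key
    _ = _ := by simp

end Net

attribute [simp] runAll okAll timeAll Instr.run Instr.ok Instr.time HTest.holds HState.setN

section Programs

variable {E : Env} {S : ℕ}

/-! ### Farthest-first centers -/

def nearestCmd : Cmd :=
  .ops [.constN .i 0, .load .c .cen .i, .dist .mn .x .c] ;;
  forUp .i .j1 (
    .ops [.load .c .cen .i, .dist .y .x .c] ;;
    .ite (.ltR .y .mn) (.ops [.copyR .mn .y]) .skip)

def farthestCmd : Cmd :=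
  .ops [.copyN .j1 .j, .inc .j1, .constR .rad 0, .constN .far 0] ;;
  forUp .x .n (
    nearestCmd ;;
    .ite (.ltR .rad .mn) (.ops [.copyR .rad .mn, .copyN .far .x]) .skip)

def centersCmd : Cmd :=
  .ops [.constN .i 0, .constN .c 0, .store .cen .i .c] ;;
  forUp .j .k (farthestCmd ;; .ops [.store .cen .j1 .far])

theorem nearestCmd_spec {s : HState} {j : ℕ} (hj : s.v .j1 = j + 1) (hjS : j < S) :
    Does E S nearestCmd s ((j + 1) * 10 + 9) fun s' =>
      (∀ i ≤ j, s'.r .mn ≤ E.dist (s.v .x) (s.a .cen i)) ∧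
      ∃ i ≤ j, s'.r .mn = E.dist (s.v .x) (s.a .cen i) := by
  refine Does.opsSeq 6 ((j + 1) * 10 + 3) ?_ ?_ ?_
  · simp; omega
  · simp
  refine Does.forUp 7 (fun i s' => (∀ i' < i, s'.r .mn ≤ E.dist (s.v .x) (s.a .cen i')) ∧
      ∃ i' ≤ j, s'.r .mn = E.dist (s.v .x) (s.a .cen i')) ⟨rfl, rfl⟩ ?_ ?_ ?_ ?_
  · simp
    exact ⟨0, Nat.zero_le _, rfl⟩
  · rintro i s' hi hi' hf ⟨h1, i₀, h2, h3⟩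
    have ex : s'.v .x = s.v .x := (hf.v .x rfl).trans (by simp)
    have ec : s'.a .cen = s.a .cen := (hf.a .cen rfl).trans (by simp)
    simp [hj] at hi
    refine Does.opsSeq 4 3 ?_ ?_ ?_
    · simp; omega
    · simp
    refine Does.ite 2 (fun hc => ?_) (fun hc => ?_)
    · refine Does.ops (by simp) (by simp) ?_
      simp [hi', ex, ec, h3] at hc ⊢
      refine ⟨fun i' hi'' => ?_, i, by omega, rfl⟩
      rcases hi''.lt_or_eq with h | rfl
      · exact hc.le.trans (h3 ▸ h1 i' h)
      · exact le_rfl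
    · refine Does.skip ?_
      simp [hi', ex, ec] at hc ⊢
      refine ⟨fun i' hi'' => ?_, i₀, h2, h3⟩
      rcases hi''.lt_or_eq with h | rfl
      · exact h1 i' h
      · exact hc
  · rintro s' hf ⟨h1, h2⟩
    simp [hj] at h1
    exact ⟨fun i hi => h1 i (by omega), h2⟩
  · simp [hj]

theorem farthestCmd_spec {s : HState} {n j : ℕ} (hn : s.v .n = n) (hn1 : 1 ≤ n) (hj : s.v .j = j)
    (hjS : j < S) (hE : ∀ x y, 0 ≤ E.dist x y) :
    Does E S farthestCmd s (n * (10 * j + 40) + 20) fun s' => s'.v .j1 = j + 1 ∧ s'.v .far < n ∧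
      0 ≤ s'.r .rad ∧ (∀ i ≤ j, s'.r .rad ≤ E.dist (s'.v .far) (s.a .cen i)) ∧
      ∀ x < n, ∃ i ≤ j, E.dist x (s.a .cen i) ≤ s'.r .rad := by
  refine Does.opsSeq 10 (n * (10 * j + 40) + 3) ?_ ?_ ?_
  · simp
  · simp
  refine Does.forUp ((j + 1) * 10 + 9 + 5) (fun x s' => s'.v .far < n ∧
      0 ≤ s'.r .rad ∧ (∀ i ≤ j, s'.r .rad ≤ E.dist (s'.v .far) (s.a .cen i)) ∧
      ∀ x' < x, ∃ i ≤ j, E.dist x' (s.a .cen i) ≤ s'.r .rad) ⟨rfl, rfl⟩ ?_ ?_ ?_ ?_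
  · simp [hE]; omega
  · rintro x s' hx hx' hf ⟨h1, h2, h3, h4⟩
    have ec : s'.a .cen = s.a .cen := (hf.a .cen rfl).trans (by simp)
    have ej : s'.v .j1 = j + 1 := (hf.v .j1 rfl).trans (by simp [hj])
    simp [hn] at hx
    refine Does.seq ((j + 1) * 10 + 9) 5 (nearestCmd_spec ej hjS) ?_
    rintro s'' hf' ⟨h5, i₀, h6, h7⟩
    have ex : s''.v .x = x := (hf'.v .x rfl).trans hx'
    have ef : s''.v .far = s'.v .far := hf'.v .far rfl
    have er : s''.r .rad = s'.r .rad := hf'.r .rad rfl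
    rw [hx', ec] at h5 h7
    refine Does.ite 4 (fun hc => ?_) (fun hc => ?_)
    · refine Does.ops (by simp) (by simp) ?_
      simp [ex, er] at hc ⊢
      refine ⟨hx, by linarith, h5, fun x' hx'' => ?_⟩
      rcases hx''.lt_or_eq with h | rfl
      · obtain ⟨i, hi, h⟩ := h4 x' h
        exact ⟨i, hi, by linarith⟩
      · exact ⟨i₀, h6, h7.ge⟩
    · refine Does.skip ?_
      simp [er, ef] at hc ⊢
      refine ⟨h1, h2, h3, fun x' hx'' => ?_⟩
      rcases hx''.lt_or_eq with h | rfl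
      · exact h4 x' h
      · exact ⟨i₀, h6, h7.ge.trans hc⟩
  · rintro s' hf ⟨h1, h2, h3, h4⟩
    simp [hn] at h4
    exact ⟨(hf.v .j1 rfl).trans (by simp [hj]), h1, h2, h3, h4⟩
  · simp [hn]
    ring_nf
    omega

/-- The radius `R` and the centers `c` found by farthest-first traversal. -/
structure Centers (D : ℕ → ℕ → ℝ) (n k : ℕ) (c : ℕ → ℕ) (R : ℝ) : Prop where
  lt : ∀ i ≤ k, c i < n
  nonneg : 0 ≤ R
  cover : ∀ x < n, ∃ i < k, D x (c i) ≤ R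
  sep : ∀ j ≤ k, ∀ i < j, R ≤ D (c j) (c i)

/-- There are `k + 1` centers: the last one is not needed for covering and only witnesses that `R`
is a lower bound. Separation of the earlier centers persists because the covering radius never
grows. -/
theorem centersCmd_spec {s : HState} {n k : ℕ} (hn : s.v .n = n) (hn1 : 1 ≤ n) (hk : s.v .k = k)
    (hk1 : 1 ≤ k) (hkS : k < S) (hE : ∀ x y, 0 ≤ E.dist x y) :
    Does E S centersCmd s (k * (n * (10 * k + 40) + 30) + 20) fun s' =>
      Centers E.dist n k (s'.a .cen) (s'.r .rad) := by
  refine Does.opsSeq 6 (k * (n * (10 * k + 40) + 30) + 3) ?_ ?_ ?_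
  · simp; omega
  · simp
  refine Does.forUp (n * (10 * k + 40) + 20 + 2) (fun j s' => (∀ i ≤ j, s'.a .cen i < n) ∧
    (1 ≤ j → Centers E.dist n j (s'.a .cen) (s'.r .rad))) ⟨rfl, rfl⟩ ?_ ?_ ?_ ?_
  · simp; omega
  · rintro j s' hj hj' hf ⟨h1, h2⟩
    have en : s'.v .n = n := (hf.v .n rfl).trans (by simp [hn])
    simp [hk] at hj
    refine Does.seq (n * (10 * k + 40) + 20) 2
      ((farthestCmd_spec en hn1 hj' (hj.trans hkS) hE).mono ?_ fun _ _ h => h) ?_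
    · gcongr
    rintro s'' hf' ⟨h3, h4, h5, h6, h7⟩
    have ec : s''.a .cen = s'.a .cen := hf'.a .cen rfl
    refine Does.ops ?_ (by simp) ?_
    · simp [h3]; omega
    have e1 : ∀ i ≤ j, Function.update (s'.a .cen) (j + 1) (s''.v .far) i = s'.a .cen i :=
      fun i hi => Function.update_of_ne (by omega) _ _
    have e2 : ∀ i ≤ j + 1, Function.update (s'.a .cen) (j + 1) (s''.v .far) i < n := by
      intro i hi
      rcases Nat.le_succ_iff.1 hi with h | rfl
      · rw [e1 i h]; exact h1 i h
      · simpa using h4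
    simp [h3, ec]
    refine ⟨e2, e2, h5, fun x hx => ?_, fun i hi i' hi' => ?_⟩
    · obtain ⟨i, hi, h⟩ := h7 x hx
      exact ⟨i, by omega, by rwa [e1 i hi]⟩
    · rw [e1 i' (by omega)]
      rcases Nat.le_succ_iff.1 hi with h | rfl
      · rw [e1 i h]
        have hc := h2 (by omega)
        obtain ⟨i₀, hi₀, h8⟩ := hc.cover _ h4
        exact ((h6 i₀ hi₀.le).trans h8).trans (hc.sep i h i' hi')
      · simpa using h6 i' (by omega)
  · rintro s' hf ⟨h1, h2⟩
    simp [hk] at h2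
    exact h2 hk1
  · simp [hk]
    ring_nf
    omega

/-! ### A greedy net -/

def netCmd : Cmd :=
  .ops [.constN .m 0] ;;
  forUp .x .n (
    .ops [.constN .fnd 0] ;;
    forUp .u .m (
      .ops [.load .c .net .u, .dist .y .x .c] ;;
      .ite (.leR .y .del) (.ops [.copyN .av .u, .constN .fnd 1]) .skip) ;;
    .ops [.constN .tc 0] ;;
    .ite (.eqN .fnd .tc) (.ops [.store .net .m .x, .copyN .av .m, .inc .m]) .skip ;;
    .ops [.store .asg .x .av])

/-- A point that is not within `δ` of the current net joins it and is assigned to itself. The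
packing bound `B` holds for every partial net, which gives the running time. -/
theorem netCmd_spec {s : HState} {n B : ℕ} {δ : ℝ} (hn : s.v .n = n) (hδ : s.r .del = δ)
    (hδ0 : 0 ≤ δ) (hnS : n ≤ S) (hE : ∀ x, E.dist x x = 0)
    (hB : ∀ (M : ℕ) (net : ℕ → ℕ), (∀ u < M, net u < n) →
      (∀ u < M, ∀ w < u, δ < E.dist (net u) (net w)) → M ≤ B) :
    Does E S netCmd s (n * (12 * B + 30) + 5) fun s' =>
      IsNet E.dist n δ (s'.a .net) (s'.a .asg) (s'.v .m) ∧ s'.v .m ≤ B := by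
  refine Does.opsSeq 2 (n * (12 * B + 30) + 3) ?_ ?_ ?_
  · simp
  · simp
  refine Does.forUp (12 * B + 22) (fun x s' => s'.v .m ≤ x ∧ (∀ u < s'.v .m, s'.a .net u < x) ∧
    (∀ x' < x, s'.a .asg x' < s'.v .m ∧ E.dist x' (s'.a .net (s'.a .asg x')) ≤ δ) ∧
    (∀ u < s'.v .m, s'.a .asg (s'.a .net u) = u) ∧
    (∀ u < s'.v .m, ∀ w < u, δ < E.dist (s'.a .net u) (s'.a .net w))) ⟨rfl, rfl⟩ ?_ ?_ ?_ ?_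
  · simp
  · rintro x s' hx hx' hf ⟨h1, h2, h3, h4, h5⟩
    simp [hn] at hx
    have hd : s'.r .del = δ := (hf.r .del rfl).trans (by simp [hδ])
    have hmB := hB _ _ (fun u hu => (h2 u hu).trans hx) h5
    refine Does.opsSeq 2 (12 * B + 20) ?_ ?_ ?_
    · simp
    · simp
    refine Does.seq (R := fun s'' => (s''.v .fnd = 1 ∧ s''.v .av < s'.v .m ∧
        E.dist x (s'.a .net (s''.v .av)) ≤ δ) ∨ (s''.v .fnd = 0 ∧
          ∀ u < s'.v .m, δ < E.dist x (s'.a .net u))) (12 * B + 3) 14 ?_ ?_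
    · refine Does.forUp 9 (fun u s'' => (s''.v .fnd = 1 ∧ s''.v .av < s'.v .m ∧
        E.dist x (s'.a .net (s''.v .av)) ≤ δ) ∨ (s''.v .fnd = 0 ∧
          ∀ u' < u, δ < E.dist x (s'.a .net u'))) ⟨rfl, rfl⟩ ?_ ?_ ?_ ?_
      · simp
      · rintro u s'' hu hu' hf' h6
        have ex : s''.v .x = x := (hf'.v .x rfl).trans (by simp [hx'])
        have en : s''.a .net = s'.a .net := (hf'.a .net rfl).trans (by simp)
        have ed : s''.r .del = δ := (hf'.r .del rfl).trans (by simp [hd])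
        simp at hu
        refine Does.opsSeq 4 5 ?_ ?_ ?_
        · simp; omega
        · simp
        refine Does.ite 4 (fun hc => ?_) (fun hc => ?_)
        · refine Does.ops (by simp) (by simp) ?_
          simp [ex, en, ed, hu'] at hc ⊢
          exact ⟨hu, hc⟩
        · refine Does.skip ?_
          simp [ex, en, ed, hu'] at hc ⊢
          refine h6.imp id fun h => ⟨h.1, fun u' hu'' => ?_⟩
          rcases hu''.lt_or_eq with h' | rfl
          · exact h.2 u' h'
          · exact hc
      · rintro s'' hf' h6
        simpa using h6
      · simp; omega
    · rintro s'' hf' h6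
      have ex : s''.v .x = x := (hf'.v .x rfl).trans (by simp [hx'])
      have en : s''.a .net = s'.a .net := (hf'.a .net rfl).trans (by simp)
      have ea : s''.a .asg = s'.a .asg := (hf'.a .asg rfl).trans (by simp)
      have em : s''.v .m = s'.v .m := (hf'.v .m rfl).trans (by simp)
      refine Does.opsSeq 2 12 ?_ ?_ ?_
      · simp
      · simp
      have upd : ∀ (v x' : ℕ), x' < x → Function.update (s'.a .asg) x v x' = s'.a .asg x' :=
        fun v x' h => Function.update_of_ne h.ne _ _
      rcases h6 with ⟨h6, h7, h8⟩ | ⟨h6, h7⟩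
      · refine Does.seq (R := fun t => t = runAll E [.constN .tc 0] s'') 7 2 ?_ ?_
        · refine Does.ite 6 (fun hc => ?_) (fun hc => Does.skip rfl)
          simp [h6] at hc
        rintro t - rfl
        refine Does.ops ?_ (by simp) ?_
        · simp; omega
        simp [ex, en, ea, em]
        refine ⟨by omega, fun u hu => (h2 u hu).le, fun x' hx'' => ?_, fun u hu => ?_, h5⟩
        · rcases hx''.lt_or_eq with h' | rfl
          · rw [upd _ _ h']; exact h3 x' h'
          · simpa using ⟨h7, h8⟩
        · rw [upd _ _ (h2 u hu)]; exact h4 u hu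
      · refine Does.seq (R := fun t => t = runAll E [.store .net .m .x, .copyN .av .m, .inc .m]
          (runAll E [.constN .tc 0] s'')) 7 2 ?_ ?_
        · refine Does.ite 6 (fun hc => Does.ops ?_ (by simp) rfl) (fun hc => ?_)
          · simp; omega
          · simp [h6] at hc
        rintro t - rfl
        have updn : ∀ (u : ℕ), u < s'.v .m →
            Function.update (s'.a .net) (s'.v .m) x u = s'.a .net u :=
          fun u h => Function.update_of_ne h.ne _ _
        refine Does.ops ?_ (by simp) ?_
        · simp; omega
        simp [ex, en, ea, em]
        refine ⟨h1, fun u hu => ?_, fun x' hx'' => ?_, fun u hu => ?_, fun u hu w hw => ?_⟩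
        · rcases hu.lt_or_eq with h' | rfl
          · rw [updn u h']; exact (h2 u h').le
          · simp
        · rcases hx''.lt_or_eq with h' | rfl
          · rw [upd _ _ h', updn _ (h3 x' h').1]
            exact ⟨(h3 x' h').1.le, (h3 x' h').2⟩
          · simp [hE, hδ0]
        · rcases hu.lt_or_eq with h' | rfl
          · rw [updn u h', upd _ _ (h2 u h')]; exact h4 u h'
          · simp
        · rw [updn w (by omega)]
          rcases hu.lt_or_eq with h' | rfl
          · rw [updn u h']; exact h5 u h' w hw
          · simpa using h7 w hw
  · rintro s' hf ⟨h1, h2, h3, h4, h5⟩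
    simp [hn] at h1 h2 h3
    exact ⟨⟨h2, fun x hx => (h3 x hx).1, fun x hx => (h3 x hx).2, h4, h5⟩, hB _ _ h2 h5⟩
  · simp [hn]
    ring_nf
    omega

end Programs

section Programs

variable {E : Env} {S : ℕ}

/-! ### The decoder -/

def scanCmd : Cmd :=
  .ops [.constN .p 0, .constR .hh 0] ;;
  forUp .u .m (
    .ops [.load .pu .part .u] ;;
    .ite (.eqN .pu .cur) (
      forUp .w .m (
        .ops [.load .pw .part .w] ;;
        .ite (.eqN .pw .cur) (
          .ops [.load .c .net .u, .load .c2 .net .w, .dist .y .c .c2] ;;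
          .ite (.ltR .hh .y) (.ops [.copyR .hh .y, .copyN .p .c]) .skip) .skip)) .skip)

def cutCmd : Cmd :=
  forUp .u .m (
    .ops [.load .pu .part .u] ;;
    .ite (.eqN .pu .cur) (
      .ops [.load .c .net .u, .dist .y .p .c] ;;
      .ite (.ltR .rr .y) (.ops [.store .part .u .cnt]) .skip) .skip) ;;
  .ops [.inc .cnt, .constR .rr 0]

/-- The scan is repeated for every digit, so that only the decoder state has to survive between
digits. -/
def stepCmd : Cmd :=
  scanCmd ;;
  .ops [.load .d .dig .it, .constN .tc 0] ;;
  .ite (.eqN .d .tc)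
    (.ops [.inc .cur, .addR .ub .ub .hh, .addR .ub .ub .del, .addR .ub .ub .del, .constR .rr 0])
    (.ops [.constN .tc 1] ;;
      .ite (.eqN .d .tc) (.ops [.addR .rr .rr .rr])
        (.ops [.constN .tc 2] ;;
          .ite (.eqN .d .tc) (.ops [.addR .rr .rr .rr, .addR .rr .rr .del])
            (.ops [.constN .tc 3] ;;
              .ite (.eqN .d .tc) .skip (.ops [.subR .rr .hh .rr]) ;;
              cutCmd)))

def decodeCmd : Cmd :=
  .ops [.constN .cur 0, .constN .cnt 1, .constR .rr 0, .constR .ub 0, .constN .tc 0] ;;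
  forUp .u .m (.ops [.store .part .u .tc]) ;;
  forUp .it .len (.ite (.ltN .cur .cnt) stepCmd .skip)

/-- The memory holds the decoder state `st`. -/
structure DecRep (M : ℕ) (s : HState) (st : Dec) : Prop where
  part : ∀ u < M, s.a .part u = st.part u
  cnt : s.v .cnt = st.cnt
  cur : s.v .cur = st.cur
  rr : s.r .rr = st.rr
  ub : s.r .ub = st.ub

theorem DecRep.setN {M : ℕ} {s : HState} {st : Dec} (h : DecRep M s st) {x : NReg} (v : ℕ)
    (h1 : x ≠ .cnt) (h2 : x ≠ .cur) : DecRep M (s.setN x v) st :=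
  ⟨h.part, by simp [h1.symm, h.cnt], by simp [h2.symm, h.cur], h.rr, h.ub⟩

theorem scanCmd_spec {s : HState} {M : ℕ} {st : Dec} (hm : s.v .m = M) (hMS : M ≤ S)
    (hst : DecRep M s st) :
    Does E S scanCmd s (M * (20 * M + 20) + 10) fun s' =>
      s'.v .p = (scan E.dist (s.a .net) M st.part st.cur M).1 ∧
      s'.r .hh = (scan E.dist (s.a .net) M st.part st.cur M).2 := by
  refine Does.opsSeq 4 (M * (20 * M + 20) + 3) (by simp) (by simp) ?_
  refine Does.forUp (20 * M + 10) (fun u s' =>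
    s'.v .p = (scan E.dist (s.a .net) M st.part st.cur u).1 ∧
    s'.r .hh = (scan E.dist (s.a .net) M st.part st.cur u).2) ⟨rfl, rfl⟩ ?_ ?_ ?_ ?_
  · simp [scan]
  · rintro u s' hu hu' hf ⟨h1, h2⟩
    simp [hm] at hu
    have hcur : s'.v .cur = st.cur := (hf.v .cur rfl).trans (by simp [hst.cur])
    have hpart : ∀ u < M, s'.a .part u = st.part u := fun u hu => by
      rw [hf.a .part rfl]; simp [hst.part u hu]
    have hnet : s'.a .net = s.a .net := (hf.a .net rfl).trans (by simp)
    have hm' : s'.v .m = M := (hf.v .m rfl).trans (by simp [hm])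
    refine Does.opsSeq 2 (20 * M + 5) (by simp; omega) (by simp) ?_
    refine Does.ite (20 * M + 4) (fun hc => ?_) (fun hc => ?_)
    · simp [hu', hpart u hu, hcur] at hc
      refine Does.forUp 15 (fun w s'' =>
        s''.v .p = (scanRow E.dist (s.a .net) st.part st.cur u w
          (scan E.dist (s.a .net) M st.part st.cur u)).1 ∧
        s''.r .hh = (scanRow E.dist (s.a .net) st.part st.cur u w
          (scan E.dist (s.a .net) M st.part st.cur u)).2) ⟨rfl, rfl⟩ ?_ ?_ ?_ ?_
      · simp [scanRow, h1, h2]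
      · rintro w s'' hw hw' hf' ⟨h3, h4⟩
        simp [hm'] at hw
        have hcur' : s''.v .cur = st.cur := (hf'.v .cur rfl).trans (by simp [hcur])
        have hu'' : s''.v .u = u := (hf'.v .u rfl).trans (by simp [hu'])
        have hpart' : ∀ u < M, s''.a .part u = st.part u := fun u hu => by
          rw [hf'.a .part rfl]; simp [hpart u hu]
        have hnet' : s''.a .net = s.a .net := (hf'.a .net rfl).trans (by simp [hnet])
        refine Does.opsSeq 2 13 (by simp; omega) (by simp) ?_
        refine Does.ite 12 (fun hc' => ?_) (fun hc' => Does.skip ?_)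
        · simp [hw', hpart' w hw, hcur'] at hc'
          refine Does.opsSeq 6 5 (by simp; omega) (by simp) ?_
          refine Does.ite 4 (fun hc'' => Does.ops (by simp) (by simp) ?_)
            (fun hc'' => Does.skip ?_)
          · simp [hw', hu'', hnet', h4] at hc''
            simp [hw', hu'', hnet', scanRow, hc', hc'']
          · simp [hw', hu'', hnet', h4, -not_lt] at hc''
            simp [hw', hu'', hnet', scanRow, hc', hc'', h3, h4]
        · simp [hw', hpart' w hw, hcur'] at hc'
          simp [scanRow, hc', h3, h4]
      · rintro s'' hf' h3
        simp [hm'] at h3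
        simpa [scan, hc] using h3
      · simp [hm']; omega
    · refine Does.skip ?_
      simp [hu', hpart u hu, hcur] at hc
      simp [scan, hc, h1, h2]
  · rintro s' hf h
    simpa [hm] using h
  · simp [hm]
    ring_nf
    omega

/-- The register `rr` holds the actual radius `r`, which for digit 4 is no longer the `rr` of the
decoder state. -/
theorem cutCmd_spec {s : HState} {M p : ℕ} {r : ℝ} {st : Dec} (hm : s.v .m = M) (hMS : M ≤ S)
    (hst : DecRep M s { st with rr := r }) (hp : s.v .p = p) :
    Does E S cutCmd s (M * 20 + 10) fun s' =>
      DecRep M s' (st.cut E.dist (s.a .net) p r) := by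
  refine Does.seq (M * 20 + 3) 4 (R := fun s' => ∀ u < M, s'.a .part u =
    (st.cut E.dist (s.a .net) p r).part u) ?_ ?_
  · refine Does.forUp 15 (fun u s' => ∀ u' < M, s'.a .part u' =
      if u' < u then (st.cut E.dist (s.a .net) p r).part u' else st.part u') ⟨rfl, rfl⟩ ?_ ?_ ?_ ?_
    · simpa using hst.part
    · rintro u s' hu hu' hf h1
      rw [hm] at hu
      have hcur : s'.v .cur = st.cur := (hf.v .cur rfl).trans hst.cur
      have hcnt : s'.v .cnt = st.cnt := (hf.v .cnt rfl).trans hst.cnt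
      have hp' : s'.v .p = p := (hf.v .p rfl).trans hp
      have hrr : s'.r .rr = r := (hf.r .rr rfl).trans hst.rr
      have hnet : s'.a .net = s.a .net := hf.a .net rfl
      have h1u := h1 u hu
      rw [if_neg (lt_irrefl u)] at h1u
      have fin : (st.cut E.dist (s.a .net) p r).part u = st.part u →
          ∀ u' < M, s'.a .part u' =
            if u' < u + 1 then (st.cut E.dist (s.a .net) p r).part u' else st.part u' := by
        intro h u' hu'
        rw [h1 u' hu']
        by_cases h2 : u' = u
        · subst h2; simp [h]
        · have : u' < u + 1 ↔ u' < u := by omega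
          simp only [this]
      refine Does.opsSeq 2 13 (by simp; omega) (by simp) ?_
      refine Does.ite 12 (fun hc => ?_) (fun hc => Does.skip ?_)
      · simp [hu', h1u, hcur] at hc
        refine Does.opsSeq 4 5 (by simp; omega) (by simp) ?_
        refine Does.ite 4 (fun hc' => Does.ops (by simp; omega) (by simp) ?_)
          (fun hc' => Does.skip ?_)
        · simp only [HTest.holds] at hc'
          simp [hu', hp', hrr, hnet] at hc'
          intro u' hu''
          simp only [runAll, Instr.run, HState.setN]
          simp [hu', hcnt]
          by_cases h2 : u' = u
          · subst h2; simp [Dec.cut, hc, hc']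
          · have : u' ≤ u ↔ u' < u := by omega
            simp only [this, Function.update_of_ne h2, h1 u' hu'']
        · simp [hu', hp', hrr, hnet, -not_lt] at hc'
          exact fin (by simp [Dec.cut, hc'])
      · simp [hu', h1u, hcur] at hc
        exact fin (by simp [Dec.cut, hc])
    · intro s' hf h1 u hu
      rw [h1 u hu, hm, if_pos hu]
    · rw [hm]; omega
  · intro s' hf h1
    refine Does.ops (by simp) (by simp) ⟨?_, ?_, ?_, ?_, ?_⟩
    · simpa using h1
    · simp [Dec.cut]; exact (hf.v .cnt rfl).trans hst.cnt
    · simp [Dec.cut]; exact (hf.v .cur rfl).trans hst.cur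
    · simp [Dec.cut]
    · simp [Dec.cut]; exact (hf.r .ub rfl).trans hst.ub

theorem stepCmd_spec {s : HState} {M : ℕ} {δ : ℝ} {st : Dec} (hm : s.v .m = M) (hMS : M ≤ S)
    (hδ : s.r .del = δ) (hst : DecRep M s st) (hlt : st.cur < st.cnt) :
    Does E S stepCmd s (M * (20 * M + 40) + 50) fun s' =>
      DecRep M s' (st.step E.dist (s.a .net) M δ (s.a .dig (s.v .it))) := by
  refine Does.seq (M * (20 * M + 20) + 10) (M * 20 + 40) (scanCmd_spec hm hMS hst) ?_
    (by ring_nf; omega)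
  rintro s' hf ⟨h1, h2⟩
  have e1 : s'.v .m = M := (hf.v .m rfl).trans hm
  have e2 : s'.r .del = δ := (hf.r .del rfl).trans hδ
  have e3 : s'.a .dig = s.a .dig := hf.a .dig rfl
  have e4 : s'.v .it = s.v .it := hf.v .it rfl
  have e5 : s'.a .net = s.a .net := hf.a .net rfl
  have e6 : ∀ u < M, s'.a .part u = st.part u := fun u hu => by
    rw [hf.a .part rfl]; exact hst.part u hu
  have e7 : s'.v .cnt = st.cnt := (hf.v .cnt rfl).trans hst.cnt
  have e8 : s'.v .cur = st.cur := (hf.v .cur rfl).trans hst.cur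
  have e9 : s'.r .rr = st.rr := (hf.r .rr rfl).trans hst.rr
  have e10 : s'.r .ub = st.ub := (hf.r .ub rfl).trans hst.ub
  unfold Dec.step
  rw [if_pos hlt]
  obtain ⟨d, hd⟩ : ∃ d, d = s.a .dig (s.v .it) := ⟨_, rfl⟩
  have hd' : s'.a .dig (s'.v .it) = d := by rw [e3, e4, hd]
  rw [← hd]
  refine Does.opsSeq 4 (M * 20 + 36) (by simp) (by simp) ?_
  refine Does.ite (M * 20 + 35) (fun hc => Does.ops (by simp) (by simp) ?_) (fun hc => ?_)
  · simp [hd'] at hc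
    rw [if_pos hc]
    exact ⟨by simpa using e6, by simp [e7], by simp [e8], by simp, by simp [e10, e2, h2]⟩
  simp [hd'] at hc
  rw [if_neg hc]
  refine Does.opsSeq 2 (M * 20 + 33) (by simp) (by simp) ?_
  refine Does.ite (M * 20 + 32) (fun hc => Does.ops (by simp) (by simp) ?_) (fun hc => ?_)
  · simp [hd'] at hc
    rw [if_pos hc]
    exact ⟨by simpa using e6, by simp [e7], by simp [e8], by simp [e9], by simp [e10]⟩
  simp [hd'] at hc
  rw [if_neg hc]
  refine Does.opsSeq 2 (M * 20 + 30) (by simp) (by simp) ?_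
  refine Does.ite (M * 20 + 29) (fun hc => Does.ops (by simp) (by simp) ?_) (fun hc => ?_)
  · simp [hd'] at hc
    rw [if_pos hc]
    exact ⟨by simpa using e6, by simp [e7], by simp [e8], by simp [e9, e2], by simp [e10]⟩
  simp [hd'] at hc
  rw [if_neg hc]
  refine Does.opsSeq 2 (M * 20 + 27) (by simp) (by simp) ?_
  refine Does.seq 5 (M * 20 + 10) (R := fun t => t.v .m = M ∧ t.v .p = s'.v .p ∧
    t.a .net = s.a .net ∧
      DecRep M t { st with rr := if d = 3 then st.rr else s'.r .hh - st.rr }) ?_ ?_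
  · refine Does.ite 4 (fun hc => Does.skip ?_) (fun hc => Does.ops (by simp) (by simp) ?_)
    · simp [hd'] at hc
      exact ⟨by simp [e1], by simp, by simp [e5], by simpa using e6, by simp [e7], by simp [e8],
        by simp [e9, hc], by simp [e10]⟩
    · simp [hd'] at hc
      exact ⟨by simp [e1], by simp, by simp [e5], by simpa using e6, by simp [e7], by simp [e8],
        by simp [e9, hc], by simp [e10]⟩
  · rintro t - ⟨t1, t2, t3, t4⟩
    refine (cutCmd_spec t1 hMS t4 rfl).mono le_rfl fun t' _ h => ?_
    rw [t3, t2, h1, h2] at h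
    by_cases h3 : d = 3
    · simpa [h3] using h
    · simpa [h3] using h

theorem decodeCmd_spec {s : HState} {M L : ℕ} {δ : ℝ} (hm : s.v .m = M) (hMS : M ≤ S)
    (hδ : s.r .del = δ) (hL : s.v .len = L) :
    Does E S decodeCmd s (L * (M * (20 * M + 40) + 60) + M * 5 + 20) fun s' =>
      DecRep M s' (decode E.dist (s.a .net) M δ (s.a .dig) L) := by
  refine Does.opsSeq 10 (L * (M * (20 * M + 40) + 60) + M * 5 + 10) (by simp) (by simp) ?_
  refine Does.seq (M * 5 + 3) (L * (M * (20 * M + 40) + 60) + 7) (R := fun s' =>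
    DecRep M s' Dec.init) ?_ ?_
  · refine Does.forUp 2 (fun u s' => ∀ u' < u, s'.a .part u' = 0) ⟨rfl, rfl⟩ ?_ ?_ ?_ ?_
    · simp
    · rintro u s' hu hu' hf h1
      simp [hm] at hu
      refine Does.ops (by simp; omega) (by simp) ?_
      have : s'.v .tc = 0 := (hf.v .tc rfl).trans (by simp)
      simp [hu', this]
      intro u' hu''
      rcases hu''.lt_or_eq with h | rfl
      · rw [Function.update_of_ne h.ne]; exact h1 u' h
      · simp
    · intro s' hf h1
      simp [hm] at h1
      exact ⟨h1, (hf.v .cnt rfl).trans (by simp [Dec.init]),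
        (hf.v .cur rfl).trans (by simp [Dec.init]), (hf.r .rr rfl).trans (by simp [Dec.init]),
        (hf.r .ub rfl).trans (by simp [Dec.init])⟩
    · simp [hm]
  · intro s' hf h1
    have hL' : s'.v .len = L := (hf.v .len rfl).trans (by simp [hL])
    have hm' : s'.v .m = M := (hf.v .m rfl).trans (by simp [hm])
    have hδ' : s'.r .del = δ := (hf.r .del rfl).trans (by simp [hδ])
    have hnet' : s'.a .net = s.a .net := (hf.a .net rfl).trans (by simp)
    have hdig' : s'.a .dig = s.a .dig := (hf.a .dig rfl).trans (by simp)
    refine Does.forUp (M * (20 * M + 40) + 51) (fun i t =>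
      DecRep M t (decode E.dist (s.a .net) M δ (s.a .dig) i)) ⟨rfl, rfl⟩ ?_ ?_ ?_ ?_
    · exact h1.setN 0 (by decide) (by decide)
    · rintro i t hi hi' hf' h2
      have hm'' : t.v .m = M := (hf'.v .m rfl).trans hm'
      have hδ'' : t.r .del = δ := (hf'.r .del rfl).trans hδ'
      have hnet'' : t.a .net = s.a .net := (hf'.a .net rfl).trans hnet'
      have hdig'' : t.a .dig = s.a .dig := (hf'.a .dig rfl).trans hdig'
      refine Does.ite (M * (20 * M + 40) + 50) (fun hc => ?_) (fun hc => Does.skip ?_)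
      · simp [h2.cur, h2.cnt] at hc
        refine (stepCmd_spec hm'' hMS hδ'' h2 hc).mono le_rfl fun t' _ h3 => ?_
        rw [hnet'', hdig'', hi'] at h3
        exact h3.setN _ (by decide) (by decide)
      · simp [h2.cur, h2.cnt, -not_lt] at hc
        rw [decode, Dec.step, if_neg (not_lt.2 hc)]
        exact h2.setN _ (by decide) (by decide)
    · intro t _ h2
      rwa [hL'] at h2
    · rw [hL']
      have : L * (M * (20 * M + 40) + 51 + 3) ≤ L * (M * (20 * M + 40) + 60) :=
        Nat.mul_le_mul_left _ (by omega)
      omega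

end Programs

/-! ### Balancedness in terms of colour counts -/

section Counting

/-- The number of `x < n` with label `j` that satisfy `p`. -/
def classCount (ℓ : ℕ → ℕ) (p : ℕ → Bool) (j n : ℕ) : ℕ :=
  ((Finset.range n).filter fun x => ℓ x = j ∧ p x = true).card

theorem classCount_succ (ℓ : ℕ → ℕ) (p : ℕ → Bool) (j n : ℕ) :
    classCount ℓ p j (n + 1) = classCount ℓ p j n + if ℓ n = j ∧ p n = true then 1 else 0 := by
  unfold classCount
  rw [Finset.range_add_one, Finset.filter_insert]
  split_ifs with h
  · rw [Finset.card_insert_of_notMem (by simp)]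
  · rfl

variable {X : Type*} [Fintype X] [DecidableEq X] {n : ℕ} (pt : Fin n ≃ X)

theorem card_inter_eq_classCount {ℓ : ℕ → ℕ} {C Y : Finset X} {p : ℕ → Bool} {j : ℕ}
    (hC : ∀ y, y ∈ C ↔ ℓ (pt.symm y) = j) (hp : ∀ y, p (pt.symm y) = true ↔ y ∈ Y) :
    (C ∩ Y).card = classCount ℓ p j n := by
  refine Finset.card_bij (fun y _ => (pt.symm y : ℕ)) (fun y hy => ?_) (fun y _ z _ h => ?_)
    (fun i hi => ?_)
  · rw [Finset.mem_inter, hC] at hy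
    simp [hy.1, (hp y).2 hy.2]
  · exact pt.symm.injective (Fin.ext h)
  · simp only [Finset.mem_filter, Finset.mem_range] at hi
    refine ⟨pt ⟨i, hi.1⟩, ?_, by simp⟩
    rw [Finset.mem_inter, hC, ← hp]
    simpa using hi.2

/-- A label that no point carries is not a cluster and imposes nothing. -/
def ClassBalanced (b : ℝ) (n1 n2 : ℕ) : Prop :=
  0 < n1 + n2 → b ≤ (n2 : ℝ) / n1 ∧ b ≤ (n1 : ℝ) / n2

theorem balanced_ofLabels_iff {X₁ X₂ : Finset X} {b : ℝ} {ℓ : ℕ → ℕ} {m : ℕ} {p₁ p₂ : ℕ → Bool}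
    (hX : IsCompl X₁ X₂) (hℓ : ∀ i < n, ℓ i < m) (h₁ : ∀ y, p₁ (pt.symm y) = true ↔ y ∈ X₁)
    (h₂ : ∀ y, p₂ (pt.symm y) = true ↔ y ∈ X₂) :
    Balanced X₁ X₂ b (ofLabels pt ℓ) ↔
      ∀ j < m, ClassBalanced b (classCount ℓ p₁ j n) (classCount ℓ p₂ j n) := by
  have key : ∀ C ∈ (ofLabels pt ℓ).parts, ∀ x ∈ C,
      (C ∩ X₁).card = classCount ℓ p₁ (ℓ (pt.symm x)) n ∧
      (C ∩ X₂).card = classCount ℓ p₂ (ℓ (pt.symm x)) n := fun C hC x hx =>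
    ⟨card_inter_eq_classCount pt (fun y => (ofLabels_same pt ℓ hC hx).trans eq_comm) h₁,
      card_inter_eq_classCount pt (fun y => (ofLabels_same pt ℓ hC hx).trans eq_comm) h₂⟩
  constructor
  · intro h j hj hpos
    obtain ⟨y, hy⟩ : ∃ y : X, ℓ (pt.symm y) = j := by
      rcases (by omega : 0 < classCount ℓ p₁ j n ∨ 0 < classCount ℓ p₂ j n) with h | h <;>
      · obtain ⟨i, hi⟩ := Finset.card_pos.1 h
        simp only [Finset.mem_filter, Finset.mem_range] at hi
        exact ⟨pt ⟨i, hi.1⟩, by simp [hi.2.1]⟩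
    have hC : (ofLabels pt ℓ).part y ∈ (ofLabels pt ℓ).parts := by simp
    have hyC : y ∈ (ofLabels pt ℓ).part y := by simp
    have := h _ hC
    rw [(key _ hC y hyC).1, (key _ hC y hyC).2, hy, le_min_iff] at this
    exact this
  · intro h C hC
    obtain ⟨x, hx⟩ := (ofLabels pt ℓ).nonempty_of_mem_parts hC
    obtain ⟨h3, h4⟩ := key C hC x hx
    have := h _ (hℓ _ (pt.symm x).2)
    rw [← h3, ← h4] at this
    rw [le_min_iff]
    refine this ?_
    by_cases hx1 : x ∈ X₁
    · have : 0 < (C ∩ X₁).card := Finset.card_pos.2 ⟨x, Finset.mem_inter.2 ⟨hx, hx1⟩⟩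
      omega
    · have hx2 : x ∈ X₂ := by
        have : x ∈ X₁ ⊔ X₂ := by rw [hX.sup_eq_top]; exact Finset.mem_univ x
        simpa [hx1] using this
      have : 0 < (C ∩ X₂).card := Finset.card_pos.2 ⟨x, Finset.mem_inter.2 ⟨hx, hx2⟩⟩
      omega

end Counting

section Programs

variable {E : Env} {S : ℕ}

/-! ### Validation -/

def fairCmd : Cmd :=
  .ops [.constN .ok 1] ;;
  forUp .j .cnt (
    .ops [.constN .n1 0, .constN .n2 0, .constN .tc 1] ;;
    forUp .x .n (
      .ops [.load .c .lab .x] ;;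
      .ite (.eqN .c .j)
        (.ops [.color .col .x] ;;
          .ite (.eqN .col .tc) (.ops [.inc .n1]) (.ops [.inc .n2])) .skip) ;;
    .ops [.addN .i .n1 .n2, .constN .c 0] ;;
    .ite (.ltN .c .i)
      (.ops [.castR .q1 .n1, .castR .q2 .n2, .divR .q3 .q2 .q1, .divR .q2 .q1 .q2] ;;
        .ite (.leR .b .q3) (.ite (.leR .b .q2) .skip (.ops [.constN .ok 0]))
          (.ops [.constN .ok 0]))
      .skip)

def checkCmd : Bool → Cmd
  | false => .ops [.validate .ok]
  | true => fairCmd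

theorem fairCmd_spec {s : HState} {n k : ℕ} {b : ℝ} (hn : s.v .n = n) (hk : s.v .cnt ≤ k)
    (hb : s.r .b = b) (hnS : n ≤ S) :
    Does E S fairCmd s (k * (n * 20 + 40) + 10) fun s' =>
      s'.v .ok = 1 ↔ ∀ j < s.v .cnt,
        ClassBalanced b (classCount (s.a .lab) (fun x => decide (E.color x = 1)) j n)
          (classCount (s.a .lab) (fun x => decide (E.color x ≠ 1)) j n) := by
  set N1 := fun j x => classCount (s.a .lab) (fun x => decide (E.color x = 1)) j x with hN1
  set N2 := fun j x => classCount (s.a .lab) (fun x => decide (E.color x ≠ 1)) j x with hN2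
  refine Does.opsSeq 2 (k * (n * 20 + 40) + 3) (by simp) (by simp) ?_
  refine Does.forUp (n * 20 + 35) (fun j s' => s'.v .ok = 1 ↔
    ∀ j' < j, ClassBalanced b (N1 j' n) (N2 j' n)) ⟨rfl, rfl⟩ (by simp) ?_ ?_ ?_
  · rintro j s' hj hj' hf h1
    have en : s'.v .n = n := (hf.v .n rfl).trans (by simp [hn])
    have el : s'.a .lab = s.a .lab := (hf.a .lab rfl).trans (by simp)
    have eb : s'.r .b = b := (hf.r .b rfl).trans (by simp [hb])
    refine Does.opsSeq 6 (n * 20 + 29) (by simp) (by simp) ?_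
    refine Does.seq (n * 20 + 3) 26 (R := fun t => t.v .n1 = N1 j n ∧ t.v .n2 = N2 j n) ?_ ?_
    · refine Does.forUp 10 (fun x t => t.v .n1 = N1 j x ∧ t.v .n2 = N2 j x) ⟨rfl, rfl⟩ ?_ ?_ ?_ ?_
      · simp [hN1, hN2, classCount]
      · rintro x t hx hx' hf' ⟨h2, h3⟩
        have ej : t.v .j = j := (hf'.v .j rfl).trans (by simp [hj'])
        have el' : t.a .lab = s.a .lab := (hf'.a .lab rfl).trans (by simp [el])
        have etc : t.v .tc = 1 := (hf'.v .tc rfl).trans (by simp)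
        simp [en] at hx
        refine Does.opsSeq 2 8 (by simp; omega) (by simp) ?_
        refine Does.ite 7 (fun hc => ?_) (fun hc => Does.skip ?_)
        · simp [hx', el', ej] at hc
          refine Does.opsSeq 2 5 (by simp) (by simp) ?_
          refine Does.ite 4 (fun hc' => Does.ops (by simp) (by simp) ?_)
            (fun hc' => Does.ops (by simp) (by simp) ?_)
          · simp [hx', etc] at hc'
            simp [hN1, hN2, classCount_succ, hc, hc', h2, h3]
          · simp [hx', etc] at hc'
            simp [hN1, hN2, classCount_succ, hc, hc', h2, h3]
        · simp [hx', el', ej] at hc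
          simp [hN1, hN2, classCount_succ, hc, h2, h3]
      · rintro t hf' h
        simpa [en] using h
      · simp [en]
        omega
    · rintro t hf' ⟨h2, h3⟩
      have ej : t.v .j = j := (hf'.v .j rfl).trans (by simp [hj'])
      have eb' : t.r .b = b := (hf'.r .b rfl).trans (by simp [eb])
      have eok : t.v .ok = s'.v .ok := (hf'.v .ok rfl).trans (by simp)
      have good : ClassBalanced b (N1 j n) (N2 j n) → (s'.v .ok = 1 ↔
          ∀ j' < j + 1, ClassBalanced b (N1 j' n) (N2 j' n)) := by
        intro hB
        rw [h1]
        constructor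
        · intro h j' hj'
          rcases Nat.lt_succ_iff_lt_or_eq.1 hj' with h4 | rfl
          · exact h j' h4
          · exact hB
        · exact fun h j' hj' => h j' (by omega)
      have bad : ¬ ClassBalanced b (N1 j n) (N2 j n) →
          ¬ ∀ j' < j + 1, ClassBalanced b (N1 j' n) (N2 j' n) :=
        fun hB h => hB (h j (by omega))
      refine Does.opsSeq 4 20 (by simp) (by simp) ?_
      refine Does.ite 15 (fun hc => ?_) (fun hc => Does.skip ?_)
      · simp [h2, h3, -add_pos_iff] at hc
        refine Does.opsSeq 8 6 (by simp) (by simp) ?_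
        refine Does.ite 5 (fun hc1 => Does.ite 2 (fun hc2 => Does.skip ?_)
          (fun hc2 => Does.ops (by simp) (by simp) ?_)) (fun hc1 => Does.ops (by simp) (by simp) ?_)
        · simp [h2, h3, eb'] at hc1 hc2
          simpa [eok] using good fun _ => ⟨hc1, hc2⟩
        · simp only [HTest.holds] at hc2
          simp [h2, h3, eb', -not_le] at hc2
          simpa using bad fun h => hc2 (h hc).2
        · simp only [HTest.holds] at hc1
          simp [h2, h3, eb', -not_le] at hc1
          simpa using bad fun h => hc1 (h hc).1
      · simp [h2, h3] at hc
        simpa [eok] using good fun h => by omega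
  · rintro s' hf h
    rwa [show (runAll E [.constN .ok 1] s).v .cnt = s.v .cnt by simp] at h
  · simp
    have : s.v .cnt * (n * 20 + 35 + 3) ≤ k * (n * 20 + 40) := Nat.mul_le_mul hk (by omega)
    omega

/-! ### Evaluation of a candidate -/

def recordCmd : Cmd :=
  .ops [.constN .found 1, .copyR .best .ub] ;;
  forUp .x .n (.ops [.load .c .lab .x, .store .blab .x .c])

def evalCmd (fair : Bool) : Cmd :=
  .ite (.ltN .cur .cnt) .skip
    (.ite (.ltN .k .cnt) .skip
      (forUp .x .n (.ops [.load .u .asg .x, .load .c .part .u, .store .lab .x .c]) ;;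
        checkCmd fair ;;
        .ops [.constN .tc 1] ;;
        .ite (.eqN .ok .tc)
          (.ops [.constN .tc 0] ;;
            .ite (.eqN .found .tc) recordCmd (.ite (.ltR .ub .best) recordCmd .skip))
          .skip))

variable {X : Type*} [Fintype X] [DecidableEq X] {n : ℕ}

/-- The validation subroutine decides `F` within time `T`. -/
def Checks (E : Env) (S : ℕ) (fair : Bool) (pt : Fin n ≃ X) (F : Clustering X → Prop) (k : ℕ)
    (b : ℝ) (T : ℕ) : Prop :=
  ∀ s : HState, s.v .n = n → s.v .cnt ≤ k → s.r .b = b → (∀ x < n, s.a .lab x < s.v .cnt) →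
    Does E S (checkCmd fair) s T fun s' => (s'.v .ok = 1 ↔ F (ofLabels pt (s.a .lab)))

theorem checks_validate (pt : Fin n ≃ X) (F : Clustering X → Prop) (k : ℕ) (b : ℝ)
    (hE : ∀ ℓ, E.valid ℓ ↔ F (ofLabels pt ℓ)) : Checks E S false pt F k b E.validTime := by
  intro s _ _ _ _
  refine Does.ops (by simp) (by simp) ?_
  simp [hE]

theorem checks_fair (pt : Fin n ≃ X) {X₁ X₂ : Finset X} (hX : IsCompl X₁ X₂) (k : ℕ) (b : ℝ)
    (hE : ∀ y, E.color (pt.symm y) = 1 ↔ y ∈ X₁) (hnS : n ≤ S) :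
    Checks E S true pt (Balanced X₁ X₂ b) k b (k * (n * 20 + 40) + 10) := by
  intro s hn hk hb hl
  refine (fairCmd_spec hn hk hb hnS).mono le_rfl fun s' _ h => ?_
  rw [h]
  refine (balanced_ofLabels_iff pt hX hl (by simpa using hE) fun y => ?_).symm
  have h1 : y ∈ X₂ ↔ y ∉ X₁ := by
    constructor
    · exact fun h2 h1 => Finset.disjoint_left.1 hX.disjoint h1 h2
    · intro h1
      have : y ∈ X₁ ⊔ X₂ := by rw [hX.sup_eq_top]; exact Finset.mem_univ y
      simpa [h1] using this
  simp [h1, hE]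

variable [MetricSpace X]

/-- The memory holds the best solution found so far, if any. -/
def Best (pt : Fin n ≃ X) (F : Clustering X → Prop) (k : ℕ) (s : HState) : Prop :=
  (s.v .found = 0 ∨ s.v .found = 1) ∧ (s.v .found = 1 →
    IsSolution F k (ofLabels pt (s.a .blab)) ∧ cost (ofLabels pt (s.a .blab)) ≤ s.r .best)

/-- Candidates are compared by the certified bound `ub`; their true cost is never computed. -/
def Beat (s : HState) (y : ℝ) : Prop := s.v .found = 1 ∧ s.r .best ≤ y

theorem recordCmd_spec {s : HState} (hn : s.v .n = n) (hnS : n ≤ S) :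
    Does E S recordCmd s (n * 10 + 10) fun s' => s'.v .found = 1 ∧ s'.r .best = s.r .ub ∧
      ∀ x < n, s'.a .blab x = s.a .lab x := by
  refine Does.opsSeq 4 (n * 10 + 3) (by simp) (by simp) ?_
  refine Does.forUp 7 (fun x t => ∀ x' < x, t.a .blab x' = s.a .lab x') ⟨rfl, rfl⟩ (by simp)
    ?_ ?_ ?_
  · rintro x t hx hx' hf h
    simp [hn] at hx
    have el : t.a .lab = s.a .lab := (hf.a .lab rfl).trans (by simp)
    refine Does.ops (by simp; omega) (by simp) ?_
    simp [hx', el]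
    intro x' hx''
    rcases hx''.lt_or_eq with h1 | rfl
    · rw [Function.update_of_ne h1.ne]; exact h x' h1
    · simp
  · intro t hf h
    exact ⟨(hf.v .found rfl).trans (by simp), (hf.r .best rfl).trans (by simp),
      by simpa [hn] using h⟩
  · simp [hn]

/-- Candidates with open classes or more than `k` classes may be skipped, since the code of a
solution yields neither. -/
theorem evalCmd_spec {fair : Bool} {pt : Fin n ≃ X} {F : Clustering X → Prop} {k T M : ℕ}
    {b δ : ℝ} {s : HState} {st : Dec} (hc : Checks E S fair pt F k b T) (hn : s.v .n = n)
    (hk : s.v .k = k) (hb : s.r .b = b) (hnS : n ≤ S)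
    (hnet : IsNet (ptDist pt) n δ (s.a .net) (s.a .asg) M) (hδ : 0 ≤ δ) (hst : DecRep M s st)
    (hs : st.Sound (ptDist pt) (s.a .net) M δ) (hbest : Best pt F k s) :
    Does E S (evalCmd fair) s (T + n * 20 + 40) fun s' => Best pt F k s' ∧
      (∀ y, Beat s y → Beat s' y) ∧ (st.cur = st.cnt → st.cnt ≤ k →
        (∀ ℓ : ℕ → ℕ, (∀ i < n, ℓ i = st.part (s.a .asg i)) → F (ofLabels pt ℓ)) →
          Beat s' st.ub) := by
  have hMS : M ≤ S := hnet.le_card.trans hnS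
  refine Does.ite (T + n * 20 + 39) (fun h1 => Does.skip ?_) (fun h1 => ?_)
  · simp [hst.cur, hst.cnt] at h1
    exact ⟨hbest, fun _ h => h, fun h => absurd h h1.ne⟩
  simp [hst.cur, hst.cnt] at h1
  have hcc : st.cur = st.cnt := le_antisymm hs.cur_le h1
  refine Does.ite (T + n * 20 + 38) (fun h2 => Does.skip ?_) (fun h2 => ?_)
  · simp [hk, hst.cnt] at h2
    exact ⟨hbest, fun _ h => h, fun _ h => absurd h h2.not_ge⟩
  simp [hk, hst.cnt] at h2
  refine Does.seq (n * 9 + 3) (T + n * 10 + 30) (R := fun t =>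
    ∀ x < n, t.a .lab x = st.part (s.a .asg x)) ?_ ?_
  · refine Does.forUp 6 (fun x t => ∀ x' < x, t.a .lab x' = st.part (s.a .asg x'))
      ⟨rfl, rfl⟩ (by simp) ?_ ?_ ?_
    · rintro x t hx hx' hf h
      rw [hn] at hx
      have ea : t.a .asg = s.a .asg := hf.a .asg rfl
      have ep : t.a .part = s.a .part := hf.a .part rfl
      have hax := hnet.asg_lt x hx
      refine Does.ops (by simp [hx', ea]; omega) (by simp) ?_
      simp [hx', ea, ep]
      intro x' hx''
      rcases hx''.lt_or_eq with h1 | rfl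
      · rw [Function.update_of_ne h1.ne]; exact h x' h1
      · simp [hst.part _ hax]
    · intro t _ h
      rwa [hn] at h
    · rw [hn]
  intro t hf hlab
  have hlt : ∀ x < n, t.a .lab x < st.cnt := fun x hx => by
    rw [hlab x hx]; exact hs.part_lt _ (hnet.asg_lt x hx)
  have ecnt : t.v .cnt = st.cnt := (hf.v .cnt rfl).trans hst.cnt
  refine Does.seq T (n * 10 + 30) (hc t ((hf.v .n rfl).trans hn) (by omega)
    ((hf.r .b rfl).trans hb) (by rwa [ecnt])) ?_
  intro t' hf' hok
  have efound : t'.v .found = s.v .found :=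
    (hf'.v .found (by cases fair <;> rfl)).trans (hf.v .found rfl)
  have ebest : t'.r .best = s.r .best :=
    (hf'.r .best (by cases fair <;> rfl)).trans (hf.r .best rfl)
  have eub : t'.r .ub = st.ub :=
    ((hf'.r .ub (by cases fair <;> rfl)).trans (hf.r .ub rfl)).trans hst.ub
  have en : t'.v .n = n := ((hf'.v .n (by cases fair <;> rfl)).trans (hf.v .n rfl)).trans hn
  have hlab1 : t'.a .lab = t.a .lab := hf'.a .lab (by cases fair <;> rfl)
  have hblab : t'.a .blab = s.a .blab :=
    (hf'.a .blab (by cases fair <;> rfl)).trans (hf.a .blab rfl)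
  obtain ⟨hcost, hcard⟩ := hnet.cost_le hδ hs hcc hlab
  have hrec : ∀ t'' : HState, F (ofLabels pt (t.a .lab)) → (t''.v .found = 1 ∧
      t''.r .best = st.ub ∧ ∀ x < n, t''.a .blab x = t.a .lab x) →
      Best pt F k t'' ∧ Beat t'' st.ub := by
    rintro t'' hF ⟨h3, h4, h5⟩
    rw [Best, ofLabels_congr pt _ h5]
    exact ⟨⟨Or.inr h3, fun _ => ⟨⟨hcard.trans h2, hF⟩, by rwa [h4]⟩⟩, h3, h4.le⟩
  refine Does.opsSeq 2 (n * 10 + 28) (by simp) (by simp) ?_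
  refine Does.ite (n * 10 + 27) (fun h3 => ?_) (fun h3 => Does.skip ?_)
  · simp at h3
    have hF := hok.1 h3
    refine Does.opsSeq 2 (n * 10 + 20) (by simp) (by simp) ?_
    refine Does.ite (n * 10 + 19) (fun h4 => ?_) (fun h4 => ?_)
    · simp at h4
      refine (recordCmd_spec (by simp [en]) hnS).mono (by omega) fun t'' _ h5 => ?_
      simp [eub, hlab1] at h5
      obtain ⟨h6, h7⟩ := hrec t'' hF h5
      refine ⟨h6, fun y hy => ?_, fun _ _ _ => h7⟩
      have := hy.1
      omega
    · simp at h4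
      refine Does.ite (n * 10 + 18) (fun h5 => ?_) (fun h5 => Does.skip ?_)
      · simp [eub, ebest] at h5
        refine (recordCmd_spec (by simp [en]) hnS).mono (by omega) fun t'' _ h6 => ?_
        simp [eub, hlab1] at h6
        obtain ⟨h7, h8⟩ := hrec t'' hF h6
        exact ⟨h7, fun y hy => ⟨h8.1, h8.2.trans (h5.le.trans hy.2)⟩, fun _ _ _ => h8⟩
      · simp only [HTest.holds] at h5
        simp [eub, ebest, -not_lt] at h5
        have hf1 : s.v .found = 1 := by
          rcases hbest.1 with h | h
          · exact absurd (efound.trans h) h4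
          · exact h
        simp only [Best, Beat]
        simp [efound, ebest, hblab]
        exact ⟨hbest, fun _ _ _ => ⟨hf1, not_lt.1 h5⟩⟩
  · simp [hok] at h3
    simp only [Best, Beat]
    simp [efound, ebest, hblab]
    exact ⟨hbest, fun _ _ h => absurd (h _ hlab) h3⟩

/-! ### Counting in base five -/

def incrCmd : Cmd :=
  .ops [.constN .carry 1, .constN .one 1, .constN .four 4, .constN .zero 0] ;;
  forUp .i .len (
    .ite (.eqN .carry .one)
      (.ops [.load .d .dig .i] ;;
        .ite (.eqN .d .four) (.ops [.store .dig .i .zero])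
          (.ops [.inc .d, .store .dig .i .d, .constN .carry 0])) .skip) ;;
  .ops [.copyN .done .carry]

/-- The number with the base five digits `g 0, …, g (L - 1)`. -/
def digVal (g : ℕ → ℕ) (L : ℕ) : ℕ := ∑ i ∈ Finset.range L, g i * 5 ^ i

theorem digVal_lt {g : ℕ → ℕ} (hg : ∀ i, g i < 5) (L : ℕ) : digVal g L < 5 ^ L := by
  induction L with
  | zero => simp [digVal]
  | succ L ih =>
    rw [digVal, Finset.sum_range_succ]
    have : g L * 5 ^ L ≤ 4 * 5 ^ L := Nat.mul_le_mul_right _ (by have := hg L; omega)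
    rw [pow_succ]
    unfold digVal at ih
    omega

theorem digVal_inj {g g' : ℕ → ℕ} (hg : ∀ i, g i < 5) (hg' : ∀ i, g' i < 5) {L : ℕ}
    (h : digVal g L = digVal g' L) : ∀ i < L, g i = g' i := by
  induction L with
  | zero => intro i hi; omega
  | succ L ih =>
    have h1 := digVal_lt hg L
    have h2 := digVal_lt hg' L
    have hL : digVal g L = digVal g' L ∧ g L = g' L := by
      simp only [digVal, Finset.sum_range_succ] at h h1 h2 ⊢
      have hp : 0 < 5 ^ L := by positivity
      have e1 := Nat.add_mul_mod_self_right (∑ i ∈ Finset.range L, g i * 5 ^ i) (g L) (5 ^ L)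
      have e2 := Nat.add_mul_mod_self_right (∑ i ∈ Finset.range L, g' i * 5 ^ i) (g' L) (5 ^ L)
      rw [Nat.mod_eq_of_lt h1] at e1
      rw [Nat.mod_eq_of_lt h2] at e2
      have e3 : ∑ i ∈ Finset.range L, g i * 5 ^ i = ∑ i ∈ Finset.range L, g' i * 5 ^ i := by
        rw [← e1, ← e2, h]
      refine ⟨e3, Nat.eq_of_mul_eq_mul_right hp (by omega)⟩
    intro i hi
    rcases Nat.lt_succ_iff_lt_or_eq.1 hi with h | rfl
    · exact ih hL.1 i h
    · exact hL.2

theorem digVal_update {g : ℕ → ℕ} {L i c : ℕ} (hi : i < L) :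
    digVal (Function.update g i c) L + g i * 5 ^ i = digVal g L + c * 5 ^ i := by
  have hm := Finset.mem_range.2 hi
  have e : ∑ x ∈ (Finset.range L).erase i, Function.update g i c x * 5 ^ x =
      ∑ x ∈ (Finset.range L).erase i, g x * 5 ^ x :=
    Finset.sum_congr rfl fun x hx => by rw [Function.update_of_ne (Finset.ne_of_mem_erase hx)]
  rw [digVal, digVal, ← Finset.add_sum_erase _ _ hm, ← Finset.add_sum_erase _ _ hm, e,
    Function.update_self]
  omega

/-- The carry counts `5 ^ i` before position `i` is treated, so digits and carry together keep the
value constant along the loop. A final carry signals overflow. -/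
theorem incrCmd_spec {s : HState} {L : ℕ} (hL : s.v .len = L) (hd : ∀ i, s.a .dig i < 5)
    (hz : ∀ i, L ≤ i → s.a .dig i = 0) :
    Does E S incrCmd s (L * 20 + 20) fun s' => (∀ i, s'.a .dig i < 5) ∧
      (∀ i, L ≤ i → s'.a .dig i = 0) ∧ s'.v .zero = 0 ∧ (s'.v .done = 0 ∨ s'.v .done = 1) ∧
      digVal (s'.a .dig) L + s'.v .done * 5 ^ L = digVal (s.a .dig) L + 1 := by
  refine Does.opsSeq 8 (L * 20 + 10) (by simp) (by simp) ?_
  refine Does.seq (L * 20 + 3) 2 (R := fun t => (∀ i, t.a .dig i < 5) ∧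
    (∀ i, L ≤ i → t.a .dig i = 0) ∧ (t.v .carry = 0 ∨ t.v .carry = 1) ∧
    digVal (t.a .dig) L + t.v .carry * 5 ^ L = digVal (s.a .dig) L + 1) ?_ ?_
  · refine Does.forUp 10 (fun i t => (∀ i, t.a .dig i < 5) ∧
      (∀ i, L ≤ i → t.a .dig i = 0) ∧ (t.v .carry = 0 ∨ t.v .carry = 1) ∧
      digVal (t.a .dig) L + t.v .carry * 5 ^ i = digVal (s.a .dig) L + 1) ⟨rfl, rfl⟩ ?_ ?_ ?_ ?_
    · simpa using ⟨hd, hz⟩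
    · rintro i t hi hi' hf ⟨h1, h2, h3, h4⟩
      simp [hL] at hi
      have e1 : t.v .one = 1 := (hf.v .one rfl).trans (by simp)
      have e4 : t.v .four = 4 := (hf.v .four rfl).trans (by simp)
      have e0 : t.v .zero = 0 := (hf.v .zero rfl).trans (by simp)
      refine Does.ite 9 (fun hc => ?_) (fun hc => Does.skip ?_)
      · simp [e1] at hc
        have hu := fun c => digVal_update (g := t.a .dig) (c := c) hi
        refine Does.opsSeq 2 7 (by simp) (by simp) ?_
        refine Does.ite 6 (fun hc' => Does.ops (by simp) (by simp) ?_)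
          (fun hc' => Does.ops (by simp) (by simp) ?_)
        · simp [hi', e4] at hc'
          have := hu 0
          rw [hc'] at this
          simp [hi', e0, hc]
          refine ⟨fun j => ?_, fun j hj => ?_, ?_⟩
          · by_cases h : j = i
            · subst h; simp
            · rw [Function.update_of_ne h]; exact h1 j
          · rw [Function.update_of_ne (by omega)]; exact h2 j hj
          · rw [hc] at h4
            rw [pow_succ]
            omega
        · simp [hi', e4] at hc'
          have := hu (t.a .dig i + 1)
          simp [hi']
          refine ⟨fun j => ?_, fun j hj => ?_, ?_⟩
          · by_cases h : j = i
            · subst h; simp; have := h1 j; omega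
            · rw [Function.update_of_ne h]; exact h1 j
          · rw [Function.update_of_ne (by omega)]; exact h2 j hj
          · rw [hc] at h4
            rw [add_mul] at this
            omega
      · simp [e1] at hc
        have h0 : t.v .carry = 0 := by omega
        simp [h0] at h4 ⊢
        exact ⟨h1, h2, h4⟩
    · rintro t hf h
      rw [show (runAll E [.constN .carry 1, .constN .one 1, .constN .four 4, .constN .zero 0]
        s).v .len = L by simp [hL]] at h
      exact h
    · simp [hL]; omega
  · rintro t hf ⟨h1, h2, h3, h4⟩
    have e0 : t.v .zero = 0 := (hf.v .zero rfl).trans (by simp)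
    refine Does.ops (by simp) (by simp) ?_
    simpa using ⟨h1, h2, e0, h3, h4⟩

end Programs

section Programs

variable {E : Env} {S : ℕ}

/-! ### All candidates at one scale -/

def roundCmd (fair : Bool) : Cmd := decodeCmd ;; evalCmd fair ;; incrCmd

def bodyCmd (fair : Bool) : Cmd :=
  .ops [.mulR .del .eps .g, .divR .del .del .krr] ;;
  netCmd ;;
  .ops [.constN .done 0, .constN .zero 0] ;;
  .loop (.eqN .done .zero) (roundCmd fair)

variable {X : Type*} [Fintype X] [DecidableEq X] [MetricSpace X] {n : ℕ}

theorem Best.congr {pt : Fin n ≃ X} {F : Clustering X → Prop} {k : ℕ} {s s' : HState}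
    (h : Best pt F k s) (h1 : s'.v .found = s.v .found) (h2 : s'.r .best = s.r .best)
    (h3 : s'.a .blab = s.a .blab) : Best pt F k s' := by
  rw [Best, h1, h2, h3]; exact h

theorem Beat.congr {s s' : HState} {y : ℝ} (h : Beat s y) (h1 : s'.v .found = s.v .found)
    (h2 : s'.r .best = s.r .best) : Beat s' y := by
  rw [Beat, h1, h2]; exact h

theorem Beat.mono {s : HState} {y z : ℝ} (h : Beat s y) (hz : y ≤ z) : Beat s z :=
  ⟨h.1, h.2.trans hz⟩

/-- The instance and the environment in which it is to be solved. -/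
structure Setup (E : Env) (S : ℕ) (fair : Bool) (pt : Fin n ≃ X) (F : Clustering X → Prop) (k e : ℕ)
    (ε b : ℝ) (T : ℕ) : Prop where
  dist : E.dist = ptDist pt
  n_pos : 1 ≤ n
  k_pos : 1 ≤ k
  eps_pos : 0 < ε
  e_pos : 1 ≤ e
  e_spec : 1 ≤ 2 ^ e * ε
  n_le : n ≤ S
  k_lt : k < S
  mergeable : Mergeable F k
  checks : Checks E S fair pt F k b T

structure Config (pt : Fin n ≃ X) (F : Clustering X → Prop) (k e : ℕ) (ε b : ℝ) (s : HState) :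
    Prop where
  v_n : s.v .n = n
  v_k : s.v .k = k
  r_eps : s.r .eps = ε
  r_b : s.r .b = b
  krr : s.r .krr = k * 32
  len : s.v .len = 64 * (k * e)
  dig : ∀ i, s.a .dig i = 0
  best : Best pt F k s

def roundTime (n L B T : ℕ) : ℕ :=
  L * (B * (20 * B + 40) + 60) + B * 5 + 20 + (T + n * 20 + 40) + (L * 20 + 20)

def bodyTime (n L B T : ℕ) : ℕ :=
  n * (12 * B + 30) + 5 ^ L * (roundTime n L B T + 1) + 20

/-- The candidate that `dig` stands for satisfies the constraint. -/
def Feasible (pt : Fin n ≃ X) (F : Clustering X → Prop) (k : ℕ) (asg : ℕ → ℕ) (st : Dec) : Prop :=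
  st.cur = st.cnt ∧ st.cnt ≤ k ∧
    ∀ ℓ : ℕ → ℕ, (∀ i < n, ℓ i = st.part (asg i)) → F (ofLabels pt ℓ)

theorem roundCmd_spec {fair : Bool} {pt : Fin n ≃ X} {F : Clustering X → Prop} {k e T M B : ℕ}
    {ε b δ : ℝ} {L : ℕ} (hS : Setup E S fair pt F k e ε b T) {s : HState} (hn : s.v .n = n)
    (hk : s.v .k = k) (hb : s.r .b = b) (hL : s.v .len = L) (hm : s.v .m = M) (hMB : M ≤ B)
    (hδ : s.r .del = δ) (hδ0 : 0 ≤ δ)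
    (hnet : IsNet (ptDist pt) n δ (s.a .net) (s.a .asg) M) (hbest : Best pt F k s)
    (hd : ∀ i, s.a .dig i < 5) (hz : ∀ i, L ≤ i → s.a .dig i = 0) :
    Does E S (roundCmd fair) s (roundTime n L B T) fun s' => Best pt F k s' ∧
      (∀ y, Beat s y → Beat s' y) ∧
      (Feasible pt F k (s.a .asg) (decode (ptDist pt) (s.a .net) M δ (s.a .dig) L) →
        Beat s' (decode (ptDist pt) (s.a .net) M δ (s.a .dig) L).ub) ∧
      (∀ i, s'.a .dig i < 5) ∧ (∀ i, L ≤ i → s'.a .dig i = 0) ∧ s'.v .zero = 0 ∧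
      (s'.v .done = 0 ∨ s'.v .done = 1) ∧
      digVal (s'.a .dig) L + s'.v .done * 5 ^ L = digVal (s.a .dig) L + 1 := by
  refine Does.seq (L * (B * (20 * B + 40) + 60) + B * 5 + 20) (T + n * 20 + 40 + (L * 20 + 20))
    ((decodeCmd_spec hm (hnet.le_card.trans hS.n_le) hδ hL).mono (by gcongr) fun _ _ h => h)
    ?_ (by rw [roundTime]; omega)
  intro s₁ f₁ h₁
  rw [hS.dist] at h₁
  have easg : s₁.a .asg = s.a .asg := f₁.a .asg rfl
  have enet : s₁.a .net = s.a .net := f₁.a .net rfl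
  refine Does.seq (T + n * 20 + 40) (L * 20 + 20) (evalCmd_spec hS.checks ((f₁.v .n rfl).trans hn)
    ((f₁.v .k rfl).trans hk) ((f₁.r .b rfl).trans hb) hS.n_le (by rwa [enet, easg]) hδ0 h₁
    (by rw [enet]; exact decode_sound _ _)
    (hbest.congr (f₁.v .found rfl) (f₁.r .best rfl) (f₁.a .blab rfl))) ?_
  rintro s₂ f₂ ⟨h₂, h₃, h₄⟩
  have edig : s₂.a .dig = s.a .dig :=
    (f₂.a .dig (by cases fair <;> rfl)).trans (f₁.a .dig rfl)
  refine (incrCmd_spec (((f₂.v .len (by cases fair <;> rfl)).trans (f₁.v .len rfl)).trans hL)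
    (by rwa [edig]) (by rwa [edig])).mono le_rfl ?_
  rintro s₃ f₃ h₅
  rw [edig] at h₅
  rw [easg] at h₄
  refine ⟨h₂.congr (f₃.v .found rfl) (f₃.r .best rfl) (f₃.a .blab rfl), fun y hy => ?_,
    fun h => ?_, h₅⟩
  · exact (h₃ y (hy.congr (f₁.v .found rfl) (f₁.r .best rfl))).congr (f₃.v .found rfl)
      (f₃.r .best rfl)
  · exact (h₄ h.1 h.2.1 h.2.2).congr (f₃.v .found rfl) (f₃.r .best rfl)

theorem bodyCmd_spec {fair : Bool} {pt : Fin n ≃ X} {F : Clustering X → Prop} {k e T B : ℕ}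
    {ε b g : ℝ} (hS : Setup E S fair pt F k e ε b T) {s : HState} (hs : Config pt F k e ε b s)
    (hg : s.r .g = g) (hg0 : 0 ≤ g)
    (hB : ∀ (M : ℕ) (net : ℕ → ℕ), (∀ u < M, net u < n) →
      (∀ u < M, ∀ w < u, ε * g / (k * 32) < ptDist pt (net u) (net w)) → M ≤ B) :
    Does E S (bodyCmd fair) s (bodyTime n (64 * (k * e)) B T) fun s' => Config pt F k e ε b s' ∧
      (∀ y, Beat s y → Beat s' y) ∧
      ∀ 𝒞, IsSolution F k 𝒞 → cost 𝒞 ≤ g → Beat s' (cost 𝒞 + 5 * k * (ε * g / (k * 32))) := by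
  set L := 64 * (k * e) with hLdef
  obtain ⟨δ, hδ⟩ : ∃ δ, δ = ε * g / (k * 32) := ⟨_, rfl⟩
  rw [← hδ] at hB ⊢
  have hδ0 : 0 ≤ δ := by rw [hδ]; have := hS.eps_pos.le; positivity
  refine Does.opsSeq 4 (n * (12 * B + 30) + 5 ^ L * (roundTime n L B T + 1) + 16) (by simp)
    (by simp) ?_ (by rw [bodyTime]; omega)
  have edel : (runAll E [.mulR .del .eps .g, .divR .del .del .krr] s).r .del = δ := by
    simp [hs.r_eps, hg, hs.krr, hδ]
  have f₀ := Frame.ops E [.mulR .del .eps .g, .divR .del .del .krr] s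
  generalize runAll E [.mulR .del .eps .g, .divR .del .del .krr] s = s₀ at edel f₀ ⊢
  refine Does.seq (n * (12 * B + 30) + 5) (5 ^ L * (roundTime n L B T + 1) + 5)
    (netCmd_spec ((f₀.v .n rfl).trans hs.v_n) edel hδ0 hS.n_le
      (by rw [hS.dist]; exact ptDist_self pt) (by rw [hS.dist]; exact hB)) ?_
  rintro s₁ f₁ ⟨hnet, hMB⟩
  rw [hS.dist] at hnet
  refine Does.opsSeq 4 (5 ^ L * (roundTime n L B T + 1) + 1) (by simp) (by simp) ?_
  have edone : (runAll E [.constN .done 0, .constN .zero 0] s₁).v .done = 0 := by simp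
  have ezero : (runAll E [.constN .done 0, .constN .zero 0] s₁).v .zero = 0 := by simp
  have f₂ := Frame.ops E [.constN .done 0, .constN .zero 0] s₁
  generalize runAll E [.constN .done 0, .constN .zero 0] s₁ = s₂ at edone ezero f₂ ⊢
  have enet : s₂.a .net = s₁.a .net := f₂.a .net rfl
  have easg : s₂.a .asg = s₁.a .asg := f₂.a .asg rfl
  obtain ⟨M, hM⟩ : ∃ M, M = s₂.v .m := ⟨_, rfl⟩
  rw [← f₂.v .m rfl, ← hM] at hMB hnet
  rw [← enet, ← easg] at hnet
  have edig : s₂.a .dig = s.a .dig :=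
    ((f₂.a .dig rfl).trans (f₁.a .dig rfl)).trans (f₀.a .dig rfl)
  have efound : s₂.v .found = s.v .found :=
    ((f₂.v .found rfl).trans (f₁.v .found rfl)).trans (f₀.v .found rfl)
  have ebest : s₂.r .best = s.r .best :=
    ((f₂.r .best rfl).trans (f₁.r .best rfl)).trans (f₀.r .best rfl)
  have hblab : s₂.a .blab = s.a .blab :=
    ((f₂.a .blab rfl).trans (f₁.a .blab rfl)).trans (f₀.a .blab rfl)
  have en : s₂.v .n = n := (((f₂.v .n rfl).trans (f₁.v .n rfl)).trans (f₀.v .n rfl)).trans hs.v_n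
  have ek : s₂.v .k = k := (((f₂.v .k rfl).trans (f₁.v .k rfl)).trans (f₀.v .k rfl)).trans hs.v_k
  have eb : s₂.r .b = b := (((f₂.r .b rfl).trans (f₁.r .b rfl)).trans (f₀.r .b rfl)).trans hs.r_b
  have el : s₂.v .len = L :=
    (((f₂.v .len rfl).trans (f₁.v .len rfl)).trans (f₀.v .len rfl)).trans hs.len
  have edel' : s₂.r .del = δ := ((f₂.r .del rfl).trans (f₁.r .del rfl)).trans edel
  have eeps : s₂.r .eps = ε :=
    (((f₂.r .eps rfl).trans (f₁.r .eps rfl)).trans (f₀.r .eps rfl)).trans hs.r_eps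
  have ekrr : s₂.r .krr = k * 32 :=
    (((f₂.r .krr rfl).trans (f₁.r .krr rfl)).trans (f₀.r .krr rfl)).trans hs.krr
  set st := fun dig => decode (ptDist pt) (s₂.a .net) M δ dig L with hst
  -- After `v` rounds the counter shows `v`, with `done` as the digit of weight `5 ^ L`. Hence there
  -- are exactly `5 ^ L` rounds, and every string of value below `v` has been tried.
  refine Does.loop (5 ^ L) (roundTime n L B T) (fun v t => (∀ i, t.a .dig i < 5) ∧
    (∀ i, L ≤ i → t.a .dig i = 0) ∧ t.v .zero = 0 ∧ (t.v .done = 0 ∨ t.v .done = 1) ∧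
    digVal (t.a .dig) L + t.v .done * 5 ^ L = v ∧ Best pt F k t ∧ (∀ y, Beat s y → Beat t y) ∧
    ∀ dig : ℕ → ℕ, (∀ i, dig i < 5) → (∀ i, L ≤ i → dig i = 0) → digVal dig L < v →
      Feasible pt F k (s₂.a .asg) (st dig) → Beat t (st dig).ub) ?_ ?_ ?_ le_rfl
  · rw [edig]
    refine ⟨fun i => by simp [hs.dig], fun i _ => hs.dig i, ezero, Or.inl edone, ?_,
      hs.best.congr efound ebest hblab, fun y hy => hy.congr efound ebest, fun _ _ _ h => by omega⟩
    simp [digVal, hs.dig, edone]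
  · rintro v t hv hf ⟨h1, h2, h3, h4, h5, h6, h7, h8⟩
    have hd0 : t.v .done = 0 := by
      rcases h4 with h | h
      · exact h
      · rw [h] at h5; omega
    have hv' : digVal (t.a .dig) L = v := by simpa [hd0] using h5
    have enet' : t.a .net = s₂.a .net := hf.a .net (by cases fair <;> rfl)
    have easg' : t.a .asg = s₂.a .asg := hf.a .asg (by cases fair <;> rfl)
    refine ⟨by simp [h3, hd0], ?_⟩
    refine (roundCmd_spec hS ((hf.v .n (by cases fair <;> rfl)).trans en)
      ((hf.v .k (by cases fair <;> rfl)).trans ek) ((hf.r .b (by cases fair <;> rfl)).trans eb)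
      ((hf.v .len (by cases fair <;> rfl)).trans el)
      ((hf.v .m (by cases fair <;> rfl)).trans hM.symm) hMB
      ((hf.r .del (by cases fair <;> rfl)).trans edel') hδ0 (by rwa [enet', easg']) h6 h1 h2).mono
      le_rfl ?_
    rintro t' hf' ⟨k1, k2, k3, k4, k5, k6, k7, k8⟩
    rw [enet', easg'] at k3
    refine ⟨k4, k5, k6, k7, by rw [k8, hv'], k1, fun y hy => k2 y (h7 y hy), ?_⟩
    intro dig hd hz hlt hfeas
    rcases Nat.lt_succ_iff_lt_or_eq.1 hlt with h | h
    · exact k2 _ (h8 dig hd hz h hfeas)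
    · have hdig : dig = t.a .dig := by
        funext i
        by_cases hi : i < L
        · exact digVal_inj hd h1 (h.trans hv'.symm) i hi
        · rw [hz i (by omega), h2 i (by omega)]
      rw [hdig] at hfeas ⊢
      exact k3 hfeas
  · rintro t hf ⟨h1, h2, h3, h4, h5, h6, h7, h8⟩
    have hlt := digVal_lt h1 L
    have hd1 : t.v .done = 1 := by
      rcases h4 with h | h
      · rw [h] at h5; omega
      · exact h
    -- The overflow resets all digits to zero, as the next scale requires.
    have hv0 : digVal (t.a .dig) L = digVal (fun _ => 0) L := by
      simp [hd1] at h5; simpa [digVal] using h5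
    refine ⟨by simp [h3, hd1], ⟨(hf.v .n (by cases fair <;> rfl)).trans en,
      (hf.v .k (by cases fair <;> rfl)).trans ek, (hf.r .eps (by cases fair <;> rfl)).trans eeps,
      (hf.r .b (by cases fair <;> rfl)).trans eb, (hf.r .krr (by cases fair <;> rfl)).trans ekrr,
      (hf.v .len (by cases fair <;> rfl)).trans el, fun i => ?_, h6⟩, h7, fun 𝒞 hC hcost => ?_⟩
    · by_cases hi : i < L
      · exact digVal_inj h1 (fun _ => by omega) hv0 i hi
      · exact h2 i (by omega)
    · obtain ⟨dig, d1, d2, d3, d4, d5, d6⟩ := hnet.exists_digits hS.n_pos hS.eps_pos hS.e_pos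
        hS.e_spec hS.k_pos hδ hC.1 hcost
      exact (h8 dig d1 d2 (digVal_lt d1 L) ⟨d3, d4, fun ℓ hℓ =>
        (hC.of_le hS.mergeable (d6 ℓ hℓ)).2⟩).mono d5

end Programs

section Programs

variable {E : Env} {S : ℕ} {X : Type*} [Fintype X] [DecidableEq X] [MetricSpace X] {n : ℕ}

/-! ### All scales -/

def scalesCmd (fair : Bool) : Cmd :=
  .ops [.load .c .cen .i1, .load .c2 .cen .i2, .dist .y .c .c2, .addR .g .rad .y] ;;
  forUp .l .kp2 (bodyCmd fair ;; .ops [.addR .g .g .g])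

def searchCmd (fair : Bool) : Cmd := forUp .i1 .k (forUp .i2 .k (scalesCmd fair))

/-- At scale `g` every solution has been beaten. -/
def Hit (F : Clustering X → Prop) (k : ℕ) (ε g : ℝ) (s : HState) : Prop :=
  ∀ 𝒞, IsSolution F k 𝒞 → cost 𝒞 ≤ g → Beat s (cost 𝒞 + 5 * k * (ε * g / (k * 32)))

theorem Hit.of_beat {F : Clustering X → Prop} {k : ℕ} {ε g : ℝ} {s s' : HState}
    (h : Hit F k ε g s) (hs : ∀ y, Beat s y → Beat s' y) : Hit F k ε g s' :=
  fun 𝒞 hC hg => hs _ (h 𝒞 hC hg)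

def scalesTime (n k L B T : ℕ) : ℕ := (k + 2) * (bodyTime n L B T + 5) + 11

def searchTime (n k L B T : ℕ) : ℕ := k * (k * (scalesTime n k L B T + 3) + 6) + 3

theorem Config.setN {pt : Fin n ≃ X} {F : Clustering X → Prop} {k e : ℕ} {ε b : ℝ} {s : HState}
    (h : Config pt F k e ε b s) {x : NReg} (v : ℕ) (h1 : x ≠ .n) (h2 : x ≠ .k) (h3 : x ≠ .len)
    (h4 : x ≠ .found) : Config pt F k e ε b (s.setN x v) :=
  ⟨by simp [h1.symm, h.v_n], by simp [h2.symm, h.v_k], h.r_eps, h.r_b, h.krr,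
    by simp [h3.symm, h.len], h.dig, h.best.congr (by simp [h4.symm]) rfl rfl⟩

theorem Beat.setN_iff {s : HState} {y : ℝ} {x : NReg} (v : ℕ) (h : x ≠ .found) :
    Beat (s.setN x v) y ↔ Beat s y := by
  simp [Beat, h.symm]

theorem Hit.setN {F : Clustering X → Prop} {k : ℕ} {ε g : ℝ} {s : HState}
    (h : Hit F k ε g s) {x : NReg} (v : ℕ) (hx : x ≠ .found) : Hit F k ε g (s.setN x v) :=
  h.of_beat fun _ hy => (Beat.setN_iff v hx).2 hy

section

variable {fair : Bool} {pt : Fin n ≃ X} {F : Clustering X → Prop} {k e T B : ℕ} {ε b R : ℝ}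
  {cen : ℕ → ℕ} {s : HState}

theorem scalesCmd_spec (hS : Setup E S fair pt F k e ε b T) (hs : Config pt F k e ε b s)
    (hR0 : 0 ≤ R)
    (hB : ∀ g, R ≤ g → ∀ (M : ℕ) (net : ℕ → ℕ), (∀ u < M, net u < n) →
      (∀ u < M, ∀ w < u, ε * g / (k * 32) < ptDist pt (net u) (net w)) → M ≤ B)
    (hcen : s.a .cen = cen) (hR : s.r .rad = R) (hkp2 : s.v .kp2 = k + 2) {i j : ℕ}
    (hi : s.v .i1 = i) (hj : s.v .i2 = j) (hik : i < k) (hjk : j < k) :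
    Does E S (scalesCmd fair) s (scalesTime n k (64 * (k * e)) B T) fun s' =>
      Config pt F k e ε b s' ∧ (∀ y, Beat s y → Beat s' y) ∧
      ∀ l < k + 2, Hit F k ε ((R + ptDist pt (cen i) (cen j)) * 2 ^ l) s' := by
  have hkS := hS.k_lt
  refine Does.opsSeq 8 ((k + 2) * (bodyTime n (64 * (k * e)) B T + 5) + 3) (by simp; omega)
    (by simp) ?_ (by rw [scalesTime]; omega)
  refine Does.forUp (bodyTime n (64 * (k * e)) B T + 2) (fun l t => Config pt F k e ε b t ∧
    (∀ y, Beat s y → Beat t y) ∧ t.r .g = (R + ptDist pt (cen i) (cen j)) * 2 ^ l ∧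
    ∀ l' < l, Hit F k ε ((R + ptDist pt (cen i) (cen j)) * 2 ^ l') t)
    (by cases fair <;> exact ⟨rfl, rfl⟩) ?_ ?_ ?_ ?_
  · refine ⟨⟨by simp [hs.v_n], by simp [hs.v_k], by simp [hs.r_eps], by simp [hs.r_b],
      by simp [hs.krr], by simp [hs.len], by simpa using hs.dig,
      hs.best.congr (by simp) (by simp) (by simp)⟩, fun y hy => hy.congr (by simp) (by simp), ?_,
      fun _ h => by omega⟩
    simp [hi, hj, hcen, hR, hS.dist]
  · rintro l t hl hl' hf ⟨h1, h2, h3, h4⟩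
    have hd := ptDist_nonneg pt (cen i) (cen j)
    have hpow : (1 : ℝ) ≤ 2 ^ l := one_le_pow₀ (by norm_num)
    have hRg : R ≤ (R + ptDist pt (cen i) (cen j)) * 2 ^ l := by nlinarith
    refine Does.seq (bodyTime n (64 * (k * e)) B T) 2
      (bodyCmd_spec hS h1 h3 (hR0.trans hRg) (hB _ hRg)) ?_
    rintro t' hf' ⟨k1, k2, k3⟩
    have hg' : t'.r .g = t.r .g := hf'.r .g (by cases fair <;> rfl)
    have hbeat : ∀ y, Beat t' y → Beat ((runAll E [.addR .g .g .g] t').setN .l (l + 1)) y :=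
      fun y hy => (Beat.setN_iff _ (by decide)).2 (hy.congr (by simp) (by simp))
    refine Does.ops (by simp) (by simp) ⟨?_, fun y hy => hbeat y (k2 y (h2 y hy)), ?_,
      fun l' hl' => ?_⟩
    · refine Config.setN ?_ _ (by decide) (by decide) (by decide) (by decide)
      exact ⟨by simp [k1.v_n], by simp [k1.v_k], by simp [k1.r_eps], by simp [k1.r_b],
        by simp [k1.krr], by simp [k1.len], by simpa using k1.dig,
        k1.best.congr (by simp) (by simp) (by simp)⟩
    · simp [hg', h3]
      ring
    · rcases Nat.lt_succ_iff_lt_or_eq.1 hl' with h | rfl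
      · exact (h4 l' h).of_beat fun y hy => hbeat y (k2 y hy)
      · exact Hit.of_beat k3 hbeat
  · rintro t hf ⟨h1, h2, -, h4⟩
    rw [show (runAll E [.load .c .cen .i1, .load .c2 .cen .i2, .dist .y .c .c2, .addR .g .rad .y]
      s).v .kp2 = k + 2 by simp [hkp2]] at h4
    exact ⟨h1, h2, h4⟩
  · simp [hkp2]

theorem searchCmd_spec (hS : Setup E S fair pt F k e ε b T) (hs : Config pt F k e ε b s)
    (hB : ∀ g, R ≤ g → ∀ (M : ℕ) (net : ℕ → ℕ), (∀ u < M, net u < n) →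
      (∀ u < M, ∀ w < u, ε * g / (k * 32) < ptDist pt (net u) (net w)) → M ≤ B)
    (hcen : s.a .cen = cen) (hR : s.r .rad = R) (hkp2 : s.v .kp2 = k + 2)
    (hcR : Centers (ptDist pt) n k cen R) :
    Does E S (searchCmd fair) s (searchTime n k (64 * (k * e)) B T) fun s' =>
      Best pt F k s' ∧ ∀ 𝒞, IsSolution F k 𝒞 → Beat s' ((1 + ε) * cost 𝒞) := by
  refine Does.forUp (k * (scalesTime n k (64 * (k * e)) B T + 3) + 3)
    (fun i t => Config pt F k e ε b t ∧ ∀ i' < i, ∀ j < k, ∀ l < k + 2,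
      Hit F k ε ((R + ptDist pt (cen i') (cen j)) * 2 ^ l) t)
    (by cases fair <;> exact ⟨rfl, rfl⟩) ?_ ?_ ?_ ?_
  · exact ⟨hs.setN _ (by decide) (by decide) (by decide) (by decide), fun _ h => by omega⟩
  · rintro i t hi hi' hf ⟨h1, h2⟩
    rw [hs.v_k] at hi
    refine Does.forUp (scalesTime n k (64 * (k * e)) B T)
      (fun j t' => Config pt F k e ε b t' ∧ (∀ y, Beat t y → Beat t' y) ∧
        ∀ j' < j, ∀ l < k + 2, Hit F k ε ((R + ptDist pt (cen i) (cen j')) * 2 ^ l) t')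
      (by cases fair <;> exact ⟨rfl, rfl⟩) ?_ ?_ ?_ ?_
    · exact ⟨h1.setN _ (by decide) (by decide) (by decide) (by decide),
        fun y hy => (Beat.setN_iff _ (by decide)).2 hy, fun _ h => by omega⟩
    · rintro j t' hj hj' hf' ⟨k1, k2, k3⟩
      rw [h1.v_k] at hj
      refine (scalesCmd_spec hS k1 hcR.nonneg hB
        (((hf'.a .cen (by cases fair <;> rfl)).trans (hf.a .cen (by cases fair <;> rfl))).trans hcen)
        (((hf'.r .rad (by cases fair <;> rfl)).trans (hf.r .rad (by cases fair <;> rfl))).trans hR)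
        (((hf'.v .kp2 (by cases fair <;> rfl)).trans
          (hf.v .kp2 (by cases fair <;> rfl))).trans hkp2)
        ((hf'.v .i1 (by cases fair <;> rfl)).trans hi') hj' hi hj).mono le_rfl ?_
      rintro t'' - ⟨m1, m2, m3⟩
      refine ⟨m1.setN _ (by decide) (by decide) (by decide) (by decide),
        fun y hy => (Beat.setN_iff _ (by decide)).2 (m2 y (k2 y hy)), fun j'' hj'' l hl => ?_⟩
      refine Hit.setN ?_ _ (by decide)
      rcases Nat.lt_succ_iff_lt_or_eq.1 hj'' with h | rfl
      · exact (k3 j'' h l hl).of_beat m2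
      · exact m3 l hl
    · rintro t' hf' ⟨k1, k2, k3⟩
      rw [h1.v_k] at k3
      refine ⟨k1.setN _ (by decide) (by decide) (by decide) (by decide), fun i'' hi'' j hj l hl => ?_⟩
      refine Hit.setN ?_ _ (by decide)
      rcases Nat.lt_succ_iff_lt_or_eq.1 hi'' with h | rfl
      · exact (h2 i'' h j hj l hl).of_beat k2
      · exact k3 j hj l hl
    · rw [h1.v_k]
  · rintro t hf ⟨h1, h2⟩
    rw [hs.v_k] at h2
    refine ⟨h1.best, fun 𝒞 hC => ?_⟩
    have hn1 := hS.n_pos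
    have hk1 : (1 : ℝ) ≤ k := by exact_mod_cast hS.k_pos
    let c : ℕ → X := fun i => if h : cen i < n then pt ⟨cen i, h⟩ else pt ⟨0, hn1⟩
    have hc : ∀ i ≤ k, pt.symm (c i) = cen i := fun i hi => by
      simp [c, hcR.lt i hi]
    have hdist : ∀ i ≤ k, ∀ j ≤ k, dist (c i) (c j) = ptDist pt (cen i) (cen j) :=
      fun i hi j hj => by rw [← ptDist_symm pt, hc i hi, hc j hj]
    obtain ⟨i, hi, j, hj, l, hl, hg1, hg2⟩ := exists_scale hC.1 hcR.nonneg (c := c)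
      (fun x => by
        obtain ⟨i, hi, h⟩ := hcR.cover _ (pt.symm x).2
        exact ⟨i, hi, by rwa [← ptDist_symm pt, hc i hi.le]⟩)
      (fun j hj i hi => by
        rw [hdist j hj i (by omega)]
        exact hcR.sep j hj i hi)
    rw [hdist i hi.le j hj.le] at hg1 hg2
    refine (h2 i hi j hj l hl 𝒞 hC hg1).mono ?_
    generalize (R + ptDist pt (cen i) (cen j)) * 2 ^ l = g at hg1 hg2
    -- As `g ≤ 4 * cost 𝒞`, the surplus is at most `20 / 32 * ε * cost 𝒞`.
    have e1 : 5 * (k : ℝ) * (ε * g / (k * 32)) = ε * (5 / 32 * g) := by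
      field_simp
    rw [e1, add_mul, one_mul]
    have := hS.eps_pos
    have := cost_nonneg 𝒞
    gcongr
    linarith
  · rw [hs.v_k, searchTime]

end

/-! ### Preparation -/

/-- Natural numbers cannot be multiplied, so `k * e` is a sum of `k` copies of `e`, and six
doublings supply the factor 64. The exponent `e` is found by doubling `eps` until it reaches `1`. -/
def prepCmd : Cmd :=
  .ops [.constN .e 1, .constR .z 1, .addR .y .eps .eps] ;;
  .loop (.ltR .y .z) (.ops [.addR .y .y .y, .inc .e]) ;;
  .ops [.constN .len 0] ;;
  forUp .i1 .k (.ops [.addN .len .len .e]) ;;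
  .ops [.addN .len .len .len, .addN .len .len .len, .addN .len .len .len, .addN .len .len .len,
    .addN .len .len .len, .addN .len .len .len, .castR .krr .k, .constR .q1 32,
    .mulR .krr .krr .q1, .constN .found 0, .copyN .kp2 .k, .inc .kp2, .inc .kp2] ;;
  centersCmd

theorem prepCmd_spec {pt : Fin n ≃ X} {F : Clustering X → Prop} {k e : ℕ} {ε b : ℝ} {s : HState}
    (he : IsLeast {e : ℕ | 1 ≤ e ∧ 1 ≤ 2 ^ e * ε} e) (hE : E.dist = ptDist pt) (hn1 : 1 ≤ n)
    (hk1 : 1 ≤ k) (hkS : k < S) (hn : s.v .n = n) (hk : s.v .k = k) (hε : s.r .eps = ε)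
    (hb : s.r .b = b) (hd : ∀ i, s.a .dig i = 0) :
    Does E S prepCmd s (k * (n * (10 * k + 40) + 40) + e * 10 + 100) fun s' =>
      Config pt F k e ε b s' ∧ s'.v .kp2 = k + 2 ∧
      Centers (ptDist pt) n k (s'.a .cen) (s'.r .rad) := by
  obtain ⟨⟨he1, he2⟩, hmin⟩ := he
  refine Does.opsSeq 6 (k * (n * (10 * k + 40) + 40) + e * 10 + 90) (by simp) (by simp) ?_
  refine Does.seq (e * 10 + 1) (k * (n * (10 * k + 40) + 40) + 80) (R := fun t => t.v .e = e) ?_ ?_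
  · refine Does.loop (e - 1) 4 (fun i t => t.v .e = i + 1 ∧ t.r .y = 2 ^ (i + 1) * ε) ?_ ?_ ?_ ?_
    · simp [hε]; ring
    · rintro i t hi hf ⟨h1, h2⟩
      have hz : t.r .z = 1 := (hf.r .z rfl).trans (by simp)
      refine ⟨?_, Does.ops (by simp) (by simp) ?_⟩
      · by_contra h
        simp only [HTest.holds, hz, h2, not_lt] at h
        have := hmin (show i + 1 ∈ {e : ℕ | 1 ≤ e ∧ 1 ≤ 2 ^ e * ε} from ⟨by omega, h⟩)
        omega
      · simp [h1, h2]; ring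
    · rintro t hf ⟨h1, h2⟩
      have hz : t.r .z = 1 := (hf.r .z rfl).trans (by simp)
      rw [Nat.sub_add_cancel he1] at h1 h2
      exact ⟨by simpa [hz, h2] using he2, h1⟩
    · omega
  intro s₁ f₁ h₁
  have e₁ : s₁.v .k = k := (f₁.v .k rfl).trans (by simp [hk])
  refine Does.opsSeq 2 (k * (n * (10 * k + 40) + 40) + 70) (by simp) (by simp) ?_
  refine Does.seq (k * 5 + 3) (k * (n * (10 * k + 40) + 30) + 50) (R := fun t => t.v .len = k * e)
    ?_ ?_ (by ring_nf; omega)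
  · refine Does.forUp 2 (fun i t => t.v .len = i * e) ⟨rfl, rfl⟩ (by simp) ?_ ?_ ?_
    · rintro i t hi hi' hf h
      have : t.v .e = e := (hf.v .e rfl).trans (by simp [h₁])
      refine Does.ops (by simp) (by simp) ?_
      simp [h, this]; ring
    · rintro t - h
      simpa [e₁] using h
    · simp [e₁]
  intro s₂ f₂ h₂
  refine Does.opsSeq 26 (k * (n * (10 * k + 40) + 30) + 20) (by simp) (by simp) ?_
  have en : s₂.v .n = n := ((f₂.v .n rfl).trans (by simp)).trans ((f₁.v .n rfl).trans (by simp [hn]))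
  have ek : s₂.v .k = k := ((f₂.v .k rfl).trans (by simp)).trans ((f₁.v .k rfl).trans (by simp [hk]))
  have eε : s₂.r .eps = ε :=
    ((f₂.r .eps rfl).trans (by simp)).trans ((f₁.r .eps rfl).trans (by simp [hε]))
  have eb : s₂.r .b = b := ((f₂.r .b rfl).trans (by simp)).trans ((f₁.r .b rfl).trans (by simp [hb]))
  have ed : ∀ i, s₂.a .dig i = 0 := by
    rw [((f₂.a .dig rfl).trans (by simp)).trans (f₁.a .dig rfl)]
    simpa using hd
  refine (centersCmd_spec (by simp [en]) hn1 (by simp [ek]) hk1 hkS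
    (by rw [hE]; exact ptDist_nonneg pt)).mono le_rfl ?_
  intro s₃ f₃ h₃
  rw [hE] at h₃
  refine ⟨⟨(f₃.v .n rfl).trans (by simp [en]), (f₃.v .k rfl).trans (by simp [ek]),
    (f₃.r .eps rfl).trans (by simp [eε]), (f₃.r .b rfl).trans (by simp [eb]),
    (f₃.r .krr rfl).trans (by simp [ek]), (f₃.v .len rfl).trans (by simp [h₂]; ring),
    ?_, ?_⟩, (f₃.v .kp2 rfl).trans (by simp [ek]), h₃⟩
  · rw [f₃.a .dig rfl]; simpa using ed
  · have : s₃.v .found = 0 := (f₃.v .found rfl).trans (by simp)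
    exact ⟨Or.inl this, fun h => by omega⟩

end Programs

section Programs

variable {E : Env} {S : ℕ} {X : Type*} [Fintype X] [DecidableEq X] [MetricSpace X] {n : ℕ}

/-! ### The whole program -/

/-- A space with one point is treated as if `k = 1` and `ε = 1 / 2`. -/
def smallCmd : Cmd :=
  .ops [.constN .tc 2] ;;
  .ite (.ltN .n .tc) (.ops [.constN .k 1, .constR .y 1, .constR .z 2, .divR .eps .y .z]) .skip

def mainCmd (fair : Bool) : Cmd := smallCmd ;; prepCmd ;; searchCmd fair

theorem smallCmd_spec {s : HState} : Does E S smallCmd s 20 fun s' =>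
    s'.v .k = (if s.v .n < 2 then 1 else s.v .k) ∧
    s'.r .eps = if s.v .n < 2 then 1 / 2 else s.r .eps := by
  refine Does.opsSeq 2 10 (by simp) (by simp) ?_
  refine Does.ite 9 (fun h => Does.ops (by simp) (by simp) ?_) (fun h => Does.skip ?_)
  · simp at h
    simp [h]
  · simp at h
    have h' : ¬ s.v .n < 2 := by omega
    simp only [if_neg h', and_self, HState.setN, runAll, Instr.run]
    simp

def mainTime (n k e B T : ℕ) : ℕ :=
  k * (n * (10 * k + 40) + 40) + e * 10 + 120 + searchTime n k (64 * (k * e)) B T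

theorem mainCmd_spec {fair : Bool} {pt : Fin n ≃ X} {F : Clustering X → Prop} {k e T B : ℕ}
    {ε b : ℝ} (hS : Setup E S fair pt F k e ε b T)
    (he : IsLeast {e : ℕ | 1 ≤ e ∧ 1 ≤ 2 ^ e * ε} e)
    (hB : ∀ g R cen, Centers (ptDist pt) n k cen R → R ≤ g → ∀ (M : ℕ) (net : ℕ → ℕ),
      (∀ u < M, net u < n) →
      (∀ u < M, ∀ w < u, ε * g / (k * 32) < ptDist pt (net u) (net w)) → M ≤ B)
    {s : HState} (hn : s.v .n = n) (hk : k = if n < 2 then 1 else s.v .k)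
    (hε : ε = if n < 2 then 1 / 2 else s.r .eps) (hb : s.r .b = b) (hd : ∀ i, s.a .dig i = 0) :
    Does E S (mainCmd fair) s (mainTime n k e B T) fun s' =>
      Best pt F k s' ∧ ∀ 𝒞, IsSolution F k 𝒞 → Beat s' ((1 + ε) * cost 𝒞) := by
  refine Does.seq 20 (k * (n * (10 * k + 40) + 40) + e * 10 + 100 +
    searchTime n k (64 * (k * e)) B T) smallCmd_spec ?_ (by rw [mainTime]; omega)
  rintro s₁ f₁ ⟨h1, h2⟩
  rw [hn] at h1 h2
  refine Does.seq _ _ (prepCmd_spec (F := F) he hS.dist hS.n_pos hS.k_pos hS.k_lt ((f₁.v .n rfl).trans hn)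
    (h1.trans hk.symm) (h2.trans hε.symm) ((f₁.r .b rfl).trans hb)
    (by rwa [f₁.a .dig rfl])) ?_ le_rfl
  rintro s₂ - ⟨h3, h4, h5⟩
  exact searchCmd_spec hS h3 (fun g => hB g _ _ h5) rfl rfl h4 h5

/-! ### Memory layout -/

/-- Store the base addresses of the arrays. -/
def prologue : List Op :=
  [.constN (.dir 61) 1, .addN (.dir 61) (.dir 61) (.dir 0), .addN (.dir 61) (.dir 61) (.dir 1),
    .constN (.dir 48) 64, .addN (.dir 49) (.dir 48) (.dir 61), .addN (.dir 50) (.dir 49) (.dir 61),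
    .addN (.dir 51) (.dir 50) (.dir 61), .addN (.dir 52) (.dir 51) (.dir 61),
    .addN (.dir 53) (.dir 52) (.dir 61), .addN (.dir 54) (.dir 53) (.dir 61)]

def epilogue : List Op :=
  [.copyN (.dir 1) Arr.blab.baseRef, .copyN (.dir 0) NReg.found.ref]

def program (fair : Bool) : Prog :=
  .seq (opsProg prologue) (.seq (mainCmd fair).code (opsProg epilogue))

/-- The contents of the registers and arrays in the memory `σ`. -/
def readState (S : ℕ) (σ : State) : HState where
  v x := σ.nat x.ctorIdx
  r x := σ.real x.ctorIdx
  a A i := σ.nat (A.addr S i)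

theorem rep_readState {S : ℕ} {σ : State}
    (h : ∀ A : Arr, σ.nat (48 + A.ctorIdx) = A.addr S 0) : Rep S σ (readState S σ) :=
  ⟨fun _ => rfl, fun _ => rfl, fun _ _ _ => rfl, h⟩

theorem prologue_spec (E : Env) (n k : ℕ) (ε b : ℝ) :
    ∃ σ, Exec E (opsProg prologue) (initState n k ε b) 10 σ ∧
      (∀ A : Arr, σ.nat (48 + A.ctorIdx) = A.addr (n + k + 1) 0) ∧ σ.nat 0 = n ∧ σ.nat 1 = k ∧
      σ.real 0 = ε ∧ σ.real 1 = b ∧ ∀ a, 64 ≤ a → σ.nat a = 0 := by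
  refine ⟨_, exec_opsProg E prologue (initState n k ε b), fun A => ?_, ?_, ?_, ?_, ?_,
    fun a ha => ?_⟩
  · cases A <;> simp [prologue, Op.apply, State.setN, State.getN, Ref.addr, initState, Arr.addr,
      Arr.ctorIdx, Function.update_apply] <;> ring
  · simp [prologue, Op.apply, State.setN, State.getN, Ref.addr, initState, Function.update_apply]
  · simp [prologue, Op.apply, State.setN, State.getN, Ref.addr, initState, Function.update_apply]
  · simp [prologue, Op.apply, State.setN, State.getN, Ref.addr, initState, Function.update_apply]
  · simp [prologue, Op.apply, State.setN, State.getN, Ref.addr, initState, Function.update_apply]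
  · have h : ∀ c < 64, a ≠ c := fun c hc => by omega
    simp [prologue, Op.apply, State.setN, State.getN, Ref.addr, initState, Function.update_apply, h]

theorem epilogue_spec (E : Env) {S : ℕ} {σ : State} {s : HState} (h : Rep S σ s) :
    ∃ σ', Exec E (opsProg epilogue) σ 2 σ' ∧ σ'.nat 0 = s.v .found ∧
      ∀ i < S, σ'.nat (σ'.nat 1 + i) = s.a .blab i := by
  refine ⟨_, exec_opsProg E epilogue σ, ?_, fun i hi => ?_⟩
  · have := h.v .found
    simp [epilogue, Op.apply, State.setN, State.getN, Ref.addr, Arr.baseRef, NReg.ref,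
      Function.update_apply, NReg.ctorIdx] at this ⊢
    exact this
  · have h1 := h.base .blab
    have h2 := h.a .blab i (Or.inr hi)
    have h3 : Arr.blab.addr S i ≠ 0 ∧ Arr.blab.addr S i ≠ 1 := by unfold Arr.addr; omega
    have h4 : Arr.blab.addr S 0 + i = Arr.blab.addr S i := by simp [Arr.addr]
    simp [epilogue, Op.apply, State.setN, State.getN, Ref.addr, Arr.baseRef, NReg.ref,
      Function.update_apply, NReg.ctorIdx, h1, h4, h2, h3]

theorem program_oracleFree : (program true).OracleFree :=
  ⟨by simp [prologue, opsProg, Prog.OracleFree], Cmd.oracleFree _ rfl,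
    by simp [epilogue, opsProg, Prog.OracleFree]⟩

/-- `k₀` and `ε₀` are the input values, `k` and `ε` those in force after the one-point case has been
normalised. The memory layout is fixed before that and depends on `k₀`. -/
theorem program_spec {fair : Bool} {pt : Fin n ≃ X} {F : Clustering X → Prop} {k k₀ e T B : ℕ}
    {ε ε₀ b : ℝ} (hS : Setup E (n + k₀ + 1) fair pt F k e ε b T) (hE : E.Local (n + k₀ + 1))
    (he : IsLeast {e : ℕ | 1 ≤ e ∧ 1 ≤ 2 ^ e * ε} e)
    (hB : ∀ g R cen, Centers (ptDist pt) n k cen R → R ≤ g → ∀ (M : ℕ) (net : ℕ → ℕ),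
      (∀ u < M, net u < n) →
      (∀ u < M, ∀ w < u, ε * g / (k * 32) < ptDist pt (net u) (net w)) → M ≤ B)
    (hk : k = if n < 2 then 1 else k₀) (hε : ε = if n < 2 then 1 / 2 else ε₀) :
    ∃ t σ, Exec E (program fair) (initState n k₀ ε₀ b) t σ ∧ Answers pt F k ε σ ∧
      t ≤ mainTime n k e B T + 12 := by
  obtain ⟨σ₁, h1, h2, h3, h4, h5, h6, h7⟩ := prologue_spec E n k₀ ε₀ b
  have hv0 : (readState (n + k₀ + 1) σ₁).v .n = n := h3
  have hv1 : (readState (n + k₀ + 1) σ₁).v .k = k₀ := h4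
  have hr0 : (readState (n + k₀ + 1) σ₁).r .eps = ε₀ := h5
  obtain ⟨t, σ₂, s₂, k1, k2, -, k3, k4, k5⟩ := mainCmd_spec hS he hB hv0 (by rw [hv1]; exact hk)
    (by rw [hr0]; exact hε) h6 (fun i => h7 _ (by unfold Arr.addr; omega)) hE σ₁ (rep_readState h2)
  obtain ⟨σ₃, m1, m2, m3⟩ := epilogue_spec E k2
  have hl : ofLabels pt (fun i => σ₃.nat (σ₃.nat 1 + i)) = ofLabels pt (s₂.a .blab) :=
    ofLabels_congr pt _ fun i hi => m3 i (by omega)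
  refine ⟨_, σ₃, .seq h1 (.seq k1 m1), ⟨?_, ?_⟩, by omega⟩
  · rintro ⟨𝒞, hC⟩
    rw [m2, hl]
    have hf := (k5 𝒞 hC).1
    obtain ⟨h8, h9⟩ := k4.2 hf
    exact ⟨hf, h8, fun 𝒞' hC' => h9.trans (k5 𝒞' hC').2⟩
  · intro hno
    rw [m2]
    rcases k4.1 with h | h
    · exact h
    · exact absurd ⟨_, (k4.2 h).1⟩ hno

end Programs

/-! ### Size of the net -/

section Bounds

variable {X : Type*} [Fintype X] [DecidableEq X] [MetricSpace X] {n : ℕ} (pt : Fin n ≃ X)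

/-- The `6 + k + e` halvings bring `2 * R` below `ε * g / (k * 32)`: six of them give `1 / 32`, `k`
of them the factor `1 / k`, and `e` of them the factor `ε`. -/
theorem Centers.card_separated_le {k e : ℕ} {ε g R : ℝ} {cen : ℕ → ℕ}
    (h : Centers (ptDist pt) n k cen R) (hε : 0 < ε) (hk : 1 ≤ k) (he : 1 ≤ 2 ^ e * ε)
    (hg : R ≤ g) {M : ℕ} {net : ℕ → ℕ} (hlt : ∀ u < M, net u < n)
    (hsep : ∀ u < M, ∀ w < u, ε * g / (k * 32) < ptDist pt (net u) (net w)) :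
    (M : ℝ) ≤ k * ((2 : ℝ) ^ doublingDim X) ^ (6 + k + e) := by
  rcases Nat.eq_zero_or_pos M with rfl | hM
  · rw [Nat.cast_zero]; positivity
  have hn : 0 < n := (Nat.zero_le _).trans_lt (hlt 0 hM)
  let c : ℕ → X := fun i => if h : cen i < n then pt ⟨cen i, h⟩ else pt ⟨0, hn⟩
  have hc : ∀ i ≤ k, pt.symm (c i) = cen i := fun i hi => by
    simp [c, h.lt i hi]
  refine separated_card_le hlt hsep h.nonneg (c := c) (fun x => ?_) ?_
  · obtain ⟨i, hi, h'⟩ := h.cover _ (pt.symm x).2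
    exact ⟨i, hi, by rwa [← ptDist_symm pt, hc i hi.le]⟩
  · have hk' : (1 : ℝ) ≤ k := by exact_mod_cast hk
    have hk2 : (k : ℝ) ≤ 2 ^ k := by exact_mod_cast Nat.lt_two_pow_self.le
    have h0 := h.nonneg
    have e1 : 2 * (R / 2 ^ (6 + k + e)) = R / 32 / (2 ^ k * 2 ^ e) := by
      rw [pow_add, pow_add]; field_simp; ring
    have e2 : ε * g / (k * 32) = (g / 32) * (ε / k) := by field_simp
    rw [e1, e2, div_eq_mul_inv]
    refine mul_le_mul (by gcongr) ?_ (by positivity) (by linarith)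
    rw [inv_eq_one_div, div_le_div_iff₀ (by positivity) (by positivity), one_mul]
    calc (k : ℝ) ≤ 2 ^ k * (2 ^ e * ε) := by nlinarith
      _ = ε * (2 ^ k * 2 ^ e) := by ring

end Bounds

/-! ### Running time -/

section Time

variable {n k e L B T : ℕ} {w N : ℝ}

theorem pow_mul_le (hw : 1 ≤ w) (hN : 1 ≤ N) {a c : ℕ} (h : a ≤ c) : w ^ a * N ≤ w ^ c * N := by
  gcongr

theorem pow_le_mul (hw : 1 ≤ w) (hN : 1 ≤ N) {a c : ℕ} (h : a ≤ c) : w ^ a ≤ w ^ c * N :=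
  (le_mul_of_one_le_right (by positivity) hN).trans (pow_mul_le hw hN h)

/-- Here and below `w` dominates every parameter except the number of points, and each monomial is
raised to the leading one. The 70 is the constant of the balancedness check. -/
theorem roundTime_le (hw : 1 ≤ w) (hN : 1 ≤ N) (hn : (n : ℝ) ≤ N) (hL : (L : ℝ) ≤ w)
    (hB : (B : ℝ) ≤ w) (hT : (T : ℝ) ≤ 70 * w * N) :
    ((roundTime n L B T : ℕ) : ℝ) ≤ 315 * (w ^ 3 * N) := by
  have a1 : ((roundTime n L B T : ℕ) : ℝ) ≤ w * (w * (20 * w + 40) + 60) + w * 5 + 20 +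
      (70 * w * N + N * 20 + 40) + (w * 20 + 20) := by
    rw [roundTime]; push_cast; gcongr
  have := pow_mul_le hw hN (a := 0) (c := 3) (by norm_num)
  have := pow_mul_le hw hN (a := 1) (c := 3) (by norm_num)
  have := pow_le_mul hw hN (a := 0) (c := 3) (by norm_num)
  have := pow_le_mul hw hN (a := 1) (c := 3) (by norm_num)
  have := pow_le_mul hw hN (a := 2) (c := 3) (by norm_num)
  have := pow_le_mul hw hN (a := 3) (c := 3) (by norm_num)
  linarith

theorem bodyTime_le (hw : 1 ≤ w) (hN : 1 ≤ N) (hn : (n : ℝ) ≤ N) (hL : (L : ℝ) ≤ w)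
    (hB : (B : ℝ) ≤ w) (h5 : (5 : ℝ) ^ L ≤ w) (hT : (T : ℝ) ≤ 70 * w * N) :
    ((bodyTime n L B T : ℕ) : ℝ) ≤ 378 * (w ^ 4 * N) := by
  have hround := roundTime_le hw hN hn hL hB hT
  have a1 : ((bodyTime n L B T : ℕ) : ℝ) ≤ N * (12 * w + 30) +
      w * (315 * (w ^ 3 * N) + 1) + 20 := by
    rw [bodyTime]; push_cast; gcongr
  have := pow_mul_le hw hN (a := 0) (c := 4) (by norm_num)
  have := pow_mul_le hw hN (a := 1) (c := 4) (by norm_num)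
  have := pow_le_mul hw hN (a := 0) (c := 4) (by norm_num)
  have := pow_le_mul hw hN (a := 1) (c := 4) (by norm_num)
  linarith

theorem searchTime_le (hw : 2 ≤ w) (hN : 1 ≤ N) (hn : (n : ℝ) ≤ N) (hk : (k : ℝ) ≤ w)
    (hL : (L : ℝ) ≤ w) (hB : (B : ℝ) ≤ w) (h5 : (5 : ℝ) ^ L ≤ w) (hT : (T : ℝ) ≤ 70 * w * N) :
    ((searchTime n k L B T : ℕ) : ℝ) ≤ 1172 * (w ^ 7 * N) := by
  have hw1 : 1 ≤ w := by linarith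
  have hbody := bodyTime_le hw1 hN hn hL hB h5 hT
  have hscales : ((scalesTime n k L B T : ℕ) : ℝ) ≤ 1160 * (w ^ 5 * N) := by
    have a1 : ((scalesTime n k L B T : ℕ) : ℝ) ≤ (w + w) * (378 * (w ^ 4 * N) + 5) + 11 := by
      rw [scalesTime]; push_cast; gcongr
    have := pow_le_mul hw1 hN (a := 0) (c := 5) (by norm_num)
    have := pow_le_mul hw1 hN (a := 1) (c := 5) (by norm_num)
    linarith
  have a1 : ((searchTime n k L B T : ℕ) : ℝ) ≤ w * (w * (1160 * (w ^ 5 * N) + 3) + 6) + 3 := by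
    rw [searchTime]; push_cast; gcongr
  have := pow_le_mul hw1 hN (a := 0) (c := 7) (by norm_num)
  have := pow_le_mul hw1 hN (a := 1) (c := 7) (by norm_num)
  have := pow_le_mul hw1 hN (a := 2) (c := 7) (by norm_num)
  linarith

theorem mainTime_le (hw : 2 ≤ w) (hN : 1 ≤ N) (hn : (n : ℝ) ≤ N) (hk : (k : ℝ) ≤ w)
    (he : (e : ℝ) ≤ w) (hL : ((64 * (k * e) : ℕ) : ℝ) ≤ w) (hB : (B : ℝ) ≤ w)
    (h5 : (5 : ℝ) ^ (64 * (k * e)) ≤ w) (hT : (T : ℝ) ≤ 70 * w * N) :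
    ((mainTime n k e B T + 12 : ℕ) : ℝ) ≤ w ^ 18 * N := by
  have hw1 : 1 ≤ w := by linarith
  have hsearch := searchTime_le hw hN hn hk hL hB h5 hT
  rw [mainTime]
  generalize searchTime n k (64 * (k * e)) B T = t at hsearch ⊢
  have a1 : ((k * (n * (10 * k + 40) + 40) + e * 10 + 120 + t + 12 : ℕ) : ℝ) ≤
      w * (N * (10 * w + 40) + 40) + w * 10 + 120 + 1172 * (w ^ 7 * N) + 12 := by
    push_cast; gcongr
  have := pow_mul_le hw1 hN (a := 1) (c := 7) (by norm_num)
  have := pow_mul_le hw1 hN (a := 2) (c := 7) (by norm_num)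
  have := pow_le_mul hw1 hN (a := 0) (c := 7) (by norm_num)
  have := pow_le_mul hw1 hN (a := 1) (c := 7) (by norm_num)
  -- All constants together stay below `2 ^ 11`, which is absorbed because `2 ≤ w`.
  calc _ ≤ 2 ^ 11 * (w ^ 7 * N) := by linarith
    _ ≤ w ^ 11 * (w ^ 7 * N) := by gcongr
    _ = w ^ 18 * N := by ring

end Time

/-- The main part is `5 ^ 64` strings at three scales. -/
theorem mainTime_one_le {T : ℕ} (hT : 1 ≤ T) : mainTime 1 1 1 1 T + 12 ≤ 10 ^ 58 * T := by
  simp only [mainTime, searchTime, scalesTime, bodyTime, roundTime]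
  norm_num
  omega

/-- By minimality `2 ^ (e - 1) ≤ 1 / ε`, and the remaining factor `2` is at most `1 / ε`. -/
theorem exists_isLeast_exponent {ε : ℝ} (hε : 0 < ε) (hε2 : ε ≤ 1 / 2) :
    ∃ e : ℕ, IsLeast {e : ℕ | 1 ≤ e ∧ 1 ≤ 2 ^ e * ε} e ∧ (2 : ℝ) ^ e ≤ (1 / ε) ^ 2 := by
  have ha : 2 ≤ 1 / ε := by rw [le_div_iff₀ hε]; linarith
  have hne : {e : ℕ | 1 ≤ e ∧ 1 ≤ 2 ^ e * ε}.Nonempty := by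
    obtain ⟨m, hm⟩ := pow_unbounded_of_one_lt (1 / ε) (one_lt_two : (1 : ℝ) < 2)
    refine ⟨m + 1, by omega, ?_⟩
    rw [div_lt_iff₀ hε] at hm
    rw [pow_succ]
    nlinarith
  have hl : IsLeast {e : ℕ | 1 ≤ e ∧ 1 ≤ 2 ^ e * ε} (sInf {e : ℕ | 1 ≤ e ∧ 1 ≤ 2 ^ e * ε}) :=
    ⟨Nat.sInf_mem hne, fun _ h => Nat.sInf_le h⟩
  refine ⟨_, hl, ?_⟩
  generalize sInf {e : ℕ | 1 ≤ e ∧ 1 ≤ 2 ^ e * ε} = e at hl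
  obtain ⟨⟨he1, -⟩, hmin⟩ := hl
  obtain ⟨m, rfl⟩ : ∃ m, e = m + 1 := ⟨e - 1, by omega⟩
  have hm : (2 : ℝ) ^ m ≤ 1 / ε := by
    rcases Nat.eq_zero_or_pos m with rfl | hm
    · norm_num at ha ⊢; linarith
    · by_contra h
      rw [not_le, div_lt_iff₀ hε] at h
      have : m + 1 ≤ m := hmin ⟨hm, h.le⟩
      omega
  rw [pow_succ, pow_two]
  gcongr

/-! ### Spaces with several points and with one point -/

section Answers

variable {X : Type*} [Fintype X] [DecidableEq X] [MetricSpace X] {n : ℕ} {pt : Fin n ≃ X}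
  {F : Clustering X → Prop} {k : ℕ} {ε b : ℝ} {E : Env} {fair : Bool} {T : ℕ}

/-- Let `Y = (1 / ε) ^ (k * d)`. Since `1 ≤ d`, `2 ^ (k * e) ≤ Y ^ 2`; so `k` and `e` are at most `Y
^ 2`, the net has at most `Y ^ 18` points, and `5 ≤ 2 ^ 3` bounds the number of strings by `Y ^
384`. The choice `w = Y ^ 384` in `mainTime_le` gives `384 * 18 = 6912`. -/
theorem program_large (hn : 2 ≤ n) (hk : 1 ≤ k) (hε : 0 < ε) (hε2 : ε ≤ 1 / 2)
    (hm : Mergeable F k) (hd : E.dist = ptDist pt) (hE : E.Local (n + k + 1))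
    (hc : Checks E (n + k + 1) fair pt F k b T) {N : ℝ} (hN : (n : ℝ) ≤ N)
    (hT : (T : ℝ) ≤ 70 * k * N) :
    ∃ t σ, Exec E (program fair) (initState n k ε b) t σ ∧ Answers pt F k ε σ ∧
      (t : ℝ) ≤ (1 / ε) ^ ((6912 : ℝ) * k * doublingDim X) * N := by
  obtain ⟨e, he, he2⟩ := exists_isLeast_exponent hε hε2
  set d := doublingDim X with hdd
  have hd1 : 1 ≤ d := by
    have : Nontrivial X := by
      have : Nontrivial (Fin n) := Fin.nontrivial_iff_two_le.2 hn
      exact pt.symm.nontrivial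
    exact one_le_doublingDim
  have ha : 2 ≤ 1 / ε := by rw [le_div_iff₀ hε]; linarith
  set a := 1 / ε with ha'
  have hk' : (1 : ℝ) ≤ k := by exact_mod_cast hk
  have he1 : 1 ≤ e := he.1.1
  set Y := a ^ ((k : ℝ) * d) with hY
  have hY2 : 2 ≤ Y := by
    calc 2 ≤ a := ha
      _ = a ^ (1 : ℝ) := (Real.rpow_one a).symm
      _ ≤ Y := Real.rpow_le_rpow_of_exponent_le (by linarith) (by nlinarith)
  have hY1 : 1 ≤ Y := by linarith
  have hU : (2 : ℝ) ^ (k * e) ≤ a ^ (2 * k) := by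
    rw [mul_comm k e, pow_mul, pow_mul]
    gcongr
  have hUd : ((2 : ℝ) ^ (k * e)) ^ d ≤ Y ^ 2 := by
    calc ((2 : ℝ) ^ (k * e)) ^ d ≤ (a ^ (2 * k)) ^ d := by gcongr
      _ = Y ^ 2 := by
        rw [hY, ← Real.rpow_natCast, ← Real.rpow_natCast, ← Real.rpow_mul (by linarith),
          ← Real.rpow_mul (by linarith)]
        push_cast
        ring_nf
  have hU2 : (2 : ℝ) ^ (k * e) ≤ Y ^ 2 :=
    (Real.self_le_rpow_of_one_le (one_le_pow₀ (by norm_num)) hd1).trans hUd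
  have hke : ((k * e : ℕ) : ℝ) ≤ Y ^ 2 :=
    le_trans (by exact_mod_cast Nat.lt_two_pow_self.le) hU2
  have hkY : (k : ℝ) ≤ Y ^ 2 :=
    le_trans (by exact_mod_cast Nat.le_mul_of_pos_right k he1) hke
  have heY : (e : ℝ) ≤ Y ^ 2 :=
    le_trans (by exact_mod_cast Nat.le_mul_of_pos_left e hk) hke
  have hball : ((2 : ℝ) ^ d) ^ (6 + k + e) ≤ Y ^ 16 := by
    calc ((2 : ℝ) ^ d) ^ (6 + k + e) ≤ ((2 : ℝ) ^ d) ^ (8 * (k * e)) := by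
          refine pow_le_pow_right₀ (Real.one_le_rpow (by norm_num) (by linarith)) ?_
          nlinarith
      _ = (((2 : ℝ) ^ (k * e)) ^ d) ^ 8 := by
          rw [mul_comm, pow_mul, Real.rpow_pow_comm (by norm_num)]
      _ ≤ (Y ^ 2) ^ 8 := by gcongr
      _ = Y ^ 16 := by ring
  have h5 : (5 : ℝ) ^ (64 * (k * e)) ≤ Y ^ 384 := by
    calc (5 : ℝ) ^ (64 * (k * e)) ≤ (2 ^ 3) ^ (64 * (k * e)) := by gcongr; norm_num
      _ = ((2 : ℝ) ^ (k * e)) ^ 192 := by rw [← pow_mul, ← pow_mul]; ring_nf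
      _ ≤ (Y ^ 2) ^ 192 := by gcongr
      _ = Y ^ 384 := by rw [← pow_mul]
  have hw : ∀ {c : ℕ}, c ≤ 384 → Y ^ c ≤ Y ^ 384 := fun h => pow_le_pow_right₀ hY1 h
  set B := ⌊(k : ℝ) * ((2 : ℝ) ^ d) ^ (6 + k + e)⌋₊ with hB
  obtain ⟨t, σ, h1, h2, h3⟩ := program_spec (E := E) (pt := pt) (F := F) (k := k) (k₀ := k)
    (e := e) (T := T) (B := B) (ε := ε) (ε₀ := ε) (b := b) (fair := fair)
    ⟨hd, by omega, hk, hε, he1, he.1.2, by omega, by omega, hm, hc⟩ hE he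
    (fun g R cen hcen hg M net hlt hsep => Nat.le_floor
      (hcen.card_separated_le pt hε hk he.1.2 hg hlt hsep))
    (by rw [if_neg (by omega)]) (by rw [if_neg (by omega)])
  refine ⟨t, σ, h1, h2, ?_⟩
  have hN1 : 1 ≤ N := le_trans (by exact_mod_cast (by omega : 1 ≤ n)) hN
  have hW : (Y ^ 384) ^ 18 = a ^ ((6912 : ℝ) * k * d) := by
    rw [hY, ← pow_mul, ← Real.rpow_natCast, ← Real.rpow_mul (by linarith)]
    push_cast
    ring_nf
  rw [← hW]
  refine le_trans (by exact_mod_cast h3) (mainTime_le (w := Y ^ 384) ?_ hN1 hN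
    (hkY.trans (hw (by norm_num))) (heY.trans (hw (by norm_num))) ?_ ?_ h5 ?_)
  · exact hY2.trans (le_self_pow₀ hY1 (by norm_num))
  · refine le_trans ?_ h5
    exact_mod_cast (Nat.lt_pow_self (by norm_num : 1 < 5)).le
  · calc (B : ℝ) ≤ k * ((2 : ℝ) ^ d) ^ (6 + k + e) := Nat.floor_le (by positivity)
      _ ≤ Y ^ 2 * Y ^ 16 := by gcongr
      _ = Y ^ 18 := by ring
      _ ≤ Y ^ 384 := hw (by norm_num)
  · refine hT.trans ?_
    have := hkY.trans (hw (by norm_num : 2 ≤ 384))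
    gcongr

theorem card_parts_le_one [Subsingleton X] (𝒞 : Clustering X) : 𝒞.parts.card ≤ 1 := by
  rw [Finset.card_le_one]
  intro A hA B hB
  obtain ⟨x, hx⟩ := 𝒞.nonempty_of_mem_parts hA
  obtain ⟨y, hy⟩ := 𝒞.nonempty_of_mem_parts hB
  rw [Subsingleton.elim y x] at hy
  exact 𝒞.eq_of_mem_parts hA hB hx hy

theorem cost_of_subsingleton [Subsingleton X] (𝒞 : Clustering X) : cost 𝒞 = 0 :=
  Finset.sum_eq_zero fun _ _ => Metric.diam_subsingleton (Set.subsingleton_of_subsingleton)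

/-- All clusterings of one point cost `0` and have at most one cluster, so running with `k = 1` and
`ε = 1 / 2` gives an answer for the given parameters, in time independent of them. -/
theorem program_small (hn1 : 1 ≤ n) (hn : n < 2) (hk : 1 ≤ k)
    (hm : Mergeable F k) (hd : E.dist = ptDist pt) (hE : E.Local (n + k + 1))
    (hc : Checks E (n + k + 1) fair pt F 1 b T) (hT : 1 ≤ T) :
    ∃ t σ, Exec E (program fair) (initState n k ε b) t σ ∧ Answers pt F k ε σ ∧
      t ≤ 10 ^ 58 * T := by
  obtain rfl : n = 1 := by omega
  have : Subsingleton X := pt.symm.subsingleton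
  have hsol : ∀ 𝒞, IsSolution F 1 𝒞 ↔ IsSolution F k 𝒞 := fun 𝒞 =>
    and_congr_left fun _ => iff_of_true (card_parts_le_one 𝒞) ((card_parts_le_one 𝒞).trans hk)
  obtain ⟨t, σ, h1, h2, h3⟩ := program_spec (E := E) (pt := pt) (F := F) (k := 1) (k₀ := k)
    (e := 1) (T := T) (B := 1) (ε := 1 / 2) (ε₀ := ε) (b := b) (fair := fair)
    ⟨hd, le_rfl, le_rfl, by norm_num, le_rfl, by norm_num, by omega, by omega,
      fun 𝒞 𝒞' h h' => (hsol 𝒞').2 (hm 𝒞 𝒞' ((hsol 𝒞).1 h) h'), hc⟩ hE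
    ⟨⟨le_rfl, by norm_num⟩, fun _ h => h.1⟩
    (fun g R cen hcen hg M net hlt hsep => by
      by_contra hM
      -- Two net points in a one-point space coincide and cannot be separated.
      have h := hsep 1 (by omega) 0 (by omega)
      have e0 := hlt 0 (by omega)
      have e1 := hlt 1 (by omega)
      rw [show net 1 = net 0 by omega, ptDist_self] at h
      have := hcen.nonneg
      norm_num at h
      linarith)
    (by simp) (by simp)
  refine ⟨t, σ, h1, ⟨fun h => ?_, fun h => h2.2 (by simpa only [hsol] using h)⟩,
    h3.trans (mainTime_one_le hT)⟩
  obtain ⟨h4, h5, -⟩ := h2.1 (by simpa only [hsol] using h)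
  exact ⟨h4, (hsol _).1 h5, fun 𝒞 _ => by rw [cost_of_subsingleton, cost_of_subsingleton, mul_zero]⟩

/-- The first summand alone suffices for two or more points, the last one alone for a single point;
the middle one only has to be nonnegative. The value `10 ^ 60` exceeds both `6912` and `70 * 10 ^
58`. -/
theorem program_bound (hn : 1 ≤ n) (hk : 1 ≤ k) (hε : 0 < ε) (hε2 : ε ≤ 1 / 2)
    (hm : Mergeable F k) (hd : E.dist = ptDist pt) (hE : E.Local (n + k + 1)) {T : ℕ → ℕ} {c : ℕ}
    (hc60 : 10 ^ 60 ≤ c)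
    (hc : ∀ m, Checks E (n + k + 1) fair pt F m b (T m)) {N : ℝ} (hN : (n : ℝ) ≤ N)
    (hT0 : 1 ≤ T 1) (hT : ∀ m, 1 ≤ m → (T m : ℝ) ≤ 70 * m * N) :
    ∃ t σ, Exec E (program fair) (initState n k ε b) t σ ∧ Answers pt F k ε σ ∧
      (t : ℝ) ≤ (1 / ε) ^ ((c : ℝ) * k * doublingDim X) * N +
        2 ^ ((c : ℝ) * doublingDim X) * (n * Real.log n) +
          (c : ℝ) * k * N := by
  have hc' : (10 : ℝ) ^ 60 ≤ c := by exact_mod_cast hc60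
  have hN0 : 0 ≤ N := (Nat.cast_nonneg n).trans hN
  have hd0 : 0 ≤ doublingDim X := doublingDim_nonneg
  have ha : 1 ≤ 1 / ε := by rw [le_div_iff₀ hε]; linarith
  have hk' : (1 : ℝ) ≤ k := by exact_mod_cast hk
  have t1 : 0 ≤ (1 / ε) ^ ((c : ℝ) * k * doublingDim X) * N := by positivity
  have t2 : 0 ≤ (2 : ℝ) ^ ((c : ℝ) * doublingDim X) * (n * Real.log n) :=
    mul_nonneg (by positivity) (mul_nonneg (by positivity) (Real.log_natCast_nonneg n))
  have t3 : 0 ≤ (c : ℝ) * k * N := by positivity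
  rcases lt_or_ge n 2 with h2 | h2
  · obtain ⟨t, σ, h3, h4, h5⟩ := program_small (ε := ε) hn h2 hk hm hd hE (hc 1) hT0
    refine ⟨t, σ, h3, h4, ?_⟩
    have h6 : (t : ℝ) ≤ 10 ^ 58 * T 1 := by exact_mod_cast h5
    have h7 := hT 1 le_rfl
    have h8 : (t : ℝ) ≤ (c : ℝ) * k * N := by
      have h9 : (10 : ℝ) ^ 60 * 1 * N ≤ c * k * N := by gcongr
      rw [Nat.cast_one] at h7
      linarith
    linarith
  · obtain ⟨t, σ, h3, h4, h5⟩ := program_large h2 hk hε hε2 hm hd hE (hc k) hN (hT k hk)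
    refine ⟨t, σ, h3, h4, ?_⟩
    have h6 : (1 / ε) ^ ((6912 : ℝ) * k * doublingDim X) ≤
        (1 / ε) ^ ((c : ℝ) * k * doublingDim X) := by
      refine Real.rpow_le_rpow_of_exponent_le ha ?_
      gcongr
      linarith
    have := mul_le_mul_of_nonneg_right h6 hN0
    linarith

end Answers

end MSD

theorem mainTheorem9 :
    (∃ (p : MSD.Prog) (c : ℕ),
      ∀ (X : Type*) [Fintype X] [DecidableEq X] [MetricSpace X] (n : ℕ) (pt : Fin n ≃ X)
        (k : ℕ) (ε : ℝ) (F : MSD.Clustering X → Prop) (f : ℕ → ℕ),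
        1 ≤ n → 1 ≤ k → 0 < ε → ε ≤ 1 / 2 → MSD.Mergeable F k → (∀ m, m ≤ f m) →
        ∃ (t : ℕ) (σ : MSD.State),
          MSD.Exec (MSD.env pt (fun _ => 0) F (f n)) p (MSD.initState n k ε 0) t σ ∧
          MSD.Answers pt F k ε σ ∧
          (t : ℝ) ≤ (1 / ε) ^ ((c : ℝ) * k * MSD.doublingDim X) * f n
            + 2 ^ ((c : ℝ) * MSD.doublingDim X) * (n * Real.log n) + c * k * f n) ∧
    (∃ (p : MSD.Prog) (c : ℕ), p.OracleFree ∧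
      ∀ (X : Type*) [Fintype X] [DecidableEq X] [MetricSpace X] (n : ℕ) (pt : Fin n ≃ X)
        (k : ℕ) (ε : ℝ) (X₁ X₂ : Finset X) (b : ℝ),
        1 ≤ n → 1 ≤ k → 0 < ε → ε ≤ 1 / 2 → IsCompl X₁ X₂ → 0 ≤ b → b ≤ 1 →
        ∃ (t : ℕ) (σ : MSD.State),
          MSD.Exec (MSD.env pt (fun x => if x ∈ X₁ then 1 else 2) (fun _ => False) 0) p
            (MSD.initState n k ε b) t σ ∧
          MSD.Answers pt (MSD.Balanced X₁ X₂ b) k ε σ ∧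
          (t : ℝ) ≤ (1 / ε) ^ ((c : ℝ) * k * MSD.doublingDim X) * n
            + 2 ^ ((c : ℝ) * MSD.doublingDim X) * (n * Real.log n) + c * k * n) := by
  refine ⟨⟨MSD.program false, 10 ^ 60, ?_⟩,
    ⟨MSD.program true, 10 ^ 60, MSD.program_oracleFree, ?_⟩⟩
  · intro X _ _ _ n pt k ε F f hn hk hε hε2 hm hf
    have hfn : (n : ℝ) ≤ f n := by exact_mod_cast hf n
    refine MSD.program_bound (c := 10 ^ 60) (T := fun _ => f n) hn hk hε hε2 hm rfl (fun ℓ ℓ' h => ?_) le_rfl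
      (fun m => MSD.checks_validate pt F m 0 fun ℓ => Iff.rfl) hfn (hn.trans (hf n))
      fun m hm => ?_
    · change F (MSD.ofLabels pt ℓ) ↔ F (MSD.ofLabels pt ℓ')
      rw [MSD.ofLabels_congr pt ℓ fun i hi => h i (by omega)]
    · have : (1 : ℝ) ≤ m := by exact_mod_cast hm
      have : (0 : ℝ) ≤ f n := Nat.cast_nonneg _
      nlinarith
  · intro X _ _ _ n pt k ε X₁ X₂ b hn hk hε hε2 hX hb _
    refine MSD.program_bound (c := 10 ^ 60) (T := fun m => m * (n * 20 + 40) + 10) hn hk hε hε2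
      (MSD.mergeable_balanced hb k) rfl (fun _ _ _ => Iff.rfl) le_rfl
      (fun m => MSD.checks_fair pt hX m b (fun y => ?_) (by omega)) le_rfl (by omega)
      fun m hm => ?_
    · by_cases hy : y ∈ X₁ <;> simp [MSD.env, hy]
    · have : m * (n * 20 + 40) + 10 ≤ 70 * m * n := by
        have := Nat.mul_le_mul hm hn
        have := Nat.mul_le_mul_left m hn
        nlinarith
      exact_mod_cast this
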